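/- **Theorem (Contraction for the BU discretization scheme).** *Potential.* Let $\kappa>0$, $R\ge 0$, let $U:\mathbb R^d\to\mathbb R$ be differentiable with $L$-Lipschitz gradient and $(\nabla U(x)-\nabla U(y))\cdot(x-y)\ge\kappa|x-y|^2$ whenever $|x-y|>R$. Let $U(x)=\tfrac12x^TKx+G(x)$, where $K$ is symmetric with smallest eigenvalue $\kappa$, $L_K=\|K\|$ is the Lipschitz constant of $x\mapsto Kx$, $\nabla G$ is $L_G$-Lipschitz, and $(\nabla G(x)-\nabla G(y))\cdot(x-y)\ge0$ whenever $|x-y|>R$. *Distance.* For $\gamma>0$ put $\tau=\min(\tfrac18,\tfrac{\kappa}{4\gamma^2})$, $\alpha=2L\gamma^{-2}$, $\epsilon=\tfrac12\min(1,\tfrac{2\alpha}{3\sqrt{L_K}\gamma^{-1}},\alpha)$, $\mathcal E=\min(\tfrac{\sqrt\kappa\gamma^{-1}}{\sqrt8\,\alpha},\tfrac12)$, $\mathcal R=\tau^{-1}L_GR^2\gamma^{-2}$. For states $(x,v),(x',v')\in\mathbb R^{2d}$ with $z=x-x'$, $w=v-v'$ let $$r_l^2=\gamma^{-2}z^TKz+\tfrac12|(1-2\tau)z+\gamma^{-1}w|^2+\tfrac12\gamma^{-2}|w|^2,\quad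 r_s=\alpha|z|+|z+\gamma^{-1}w|,\quad \Delta=r_s-\epsilon r_l .$$ Let $\mathcal K=\{(z,w):\kappa\gamma^{-2}|z|^2+\tfrac12|z+\gamma^{-1}w|^2+\tfrac12|\gamma^{-1}w|^2\le\mathcal R\}$, $D_{\mathcal K}=\sup_{(z,w)\in\mathcal K}\Delta$, $R_1=\sup_{\Delta\le D_{\mathcal K}}r_s$, and $$\rho=f\big(\min(\Delta,D_{\mathcal K})+\epsilon r_l\big),\qquad f(r)=\int_0^r\phi(s)\psi(s)\,ds,$$ with $\phi(s)=\exp(-64\,\alpha\gamma^2(s\wedge R_1)^2)$, $\Phi(s)=\int_0^s\phi(x)\,dx$, $\hat c^{-1}=\gamma\int_0^{R_1}\Phi(s)\phi(s)^{-1}ds$ and $\psi(s)=1-\tfrac{\hat c\gamma}2\int_0^{s\wedge R_1}\Phi(x)\phi(x)^{-1}dx$. If $R_1=0$, then $\hat c=+\infty$, $\psi=1$, and bounds by $1/R_1^2$ are vacuous. *Coupled BU chain.* Let $h>0$, $\eta=e^{-\gamma h}$. One BU step maps $(x,v)$ to $\mathcal U(\mathcal B(x,v))$, where $\mathcal B(x,v)=(x,v-h\nabla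 U(x))$ and $$\mathcal U(x,v)=\Big(x+\tfrac{1-\eta}{\gamma}v+\sqrt{\tfrac2\gamma}(\mathcal Z^{(1)}-\mathcal Z^{(2)}),\ \eta v+\sqrt{2\gamma}\,\mathcal Z^{(2)}\Big),$$ $\mathcal Z^{(1)}=\sqrt h\,\xi^{(1)}$, $\mathcal Z^{(2)}=\sqrt{\tfrac{1-\eta^2}{2\gamma}}\big(\sqrt{a}\,\xi^{(1)}+\sqrt{1-a}\,\xi^{(2)}\big)$, $a=\tfrac{1-\eta}{1+\eta}\tfrac{2}{\gamma h}$. In each step, independently of the past, let $\xi^{(1)},\xi^{(2)}\sim\mathcal N(0,I_d)$ and $u\sim\mathrm{Unif}[0,1]$ be independent. The first copy $(X_k,V_k)$ uses $(\xi^{(1)},\xi^{(2)})$ and the second copy $(X_k',V_k')$ uses $(\xi^{(1)\prime},\xi^{(2)})$. Here $\xi^{(1)\prime}=\xi^{(1)}$ if $D_{\mathcal K}+\epsilon r_l\le r_s$ at the current pair of states. Otherwise, with $\beta=1/\sqrt{2\gamma^{-1}h}$, $q=z+\gamma^{-1}w$, $e=q/|q|$ ($e=0$ if $q=0$) and $\varphi$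 the standard normal density, $$\xi^{(1)\prime}=\begin{cases}\xi^{(1)}+\beta q&\text{if }u\le\varphi(e\cdot\xi^{(1)}+\beta|q|)/\varphi(e\cdot\xi^{(1)}),\\ \xi^{(1)}-2(e\cdot\xi^{(1)})e&\text{otherwise.}\end{cases}$$ *Conclusion.* Assume $$\gamma\ge\sqrt{13L_G^2/\kappa},\qquad L\gamma^{-1}h\le\min\Big(\frac1{8LR_1^2},\frac1{256\cdot75(2L\gamma^{-2}+1)},\frac{L\gamma^{-2}}{15},\frac{L}{55L_K}\Big).$$ Then $\rho$ is a distance on $\mathbb R^{2d}$, and for all deterministic initial points $(x,v),(x',v')\in\mathbb R^{2d}$ and all $k\in\mathbb N$ the random variable below is integrable and $$\mathbb E\big[\rho((X_k,V_k),(X_k',V_k'))\big]\le(1-ch)^k\rho((x,v),(x',v')),$$ where $$c=\min\Big(f'(R_1)\tfrac{7\epsilon\kappa\gamma^{-1}}{96}\mathcal E,\ f'(R_1)\tfrac{7\epsilon\gamma}{256}\mathcal E,\ f'(R_1)e^{-\gamma h}\tfrac{\gamma}{16},\ f'(R_1)e^{-\gamma h}\tfrac{\gamma\alpha}4,\ \tfrac{9\hat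 c}{640},\ \tfrac{\hat c}{32(4\alpha+1)}\Big)$$ satisfies $c>0$ and $ch<1$. The construction of $\rho$ and the constants $D_{\mathcal K},R_1,\epsilon,\mathcal E,\alpha$ do not involve $h$, and these constants do not depend on $d$: they are the same for every dimension $d'$ and every symmetric $K'$ on $\mathbb R^{d'}$ with smallest eigenvalue $\kappa$ and norm $L_K$ (the other parameters being fixed). Consequently $c$ does not depend on $d$, and it depends on $h$ only through the factor $e^{-\gamma h}$. -/

import Mathlib

open MeasureTheory ProbabilityTheory Set
open scoped RealInnerProductSpace

namespace KineticBU

/-- The configuration space `ℝ^d`. -/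
abbrev Pos (d : ℕ) : Type := EuclideanSpace ℝ (Fin d)

/-- The phase space `ℝ^{2d}` of pairs (position, velocity). -/
abbrev State (d : ℕ) : Type := Pos d × Pos d

/-- The scalar data of the problem: the convexity constant `κ`, the radius `R`, the Lipschitz
constants `L`, `LG`, `LK` of `∇U`, `∇G`, `x ↦ K x`, and the friction `γ`. -/
structure Params where
  κ : ℝ
  R : ℝ
  L : ℝ
  LG : ℝ
  LK : ℝ
  γ : ℝ

/-! ### The potential -/

/-- `U` is differentiable, `∇U` is `L`-Lipschitz, and `U` is `κ`-strongly convex outside a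
Euclidean ball of radius `R`. -/
structure PotentialAssumption {d : ℕ} (U : Pos d → ℝ) (κ R L : ℝ) : Prop where
  κ_pos : 0 < κ
  R_nonneg : 0 ≤ R
  differentiable : Differentiable ℝ U
  lipschitz : ∀ x y, ‖gradient U x - gradient U y‖ ≤ L * ‖x - y‖
  strongly_convex : ∀ x y, R < ‖x - y‖ →
    κ * ‖x - y‖ ^ 2 ≤ ⟪gradient U x - gradient U y, x - y⟫

/-- `K` is symmetric with smallest eigenvalue `κ`, and `LK` is the Lipschitz constant
(operator norm) of `x ↦ K x`. -/
structure IsQuadraticPart {d : ℕ} (K : Pos d →L[ℝ] Pos d) (κ LK : ℝ) : Prop where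
  symmetric : (K : Pos d →ₗ[ℝ] Pos d).IsSymmetric
  smallest : IsLeast {m : ℝ | Module.End.HasEigenvalue (K : Pos d →ₗ[ℝ] Pos d) m} κ
  lipschitz : ‖K‖ = LK

/-- The splitting `U(x) = ½ xᵀ K x + G(x)`: `G` is convex outside a Euclidean ball of
radius `R` and `∇G` is `LG`-Lipschitz. -/
structure IsSplitting {d : ℕ} (U : Pos d → ℝ) (K : Pos d →L[ℝ] Pos d) (G : Pos d → ℝ)
    (P : Params) : Prop where
  split : ∀ x, U x = 1 / 2 * ⟪x, K x⟫ + G x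
  quadratic : IsQuadraticPart K P.κ P.LK
  monotone : ∀ x y, P.R < ‖x - y‖ → 0 ≤ ⟪gradient G x - gradient G y, x - y⟫
  lipschitz : ∀ x y, ‖gradient G x - gradient G y‖ ≤ P.LG * ‖x - y‖

/-! ### The constants -/

noncomputable def tau (P : Params) : ℝ := min (1 / 8) (P.γ⁻¹ ^ 2 * P.κ / 4)

noncomputable def alpha (P : Params) : ℝ := 2 * P.L * P.γ⁻¹ ^ 2

noncomputable def eps (P : Params) : ℝ :=
  1 / 2 * min 1 (min (2 * alpha P / (3 * √P.LK * P.γ⁻¹)) (alpha P))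

noncomputable def calE (P : Params) : ℝ := min (√P.κ * P.γ⁻¹ / (√8 * alpha P)) (1 / 2)

noncomputable def calR (P : Params) : ℝ := (tau P)⁻¹ * P.LG * P.R ^ 2 * P.γ⁻¹ ^ 2

/-! ### The distance -/

/-- The twisted 2-norm distance `r_l`. -/
noncomputable def rl {d : ℕ} (P : Params) (K : Pos d →L[ℝ] Pos d) (s s' : State d) : ℝ :=
  √(P.γ⁻¹ ^ 2 * ⟪s.1 - s'.1, K (s.1 - s'.1)⟫
    + 1 / 2 * ‖(1 - 2 * tau P) • (s.1 - s'.1) + P.γ⁻¹ • (s.2 - s'.2)‖ ^ 2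
    + 1 / 2 * P.γ⁻¹ ^ 2 * ‖s.2 - s'.2‖ ^ 2)

/-- The distance `r_s`. -/
noncomputable def rs {d : ℕ} (P : Params) (s s' : State d) : ℝ :=
  alpha P * ‖s.1 - s'.1‖ + ‖(s.1 - s'.1) + P.γ⁻¹ • (s.2 - s'.2)‖

noncomputable def Delta {d : ℕ} (P : Params) (K : Pos d →L[ℝ] Pos d) (s s' : State d) : ℝ :=
  rs P s s' - eps P * rl P K s s'

/-- The compact set `𝒦` of differences `(z, w)`. -/
def compactSet (d : ℕ) (P : Params) : Set (State d) :=
  {p | P.κ * P.γ⁻¹ ^ 2 * ‖p.1‖ ^ 2 + 1 / 2 * ‖p.1 + P.γ⁻¹ • p.2‖ ^ 2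
    + 1 / 2 * ‖P.γ⁻¹ • p.2‖ ^ 2 ≤ calR P}

/-- `D_𝒦`, the supremum of `Δ` over pairs of states with difference in `𝒦`. -/
noncomputable def DK {d : ℕ} (P : Params) (K : Pos d →L[ℝ] Pos d) : ℝ :=
  sSup {t | ∃ s s' : State d, s - s' ∈ compactSet d P ∧ t = Delta P K s s'}

/-- `R₁`, the supremum of `r_s` over pairs of states with `Δ ≤ D_𝒦`. -/
noncomputable def R1 {d : ℕ} (P : Params) (K : Pos d →L[ℝ] Pos d) : ℝ :=
  sSup {t | ∃ s s' : State d, Delta P K s s' ≤ DK P K ∧ t = rs P s s'}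

noncomputable def phi (P : Params) (R₁ s : ℝ) : ℝ :=
  Real.exp (-128 * alpha P * P.γ ^ 2 * ((min s R₁) ^ 2 / 2))

noncomputable def Phi (P : Params) (R₁ s : ℝ) : ℝ := ∫ x in (0 : ℝ)..s, phi P R₁ x

/-- The constant `ĉ`. It is `+∞` on paper when `R₁ = 0`; see `rate`. -/
noncomputable def chat (P : Params) (R₁ : ℝ) : ℝ :=
  1 / (P.γ * ∫ s in (0 : ℝ)..R₁, Phi P R₁ s * (phi P R₁ s)⁻¹)

/-- The function `ψ`. For `R₁ = 0` the integral vanishes and `ψ = 1`. -/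
noncomputable def psi (P : Params) (R₁ s : ℝ) : ℝ :=
  1 - chat P R₁ / 2 * P.γ * ∫ x in (0 : ℝ)..(min s R₁), Phi P R₁ x * (phi P R₁ x)⁻¹

/-- The concave function `f`. -/
noncomputable def f (P : Params) (R₁ r : ℝ) : ℝ :=
  ∫ s in (0 : ℝ)..r, phi P R₁ s * psi P R₁ s

/-- The distance `ρ = f(min(Δ, D_𝒦) + ε r_l)`. -/
noncomputable def rho {d : ℕ} (P : Params) (K : Pos d →L[ℝ] Pos d) (s s' : State d) : ℝ :=
  f P (R1 P K) (min (Delta P K s s') (DK P K) + eps P * rl P K s s')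

/-- The axioms of a distance function. -/
structure IsDistance {S : Type*} (D : S → S → ℝ) : Prop where
  nonneg : ∀ s t, 0 ≤ D s t
  eq_zero_iff : ∀ s t, D s t = 0 ↔ s = t
  symm : ∀ s t, D s t = D t s
  triangle : ∀ s t u, D s u ≤ D s t + D t u

/-! ### The contraction rate and the step size condition -/

/-- The four terms of the rate that do not involve `ĉ`. -/
noncomputable def rateBase (P : Params) (R₁ h : ℝ) : ℝ :=
  min (min (deriv (f P R₁) R₁ * (7 * eps P * P.κ * P.γ⁻¹ / 96) * calE P)
      (deriv (f P R₁) R₁ * (7 * eps P * P.γ / 256) * calE P))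
    (min (deriv (f P R₁) R₁ * Real.exp (-P.γ * h) * (P.γ / 16))
      (deriv (f P R₁) R₁ * Real.exp (-P.γ * h) * (P.γ * alpha P / 4)))

/-- The contraction rate `c`. When `R₁ = 0` one has `ĉ = +∞`, so the last two terms of the
minimum are absent. -/
noncomputable def rate (P : Params) (R₁ h : ℝ) : ℝ :=
  open Classical in
  if R₁ = 0 then rateBase P R₁ h
  else min (rateBase P R₁ h)
    (min (9 * chat P R₁ / 640) (chat P R₁ / (32 * (4 * alpha P + 1))))

/-- The step size condition. The bound `L γ⁻¹ h ≤ 1 / (8 L R₁²)` is vacuous when `R₁ = 0`. -/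
def StepSizeCondition (P : Params) (R₁ h : ℝ) : Prop :=
  (R₁ ≠ 0 → P.L * P.γ⁻¹ * h ≤ 1 / (8 * P.L * R₁ ^ 2)) ∧
  P.L * P.γ⁻¹ * h ≤ 1 / (256 * 75 * (2 * P.L * P.γ⁻¹ ^ 2 + 1)) ∧
  P.L * P.γ⁻¹ * h ≤ P.L * P.γ⁻¹ ^ 2 / 15 ∧
  P.L * P.γ⁻¹ * h ≤ P.L / (55 * P.LK)

/-! ### The BU scheme -/

/-- The `ℬ` step. -/
noncomputable def stepB {d : ℕ} (U : Pos d → ℝ) (h : ℝ) (s : State d) : State d :=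
  (s.1, s.2 - h • gradient U s.1)

noncomputable def Z1 {d : ℕ} (h : ℝ) (ξ₁ : Pos d) : Pos d := √h • ξ₁

noncomputable def Z2 {d : ℕ} (γ h : ℝ) (ξ₁ ξ₂ : Pos d) : Pos d :=
  let η := Real.exp (-γ * h)
  √((1 - η ^ 2) / (2 * γ)) •
    (√((1 - η) / (1 + η) * (2 / (γ * h))) • ξ₁
      + √(1 - (1 - η) / (1 + η) * (2 / (γ * h))) • ξ₂)

/-- The `𝒰` step. -/
noncomputable def stepU {d : ℕ} (γ h : ℝ) (s : State d) (ξ₁ ξ₂ : Pos d) : State d :=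
  let η := Real.exp (-γ * h)
  (s.1 + ((1 - η) / γ) • s.2 + √(2 / γ) • (Z1 h ξ₁ - Z2 γ h ξ₁ ξ₂),
    η • s.2 + √(2 * γ) • Z2 γ h ξ₁ ξ₂)

/-- One step of the BU scheme: a `ℬ` step followed by a `𝒰` step. -/
noncomputable def stepBU {d : ℕ} (U : Pos d → ℝ) (γ h : ℝ) (s : State d) (ξ₁ ξ₂ : Pos d) :
    State d :=
  stepU γ h (stepB U h s) ξ₁ ξ₂

/-! ### The coupling -/

/-- The contractive coupling of `ξ'` to `ξ`, given `q` and the uniform variable `u`. If `q = 0`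
then `e = 0` and `ξ' = ξ`. -/
noncomputable def contractiveNoise {d : ℕ} (γ h : ℝ) (q ξ : Pos d) (u : ℝ) : Pos d :=
  let β : ℝ := 1 / √(2 * γ⁻¹ * h)
  let e : Pos d := ‖q‖⁻¹ • q
  open Classical in
  if u ≤ gaussianPDFReal 0 1 (⟪e, ξ⟫ + β * ‖q‖) / gaussianPDFReal 0 1 ⟪e, ξ⟫ then ξ + β • q
  else ξ - (2 * ⟪e, ξ⟫) • e

/-- The first noise of the second copy: synchronous if `D_𝒦 + ε r_l ≤ r_s`, contractive
otherwise. -/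
noncomputable def coupledNoise {d : ℕ} (P : Params) (K : Pos d →L[ℝ] Pos d) (h : ℝ)
    (s s' : State d) (ξ₁ : Pos d) (u : ℝ) : Pos d :=
  open Classical in
  if DK P K + eps P * rl P K s s' ≤ rs P s s' then ξ₁
  else contractiveNoise P.γ h ((s.1 - s'.1) + P.γ⁻¹ • (s.2 - s'.2)) ξ₁ u

/-- One step of the coupled chain, driven by the noise `n = (ξ₁, ξ₂, u)`; the second noise is
always coupled synchronously. -/
noncomputable def coupledStep {d : ℕ} (U : Pos d → ℝ) (K : Pos d →L[ℝ] Pos d) (P : Params)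
    (h : ℝ) (p : State d × State d) (n : Pos d × Pos d × ℝ) : State d × State d :=
  (stepBU U P.γ h p.1 n.1 n.2.1,
    stepBU U P.γ h p.2 (coupledNoise P K h p.1 p.2 n.1 n.2.2) n.2.1)

/-- The coupled chain `((X_k, V_k), (X'_k, V'_k))` started at `p`; the noise `N k` drives the
step from time `k` to time `k + 1`. -/
noncomputable def coupledChain {d : ℕ} {Ω : Type*} (U : Pos d → ℝ) (K : Pos d →L[ℝ] Pos d)
    (P : Params) (h : ℝ) (p : State d × State d) (N : ℕ → Ω → Pos d × Pos d × ℝ) :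
    ℕ → Ω → State d × State d
  | 0, _ => p
  | k + 1, ω => coupledStep U K P h (coupledChain U K P h p N k ω) (N k ω)

/-- The law of `(ξ₁, ξ₂, u)`: two standard Gaussian vectors and a uniform variable on `[0,1]`,
independent of each other. -/
noncomputable def noiseLaw (d : ℕ) : Measure (Pos d × Pos d × ℝ) :=
  (stdGaussian (Pos d)).prod ((stdGaussian (Pos d)).prod (volume.restrict (Icc (0 : ℝ) 1)))

end KineticBU

/-! Write `z = x - x'`, `q = z + γ⁻¹(v - v')`, `σ = √(2h/γ)`, and let `θ` be `γ⁻¹h` times the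
gradient difference. One coupled step is linear in these: `q` becomes `q - θ + σ(ξ - ξ')`, while `z`
relaxes towards `q` at rate `damping` and receives only the small fraction `defect` of the noise.
Moreover `ρ = f(min(r_s, D_𝒦 + ε r_l))` (`rho_eq`), so there are two regimes, and the coupling is
chosen according to which argument of the minimum is active.

If `Δ ≥ D_𝒦`, the difference of the states lies outside the interior of `𝒦` (`calR_le_coreForm`).
There the possible non-convexity of `G`, at most `L_G R²`, is dominated by `τ` times the quadratic
form defining `𝒦`, and the synchronous step contracts `r_l²` by `1 - (7/12)γhτ`
(`rl_sq_synchronous_le`, resting on `quadratic_contraction`). Since `f' ≥ f'(R₁)` and `ρ ≤ r_s ≤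
r_l/ℰ`, this contracts `ρ` (`rho_synchronous_le`).

If `Δ < D_𝒦`, then `r_s ≤ R₁`. The coupled length `T = |q + σ(ξ - ξ')|` has mean `|q|`
(`integral_coupledDist`), and the next `r_s` is at most an affine function of `|z|`, `|q|` and `T`
(`rs_contractive_le`). When `|z| ≥ 4|q|` the damping of `z` suffices. Otherwise the mean of `r_s`
may grow by about `αγh|q|`, and the concavity of `f` must pay for it. If `|q| ≥ 0.7σ`, then `T`
falls by `0.85σ`, or to zero, with probability at least `0.33`, and the Gaussian factor `φ` supplies
the curvature. If `|q| ≤ 0.7σ`, the copies coalesce with probability at least `1 - (2/5)|q|/σ`, and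
one compares tangents of `f` at a point below `r_s` and at a point above it, the slopes differing
because of `φ`, or of `ψ` near `R₁` (`slope_drop`). In all cases an integrable majorant `H` is
exhibited (`exists_bound_contractive`).

All upper bounds on the rate come from `rateBase`: the terms with `ĉ` can only lower the rate. The
one-step bound is iterated through independence of the current state and the next noise. Dimension
independence holds because the suprema defining `D_𝒦` and `R₁` may be taken over pairs `z`, `q` that
are multiples of one extremal eigenvector. -/

namespace KineticBU

/-! ### The quadratic part -/

namespace IsQuadraticPart

variable {d : ℕ} {K : Pos d →L[ℝ] Pos d} {κ LK : ℝ}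

theorem inner_map_comm (hK : IsQuadraticPart K κ LK) (x y : Pos d) : ⟪x, K y⟫ = ⟪y, K x⟫ := by
  rw [real_inner_comm]
  exact hK.symmetric y x

theorem exists_unit_eigenvector (hK : IsQuadraticPart K κ LK) :
    ∃ e : Pos d, ‖e‖ = 1 ∧ ⟪e, K e⟫ = κ := by
  obtain ⟨v, hv⟩ := hK.smallest.1.exists_hasEigenvector
  have hv0 : ‖v‖ ≠ 0 := norm_ne_zero_iff.2 hv.2
  have hKv : K v = κ • v := hv.apply_eq_smul
  refine ⟨‖v‖⁻¹ • v, by rw [norm_smul, norm_inv, norm_norm, inv_mul_cancel₀ hv0], ?_⟩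
  rw [map_smul, hKv, inner_smul_left, inner_smul_right, inner_smul_right,
    real_inner_self_eq_norm_sq]
  simp only [conj_trivial]
  field_simp

theorem nontrivial (hK : IsQuadraticPart K κ LK) : Nontrivial (Pos d) := by
  obtain ⟨e, he, -⟩ := hK.exists_unit_eigenvector
  exact ⟨e, 0, fun h => by simp [h] at he⟩

/-- In finite dimension the infimum of the Rayleigh quotient is itself an eigenvalue, hence at least
`κ`. -/
theorem mul_norm_sq_le_inner (hK : IsQuadraticPart K κ LK) (z : Pos d) :
    κ * ‖z‖ ^ 2 ≤ ⟪z, K z⟫ := by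
  have := hK.nontrivial
  by_cases hz : z = 0
  · simp [hz]
  have hev := hK.symmetric.hasEigenvalue_iInf_of_finiteDimensional
  have h1 := hK.smallest.2 hev
  have hz' : 0 < ‖z‖ ^ 2 := by positivity
  set T : Pos d →ₗ[ℝ] Pos d := (K : Pos d →ₗ[ℝ] Pos d) with hT
  have hbdd : BddBelow (range fun x : { x : Pos d // x ≠ 0 } =>
      RCLike.re ⟪T x, (x : Pos d)⟫ / ‖(x : Pos d)‖ ^ 2) := by
    refine ⟨-‖K‖, ?_⟩
    rintro _ ⟨x, rfl⟩
    have hx : 0 < ‖(x : Pos d)‖ ^ 2 := by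
      have := norm_pos_iff.2 x.2
      positivity
    show _ ≤ _ / _
    rw [le_div_iff₀ hx]
    have h2 := abs_real_inner_le_norm (K x) (x : Pos d)
    have h3 := K.le_opNorm (x : Pos d)
    have h4 : -(‖K (x : Pos d)‖ * ‖(x : Pos d)‖) ≤ ⟪K x, (x : Pos d)⟫ := (abs_le.1 h2).1
    have h5 : ‖K (x : Pos d)‖ * ‖(x : Pos d)‖ ≤ ‖K‖ * ‖(x : Pos d)‖ * ‖(x : Pos d)‖ :=
      mul_le_mul_of_nonneg_right h3 (norm_nonneg _)
    show -‖K‖ * ‖(x : Pos d)‖ ^ 2 ≤ ⟪K x, (x : Pos d)⟫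
    nlinarith
  have h2 := h1.trans (ciInf_le hbdd ⟨z, hz⟩)
  have h3 : κ ≤ ⟪K z, z⟫ / ‖z‖ ^ 2 := h2
  rw [le_div_iff₀ hz'] at h3
  rwa [real_inner_comm]

theorem inner_nonneg (hK : IsQuadraticPart K κ LK) (hκ : 0 < κ) (z : Pos d) : 0 ≤ ⟪z, K z⟫ :=
  le_trans (by positivity) (hK.mul_norm_sq_le_inner z)

theorem inner_le_mul_norm_sq (hK : IsQuadraticPart K κ LK) (z : Pos d) :
    ⟪z, K z⟫ ≤ LK * ‖z‖ ^ 2 := by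
  have h1 := real_inner_le_norm z (K z)
  have h2 := K.le_opNorm z
  rw [hK.lipschitz] at h2
  nlinarith [norm_nonneg z]

theorem le_norm (hK : IsQuadraticPart K κ LK) : κ ≤ LK := by
  obtain ⟨e, he, hKe⟩ := hK.exists_unit_eigenvector
  have := hK.inner_le_mul_norm_sq e
  simpa [he, hKe] using this

/-- The Cauchy–Schwarz inequality for the form `⟪x, K y⟫`. -/
theorem inner_sq_le (hK : IsQuadraticPart K κ LK) (hκ : 0 < κ) (x y : Pos d) :
    ⟪x, K y⟫ ^ 2 ≤ ⟪x, K x⟫ * ⟪y, K y⟫ := by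
  have h (t : ℝ) : 0 ≤ ⟪y, K y⟫ * (t * t) + 2 * ⟪x, K y⟫ * t + ⟪x, K x⟫ := by
    have h1 := hK.inner_nonneg hκ (x + t • y)
    rw [map_add, map_smul, inner_add_left, inner_add_right, inner_add_right, inner_smul_left,
      inner_smul_right, inner_smul_left, inner_smul_right, hK.inner_map_comm y x] at h1
    simp only [conj_trivial] at h1
    linarith
  have := discrim_le_zero h
  rw [discrim] at this
  nlinarith

/-- Cauchy–Schwarz for the form of `K` at the pair `K z`, `z` bounds `‖K z‖⁴` by `LK ‖K z‖² ⟪z, K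
z⟫`; divide by `‖K z‖²`. -/
theorem norm_map_sq_le (hK : IsQuadraticPart K κ LK) (hκ : 0 < κ) (z : Pos d) :
    ‖K z‖ ^ 2 ≤ LK * ⟪z, K z⟫ := by
  have h1 := hK.inner_sq_le hκ (K z) z
  rw [real_inner_self_eq_norm_sq] at h1
  have h2 := hK.inner_le_mul_norm_sq (K z)
  have h3 := hK.inner_nonneg hκ z
  by_cases h0 : ‖K z‖ = 0
  · rw [h0]
    have := hK.le_norm
    rw [zero_pow two_ne_zero]
    exact mul_nonneg (by linarith) h3
  · have h4 : 0 < ‖K z‖ ^ 2 := by positivity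
    have h5 : ⟪K z, K (K z)⟫ * ⟪z, K z⟫ ≤ LK * ‖K z‖ ^ 2 * ⟪z, K z⟫ :=
      mul_le_mul_of_nonneg_right h2 h3
    nlinarith

/-- A maximiser of `‖K x‖` on the compact unit sphere attains the operator norm, and
`norm_map_sq_le` turns this into attainment of the quadratic form. -/
theorem exists_unit_top (hK : IsQuadraticPart K κ LK) (hκ : 0 < κ) :
    ∃ e : Pos d, ‖e‖ = 1 ∧ ⟪e, K e⟫ = LK := by
  obtain ⟨e₀, he₀, -⟩ := hK.exists_unit_eigenvector
  have hc : IsCompact (Metric.sphere (0 : Pos d) 1) := isCompact_sphere 0 1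
  obtain ⟨e, he, hmax⟩ := hc.exists_isMaxOn ⟨e₀, by simpa using he₀⟩
    (f := fun x => ‖K x‖) (by fun_prop)
  have he1 : ‖e‖ = 1 := by simpa using he
  have hLK : 0 < LK := hκ.trans_le hK.le_norm
  refine ⟨e, he1, le_antisymm (by simpa [he1] using hK.inner_le_mul_norm_sq e) ?_⟩
  have h1 : LK ≤ ‖K e‖ := by
    rw [← hK.lipschitz]
    refine K.opNorm_le_bound (norm_nonneg _) fun x => ?_
    by_cases hx : x = 0
    · simp [hx]
    have hx0 : ‖x‖ ≠ 0 := norm_ne_zero_iff.2 hx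
    have h2 : ‖K (‖x‖⁻¹ • x)‖ ≤ ‖K e‖ := hmax (by
      simp [norm_smul, inv_mul_cancel₀ hx0])
    rw [map_smul, norm_smul, norm_inv, norm_norm, inv_mul_le_iff₀ (by positivity)] at h2
    linarith
  have h2 := hK.norm_map_sq_le hκ e
  have h3 : LK * LK ≤ LK * ⟪e, K e⟫ := by nlinarith
  exact le_of_mul_le_mul_left h3 hLK

end IsQuadraticPart

/-! ### Admissible parameters -/

/-- The relations between the parameters that follow from the assumptions. -/
structure Params.Admissible (P : Params) : Prop where
  κ_pos : 0 < P.κ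
  γ_pos : 0 < P.γ
  L_pos : 0 < P.L
  LK_pos : 0 < P.LK
  LG_nonneg : 0 ≤ P.LG
  R_nonneg : 0 ≤ P.R
  LG_sq_le : 13 * P.LG ^ 2 ≤ P.κ * P.γ ^ 2

/-- The eigenvector for `κ` forces `d ≥ 1`. Two points at distance `R + 1` along it are subject to
both strong convexity and the Lipschitz bound, whence `L > 0`. -/
theorem Params.admissible {d : ℕ} {U G : Pos d → ℝ} {K : Pos d →L[ℝ] Pos d} {P : Params}
    (hU : PotentialAssumption U P.κ P.R P.L) (hG : IsSplitting U K G P) (hγ_pos : 0 < P.γ)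
    (hγ : √(13 * P.LG ^ 2 / P.κ) ≤ P.γ) : P.Admissible := by
  obtain ⟨e, he, -⟩ := hG.quadratic.exists_unit_eigenvector
  have hκ := hU.κ_pos
  have hR := hU.R_nonneg
  refine ⟨hκ, hγ_pos, ?_, hκ.trans_le hG.quadratic.le_norm, ?_, hR, ?_⟩
  · have hn : ‖(P.R + 1) • e - 0‖ = P.R + 1 := by
      rw [sub_zero, norm_smul, he, mul_one, Real.norm_of_nonneg (by linarith)]
    have h1 := hU.strongly_convex ((P.R + 1) • e) 0 (by rw [hn]; linarith)
    have h2 := hU.lipschitz ((P.R + 1) • e) 0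
    have h3 := real_inner_le_norm (gradient U ((P.R + 1) • e) - gradient U 0)
      ((P.R + 1) • e - 0)
    rw [hn] at h1 h2 h3
    have h4 : 0 < P.κ * (P.R + 1) ^ 2 := by positivity
    have h5 : 0 < P.L * (P.R + 1) * (P.R + 1) := by nlinarith
    by_contra h6
    push Not at h6
    nlinarith [sq_nonneg (P.R + 1)]
  · have h1 := hG.lipschitz e 0
    rw [sub_zero, he, mul_one] at h1
    exact (norm_nonneg _).trans h1
  · have h1 := (Real.sqrt_le_left hγ_pos.le).1 hγ
    rw [div_le_iff₀ hκ] at h1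
    linarith

/-! ### Elementary bounds on `τ`, `α`, `ε`, `ℰ` and `ℛ` -/

section Constants

variable {P : Params}

theorem tau_pos (hP : P.Admissible) : 0 < tau P := by
  have := hP.κ_pos
  have := hP.γ_pos
  rw [tau]
  positivity

theorem tau_le_eighth : tau P ≤ 1 / 8 := min_le_left _ _

theorem four_tau_le : 4 * tau P ≤ P.γ⁻¹ ^ 2 * P.κ := by
  have := min_le_right (1 / 8) (P.γ⁻¹ ^ 2 * P.κ / 4)
  rw [tau]
  linarith

theorem alpha_pos (hP : P.Admissible) : 0 < alpha P := by
  have := hP.L_pos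
  have := hP.γ_pos
  rw [alpha]
  positivity

theorem eps_pos (hP : P.Admissible) : 0 < eps P := by
  have := hP.LK_pos
  have := hP.γ_pos
  have := alpha_pos hP
  rw [eps]
  positivity

theorem two_eps_le_one : 2 * eps P ≤ 1 := by
  have := min_le_left 1 (min (2 * alpha P / (3 * √P.LK * P.γ⁻¹)) (alpha P))
  rw [eps]
  linarith

theorem two_eps_le_alpha : 2 * eps P ≤ alpha P := by
  have := (min_le_right 1 (min (2 * alpha P / (3 * √P.LK * P.γ⁻¹)) (alpha P))).trans
    (min_le_right _ _)
  rw [eps]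
  linarith

theorem two_eps_mul_le (hP : P.Admissible) : 2 * eps P * (3 * √P.LK * P.γ⁻¹) ≤ 2 * alpha P := by
  have := hP.LK_pos
  have := hP.γ_pos
  have h := (min_le_right 1 (min (2 * alpha P / (3 * √P.LK * P.γ⁻¹)) (alpha P))).trans
    (min_le_left _ _)
  rw [← le_div_iff₀ (by positivity), eps]
  linarith

theorem calE_pos (hP : P.Admissible) : 0 < calE P := by
  have := hP.κ_pos
  have := hP.γ_pos
  have := alpha_pos hP
  rw [calE]
  positivity

theorem calE_le_half : calE P ≤ 1 / 2 := min_le_right _ _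

theorem calE_mul_alpha_sq_le (hP : P.Admissible) :
    (calE P * alpha P) ^ 2 ≤ P.κ * P.γ⁻¹ ^ 2 / 8 := by
  have h0 := hP.κ_pos
  have := hP.γ_pos
  have := alpha_pos hP
  have h8 : (0 : ℝ) < √8 := by positivity
  have h1 : calE P ≤ √P.κ * P.γ⁻¹ / (√8 * alpha P) := min_le_left _ _
  have h2 : calE P * alpha P ≤ √P.κ * P.γ⁻¹ / √8 := by
    calc calE P * alpha P ≤ √P.κ * P.γ⁻¹ / (√8 * alpha P) * alpha P := by gcongr
      _ = _ := by field_simp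
  have h3 : 0 ≤ calE P * alpha P := by
    have := calE_pos hP
    positivity
  calc (calE P * alpha P) ^ 2 ≤ (√P.κ * P.γ⁻¹ / √8) ^ 2 := by gcongr
    _ = _ := by
      rw [div_pow, mul_pow, Real.sq_sqrt h0.le, Real.sq_sqrt (by norm_num)]

theorem calR_nonneg (hP : P.Admissible) : 0 ≤ calR P := by
  have := tau_pos hP
  have := hP.γ_pos
  have := hP.LG_nonneg
  rw [calR]
  positivity

end Constants

/-! ### The norms `r_l` and `r_s` -/

/-- Minkowski's inequality from the discriminant form of Cauchy–Schwarz. It yields the triangle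
inequality of `r_l` when applied to `twistedForm`. -/
theorem sqrt_bilinForm_add_le {E : Type*} [AddCommGroup E] [Module ℝ E]
    (B : LinearMap.BilinForm ℝ E) (h0 : ∀ x, 0 ≤ B x x) (hs : ∀ x y, B x y = B y x) (x y : E) :
    √(B (x + y) (x + y)) ≤ √(B x x) + √(B y y) := by
  have hB : B (x + y) (x + y) = B x x + 2 * B x y + B y y := by
    simp only [map_add, LinearMap.add_apply, hs y x]
    ring
  have hcs : B x y ^ 2 ≤ B x x * B y y := by
    have h (t : ℝ) : 0 ≤ B y y * (t * t) + 2 * B x y * t + B x x := by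
      have h1 := h0 (x + t • y)
      simp only [map_add, LinearMap.add_apply, map_smul, LinearMap.smul_apply, hs y x,
        smul_eq_mul] at h1
      linarith
    have := discrim_le_zero h
    rw [discrim] at this
    nlinarith
  rw [Real.sqrt_le_left (by positivity), hB, add_sq, Real.sq_sqrt (h0 x), Real.sq_sqrt (h0 y)]
  have h1 : B x y ≤ √(B x x) * √(B y y) := by
    rw [← Real.sqrt_mul (h0 x)]
    exact Real.le_sqrt_of_sq_le hcs
  linarith

section Norms

variable {d : ℕ} {P : Params} {K : Pos d →L[ℝ] Pos d}

/-- The bilinear form underlying `r_l ^ 2`, as a function of differences of states. -/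
noncomputable def twistedForm (P : Params) (K : Pos d →L[ℝ] Pos d) :
    LinearMap.BilinForm ℝ (State d) :=
  LinearMap.mk₂ ℝ (fun p r => P.γ⁻¹ ^ 2 * ⟪p.1, K r.1⟫
    + 1 / 2 * ⟪(1 - 2 * tau P) • p.1 + P.γ⁻¹ • p.2, (1 - 2 * tau P) • r.1 + P.γ⁻¹ • r.2⟫
    + 1 / 2 * P.γ⁻¹ ^ 2 * ⟪p.2, r.2⟫)
    (fun p p' r => by
      simp only [Prod.fst_add, Prod.snd_add, smul_add, inner_add_left, inner_add_right]
      ring)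
    (fun c p r => by
      simp only [Prod.smul_fst, Prod.smul_snd, inner_add_left, inner_add_right, inner_smul_left,
        inner_smul_right, conj_trivial, smul_eq_mul]
      ring)
    (fun p r r' => by
      simp only [Prod.fst_add, Prod.snd_add, smul_add, map_add, inner_add_left, inner_add_right]
      ring)
    (fun c p r => by
      simp only [Prod.smul_fst, Prod.smul_snd, map_smul, inner_add_left, inner_add_right,
        inner_smul_left, inner_smul_right, conj_trivial, smul_eq_mul]
      ring)

theorem twistedForm_apply (p r : State d) : twistedForm P K p r = P.γ⁻¹ ^ 2 * ⟪p.1, K r.1⟫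
    + 1 / 2 * ⟪(1 - 2 * tau P) • p.1 + P.γ⁻¹ • p.2, (1 - 2 * tau P) • r.1 + P.γ⁻¹ • r.2⟫
    + 1 / 2 * P.γ⁻¹ ^ 2 * ⟪p.2, r.2⟫ := rfl

theorem rl_eq_sqrt (s s' : State d) : rl P K s s' = √(twistedForm P K (s - s') (s - s')) := by
  rw [rl, twistedForm_apply, real_inner_self_eq_norm_sq, real_inner_self_eq_norm_sq]
  rfl

theorem twistedForm_self_nonneg (hP : P.Admissible) (hK : IsQuadraticPart K P.κ P.LK)
    (p : State d) : 0 ≤ twistedForm P K p p := by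
  rw [twistedForm_apply, real_inner_self_eq_norm_sq, real_inner_self_eq_norm_sq]
  have := hK.inner_nonneg hP.κ_pos p.1
  positivity

theorem twistedForm_comm (hK : IsQuadraticPart K P.κ P.LK) (p r : State d) :
    twistedForm P K p r = twistedForm P K r p := by
  rw [twistedForm_apply, twistedForm_apply, hK.inner_map_comm, real_inner_comm p.2,
    real_inner_comm ((1 - 2 * tau P) • p.1 + _)]

theorem rl_nonneg (s s' : State d) : 0 ≤ rl P K s s' := Real.sqrt_nonneg _

theorem rl_triangle (hP : P.Admissible) (hK : IsQuadraticPart K P.κ P.LK) (s t u : State d) :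
    rl P K s u ≤ rl P K s t + rl P K t u := by
  rw [rl_eq_sqrt, rl_eq_sqrt, rl_eq_sqrt, ← sub_add_sub_cancel s t u]
  exact sqrt_bilinForm_add_le _ (twistedForm_self_nonneg hP hK) (twistedForm_comm hK) _ _

theorem rl_symm (s t : State d) : rl P K s t = rl P K t s := by
  rw [rl_eq_sqrt, rl_eq_sqrt, ← neg_sub t s]
  simp only [map_neg, LinearMap.neg_apply, neg_neg]

theorem rl_eq_sub (s t : State d) : rl P K s t = rl P K (s - t) 0 := by
  rw [rl_eq_sqrt, rl_eq_sqrt, sub_zero]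

theorem rl_smul (c : ℝ) (p : State d) : rl P K (c • p) 0 = |c| * rl P K p 0 := by
  rw [rl_eq_sqrt, rl_eq_sqrt, sub_zero, sub_zero]
  simp only [map_smul, LinearMap.smul_apply, smul_eq_mul]
  rw [← mul_assoc, Real.sqrt_mul (mul_self_nonneg c), Real.sqrt_mul_self_eq_abs]

/-- `r_l` in terms of `z = x - x'` and `q = z + γ⁻¹ (v - v')`. -/
theorem rl_sq (hP : P.Admissible) (hK : IsQuadraticPart K P.κ P.LK) {s s' : State d} {z q : Pos d}
    (hz : s.1 - s'.1 = z) (hq : z + P.γ⁻¹ • (s.2 - s'.2) = q) :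
    rl P K s s' ^ 2 = P.γ⁻¹ ^ 2 * ⟪z, K z⟫ + 1 / 2 * ‖q - (2 * tau P) • z‖ ^ 2
      + 1 / 2 * ‖q - z‖ ^ 2 := by
  have hγ : 0 < P.γ⁻¹ := inv_pos.2 hP.γ_pos
  rw [rl_eq_sqrt, Real.sq_sqrt (twistedForm_self_nonneg hP hK _), twistedForm_apply,
    real_inner_self_eq_norm_sq, real_inner_self_eq_norm_sq, Prod.fst_sub, Prod.snd_sub, hz, ← hq]
  have h1 : z + P.γ⁻¹ • (s.2 - s'.2) - (2 * tau P) • z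
      = (1 - 2 * tau P) • z + P.γ⁻¹ • (s.2 - s'.2) := by module
  have h2 : z + P.γ⁻¹ • (s.2 - s'.2) - z = P.γ⁻¹ • (s.2 - s'.2) := by module
  rw [h1, h2, norm_smul, Real.norm_of_nonneg hγ.le, mul_pow]
  ring

theorem rs_eq {s s' : State d} {z q : Pos d}
    (hz : s.1 - s'.1 = z) (hq : z + P.γ⁻¹ • (s.2 - s'.2) = q) :
    rs P s s' = alpha P * ‖z‖ + ‖q‖ := by
  rw [rs, hz, hq]

theorem rs_nonneg (hP : P.Admissible) (s s' : State d) : 0 ≤ rs P s s' := by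
  have := alpha_pos hP
  rw [rs]
  positivity

theorem rs_symm (s t : State d) : rs P s t = rs P t s := by
  rw [rs, rs, norm_sub_rev, ← norm_neg (s.1 - t.1 + _)]
  congr 2
  module

theorem rs_triangle (hP : P.Admissible) (s t u : State d) :
    rs P s u ≤ rs P s t + rs P t u := by
  have := alpha_pos hP
  have h1 : ‖s.1 - u.1‖ ≤ ‖s.1 - t.1‖ + ‖t.1 - u.1‖ := norm_sub_le_norm_sub_add_norm_sub _ _ _
  have h2 := norm_add_le (s.1 - t.1 + P.γ⁻¹ • (s.2 - t.2)) (t.1 - u.1 + P.γ⁻¹ • (t.2 - u.2))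
  rw [show s.1 - t.1 + P.γ⁻¹ • (s.2 - t.2) + (t.1 - u.1 + P.γ⁻¹ • (t.2 - u.2))
    = s.1 - u.1 + P.γ⁻¹ • (s.2 - u.2) by module] at h2
  rw [rs, rs, rs]
  nlinarith

theorem rs_eq_sub (s t : State d) : rs P s t = rs P (s - t) 0 := by simp [rs]

theorem rs_smul (c : ℝ) (p : State d) : rs P (c • p) 0 = |c| * rs P p 0 := by
  simp only [rs, Prod.smul_fst, Prod.smul_snd, Prod.fst_zero, Prod.snd_zero, sub_zero, norm_smul,
    Real.norm_eq_abs]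
  rw [show c • p.1 + P.γ⁻¹ • c • p.2 = c • (p.1 + P.γ⁻¹ • p.2) by module, norm_smul,
    Real.norm_eq_abs]
  ring

theorem eq_of_rs_eq_zero (hP : P.Admissible) {s t : State d} (h : rs P s t = 0) : s = t := by
  have hα := alpha_pos hP
  have hγ : P.γ⁻¹ ≠ 0 := inv_ne_zero hP.γ_pos.ne'
  rw [rs] at h
  have h1 : ‖s.1 - t.1‖ = 0 := by
    have := norm_nonneg (s.1 - t.1 + P.γ⁻¹ • (s.2 - t.2))
    nlinarith [norm_nonneg (s.1 - t.1)]
  have h2 : ‖s.1 - t.1 + P.γ⁻¹ • (s.2 - t.2)‖ = 0 := by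
    rw [h1] at h
    linarith
  rw [norm_eq_zero] at h1 h2
  rw [h1, zero_add, smul_eq_zero_iff_right hγ] at h2
  exact Prod.ext (sub_eq_zero.1 h1) (sub_eq_zero.1 h2)

theorem rs_pos (hP : P.Admissible) {s t : State d} (h : s ≠ t) : 0 < rs P s t :=
  (rs_nonneg hP s t).lt_of_ne fun h0 => h (eq_of_rs_eq_zero hP h0.symm)

/-- The three entries of the minimum in `ε` control, in turn, the `‖q‖²` term, the `K` term, and the
remaining terms in `z`. As a consequence `Δ` is comparable to `r_s`. -/
theorem two_eps_mul_rl_le_rs (hP : P.Admissible) (hK : IsQuadraticPart K P.κ P.LK)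
    (s s' : State d) : 2 * eps P * rl P K s s' ≤ rs P s s' := by
  have hε := eps_pos hP
  have hα := alpha_pos hP
  have hγ : 0 < P.γ⁻¹ := inv_pos.2 hP.γ_pos
  refine le_of_sq_le_sq ?_ (rs_nonneg hP s s')
  generalize hz : s.1 - s'.1 = z
  generalize hq : z + P.γ⁻¹ • (s.2 - s'.2) = q
  rw [mul_pow, rl_sq hP hK hz hq, rs_eq hz hq]
  have hKz : P.γ⁻¹ ^ 2 * ⟪z, K z⟫ ≤ P.γ⁻¹ ^ 2 * (P.LK * ‖z‖ ^ 2) := by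
    gcongr
    exact hK.inner_le_mul_norm_sq z
  have hτ := tau_pos hP
  have hτ' := tau_le_eighth (P := P)
  have e1 : ‖q - (2 * tau P) • z‖ ≤ ‖q‖ + 2 * tau P * ‖z‖ := by
    refine (norm_sub_le _ _).trans_eq ?_
    rw [norm_smul, Real.norm_of_nonneg (by positivity)]
  have e2 : ‖q - z‖ ≤ ‖q‖ + ‖z‖ := norm_sub_le _ _
  have h1 : (2 * eps P) ^ 2 * (P.γ⁻¹ ^ 2 * P.LK) ≤ 4 / 9 * alpha P ^ 2 := by
    have h := two_eps_mul_le hP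
    have h' := pow_le_pow_left₀ (by positivity) h 2
    rw [mul_pow, mul_pow, mul_pow, mul_pow, Real.sq_sqrt hP.LK_pos.le] at h'
    linarith
  have h2 : (2 * eps P) ^ 2 ≤ 1 := pow_le_one₀ (by positivity) two_eps_le_one
  have h3 : (2 * eps P) ^ 2 ≤ alpha P ^ 2 := by
    gcongr
    exact two_eps_le_alpha
  have h4 : (2 * eps P) ^ 2 ≤ alpha P := by
    have h5 := two_eps_le_one (P := P)
    have h6 := two_eps_le_alpha (P := P)
    nlinarith
  have ha := norm_nonneg z
  have hb := norm_nonneg q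
  have hab : 0 ≤ ‖q‖ * ‖z‖ := by positivity
  have f1 : ‖q - (2 * tau P) • z‖ ^ 2 ≤ (‖q‖ + 1 / 4 * ‖z‖) ^ 2 := by
    gcongr
    exact e1.trans (by gcongr; linarith)
  have f2 : ‖q - z‖ ^ 2 ≤ (‖q‖ + ‖z‖) ^ 2 := by gcongr
  calc (2 * eps P) ^ 2 * (P.γ⁻¹ ^ 2 * ⟪z, K z⟫ + 1 / 2 * ‖q - (2 * tau P) • z‖ ^ 2
        + 1 / 2 * ‖q - z‖ ^ 2)
      ≤ (2 * eps P) ^ 2 * (P.γ⁻¹ ^ 2 * (P.LK * ‖z‖ ^ 2) + 1 / 2 * (‖q‖ + 1 / 4 * ‖z‖) ^ 2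
        + 1 / 2 * (‖q‖ + ‖z‖) ^ 2) := by gcongr
    _ = (2 * eps P) ^ 2 * (P.γ⁻¹ ^ 2 * P.LK) * ‖z‖ ^ 2 + (2 * eps P) ^ 2 * ‖q‖ ^ 2
        + 5 / 4 * ((2 * eps P) ^ 2 * (‖q‖ * ‖z‖))
        + 17 / 32 * ((2 * eps P) ^ 2 * ‖z‖ ^ 2) := by ring
    _ ≤ 4 / 9 * alpha P ^ 2 * ‖z‖ ^ 2 + 1 * ‖q‖ ^ 2
        + 5 / 4 * (alpha P * (‖q‖ * ‖z‖)) + 17 / 32 * (alpha P ^ 2 * ‖z‖ ^ 2) := by gcongr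
    -- The coefficients fit because `4/9 + 17/32 ≤ 1` and `5/4 ≤ 2`.
    _ ≤ (alpha P * ‖z‖ + ‖q‖) ^ 2 := by
      have : 0 ≤ alpha P * (‖q‖ * ‖z‖) := by positivity
      nlinarith [sq_nonneg (alpha P * ‖z‖)]

theorem calE_mul_rs_le_rl (hP : P.Admissible) (hK : IsQuadraticPart K P.κ P.LK)
    (s s' : State d) : calE P * rs P s s' ≤ rl P K s s' := by
  have hE := calE_pos hP
  have hα := alpha_pos hP
  refine le_of_sq_le_sq ?_ (rl_nonneg s s')
  generalize hz : s.1 - s'.1 = z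
  generalize hq : z + P.γ⁻¹ • (s.2 - s'.2) = q
  rw [mul_pow, rl_sq hP hK hz hq, rs_eq hz hq]
  have hKz : P.γ⁻¹ ^ 2 * (P.κ * ‖z‖ ^ 2) ≤ P.γ⁻¹ ^ 2 * ⟪z, K z⟫ := by
    gcongr
    exact hK.mul_norm_sq_le_inner z
  have h1 := calE_mul_alpha_sq_le hP
  have h2 : calE P ^ 2 ≤ 1 / 4 := by
    have := calE_le_half (P := P)
    nlinarith
  have h3 : (calE P * alpha P) ^ 2 * ‖z‖ ^ 2 ≤ P.κ * P.γ⁻¹ ^ 2 / 8 * ‖z‖ ^ 2 := by gcongr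
  have h4 : calE P ^ 2 * ‖q‖ ^ 2 ≤ 1 / 4 * ‖q‖ ^ 2 := by gcongr
  have h5 : calE P ^ 2 * (alpha P * ‖z‖ + ‖q‖) ^ 2
      ≤ 2 * ((calE P * alpha P) ^ 2 * ‖z‖ ^ 2 + calE P ^ 2 * ‖q‖ ^ 2) := by
    have := sq_nonneg (calE P * alpha P * ‖z‖ - calE P * ‖q‖)
    nlinarith
  have h6 : 4 * tau P * ‖z‖ ^ 2 ≤ P.γ⁻¹ ^ 2 * P.κ * ‖z‖ ^ 2 :=
    mul_le_mul_of_nonneg_right four_tau_le (sq_nonneg _)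
  -- Completing the square costs `4τ‖z‖²`; since `4τ ≤ γ⁻²κ`, half of the `K` term pays for it and
  -- the other half remains.
  have h7 : ‖q - (2 * tau P) • z‖ ^ 2 + ‖q - z‖ ^ 2
      = ‖q‖ ^ 2 - 4 * tau P * ‖z‖ ^ 2 + ‖(q - z) - (2 * tau P) • z‖ ^ 2 := by
    have e1 : ⟪q, z⟫ = ⟪z, q⟫ := real_inner_comm _ _
    simp only [← real_inner_self_eq_norm_sq, inner_sub_left, inner_sub_right, inner_smul_left,
      inner_smul_right, conj_trivial, e1]
    ring
  have h8 := sq_nonneg ‖(q - z) - (2 * tau P) • z‖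
  nlinarith

theorem Delta_eq_sub (s t : State d) : Delta P K s t = Delta P K (s - t) 0 := by
  rw [Delta, Delta, rl_eq_sub, rs_eq_sub]

theorem Delta_smul (c : ℝ) (p : State d) : Delta P K (c • p) 0 = |c| * Delta P K p 0 := by
  rw [Delta, Delta, rl_smul, rs_smul]
  ring

theorem rs_le_two_mul_Delta (hP : P.Admissible) (hK : IsQuadraticPart K P.κ P.LK)
    (s s' : State d) : rs P s s' ≤ 2 * Delta P K s s' := by
  have := two_eps_mul_rl_le_rs hP hK s s'
  rw [Delta]
  linarith

theorem Delta_le_rs (hP : P.Admissible) (s s' : State d) : Delta P K s s' ≤ rs P s s' := by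
  have := mul_nonneg (eps_pos hP).le (rl_nonneg (P := P) (K := K) s s')
  rw [Delta]
  linarith

/-! ### The constants `D_𝒦` and `R₁` -/

/-- The state difference with position `z` and twisted coordinate `q`. -/
noncomputable def ofTwisted (P : Params) (z q : Pos d) : State d := (z, P.γ • (q - z))

theorem ofTwisted_fst (z q : Pos d) : (ofTwisted P z q).1 - (0 : State d).1 = z := by
  simp [ofTwisted]

theorem ofTwisted_snd (hP : P.Admissible) (z q : Pos d) :
    z + P.γ⁻¹ • ((ofTwisted P z q).2 - (0 : State d).2) = q := by
  simp [ofTwisted, smul_smul, inv_mul_cancel₀ hP.γ_pos.ne']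

/-- The quadratic function defining `𝒦`, at a difference of states. -/
noncomputable def coreForm (P : Params) (p : State d) : ℝ :=
  P.κ * P.γ⁻¹ ^ 2 * ‖p.1‖ ^ 2 + 1 / 2 * ‖p.1 + P.γ⁻¹ • p.2‖ ^ 2 + 1 / 2 * ‖P.γ⁻¹ • p.2‖ ^ 2

theorem mem_compactSet {p : State d} : p ∈ compactSet d P ↔ coreForm P p ≤ calR P := Iff.rfl

theorem coreForm_smul (c : ℝ) (p : State d) : coreForm P (c • p) = c ^ 2 * coreForm P p := by
  simp only [coreForm, Prod.smul_fst, Prod.smul_snd]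
  rw [show c • p.1 + P.γ⁻¹ • c • p.2 = c • (p.1 + P.γ⁻¹ • p.2) by module, smul_comm, norm_smul,
    norm_smul, norm_smul, mul_pow, mul_pow, mul_pow, Real.norm_eq_abs, sq_abs]
  ring

theorem rs_le_of_mem_compactSet (hP : P.Admissible) {s s' : State d}
    (h : s - s' ∈ compactSet d P) :
    rs P s s' ≤ alpha P * √(calR P / (P.κ * P.γ⁻¹ ^ 2)) + √(2 * calR P) := by
  have hα := alpha_pos hP
  have hγ : 0 < P.γ⁻¹ := inv_pos.2 hP.γ_pos
  have hκ := hP.κ_pos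
  rw [mem_compactSet, coreForm, Prod.fst_sub, Prod.snd_sub] at h
  rw [rs]
  have h0 : 0 ≤ P.κ * P.γ⁻¹ ^ 2 * ‖s.1 - s'.1‖ ^ 2 := by positivity
  gcongr
  · refine Real.le_sqrt_of_sq_le ?_
    rw [le_div_iff₀ (by positivity)]
    nlinarith [sq_nonneg ‖s.1 - s'.1 + P.γ⁻¹ • (s.2 - s'.2)‖, sq_nonneg ‖P.γ⁻¹ • (s.2 - s'.2)‖]
  · refine Real.le_sqrt_of_sq_le ?_
    nlinarith [sq_nonneg ‖P.γ⁻¹ • (s.2 - s'.2)‖]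

/-- Boundedness is what makes the real-valued `sSup` in `DK` a genuine supremum; `bddAbove_rs` plays
the same role for `R1`. -/
theorem bddAbove_Delta (hP : P.Admissible) :
    BddAbove {t | ∃ s s' : State d, s - s' ∈ compactSet d P ∧ t = Delta P K s s'} := by
  refine ⟨alpha P * √(calR P / (P.κ * P.γ⁻¹ ^ 2)) + √(2 * calR P), ?_⟩
  rintro _ ⟨s, s', h, rfl⟩
  exact (Delta_le_rs hP s s').trans (rs_le_of_mem_compactSet hP h)

theorem Delta_self (s : State d) : Delta P K s s = 0 := by
  rw [Delta_eq_sub, sub_self]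
  simpa using Delta_smul (P := P) (K := K) 0 0

theorem zero_mem_compactSet (hP : P.Admissible) : (0 : State d) ∈ compactSet d P := by
  rw [mem_compactSet, coreForm]
  simpa using calR_nonneg hP

theorem Delta_le_DK (hP : P.Admissible) {s s' : State d} (h : s - s' ∈ compactSet d P) :
    Delta P K s s' ≤ DK P K :=
  le_csSup (bddAbove_Delta hP) ⟨s, s', h, rfl⟩

theorem DK_nonneg (hP : P.Admissible) : 0 ≤ DK P K := by
  rw [← Delta_self (P := P) (K := K) 0]
  exact Delta_le_DK hP (by simpa using zero_mem_compactSet hP)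

theorem bddAbove_rs (hP : P.Admissible) (hK : IsQuadraticPart K P.κ P.LK) :
    BddAbove {t | ∃ s s' : State d, Delta P K s s' ≤ DK P K ∧ t = rs P s s'} := by
  refine ⟨2 * DK P K, ?_⟩
  rintro _ ⟨s, s', h, rfl⟩
  exact (rs_le_two_mul_Delta hP hK s s').trans (by linarith)

theorem rs_le_R1 (hP : P.Admissible) (hK : IsQuadraticPart K P.κ P.LK) {s s' : State d}
    (h : Delta P K s s' ≤ DK P K) : rs P s s' ≤ R1 P K :=
  le_csSup (bddAbove_rs hP hK) ⟨s, s', h, rfl⟩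

theorem R1_nonneg (hP : P.Admissible) (hK : IsQuadraticPart K P.κ P.LK) : 0 ≤ R1 P K :=
  (rs_nonneg hP 0 0).trans (rs_le_R1 hP hK ((Delta_self 0).trans_le (DK_nonneg hP)))

/-- It excludes the contractive regime `Δ < D_𝒦` when `R₁ = 0`, so the degenerate case needs only
the synchronous estimate. -/
theorem DK_eq_zero_of_R1_eq_zero (hP : P.Admissible) (hK : IsQuadraticPart K P.κ P.LK)
    (h : R1 P K = 0) : DK P K = 0 := by
  refine le_antisymm ?_ (DK_nonneg hP)
  refine csSup_le ⟨_, 0, 0, by simpa using zero_mem_compactSet hP, rfl⟩ ?_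
  rintro _ ⟨s, s', hs, rfl⟩
  refine (Delta_le_rs hP s s').trans ?_
  rw [← h]
  exact rs_le_R1 hP hK (Delta_le_DK hP hs)

/-- Outside of `{Δ < D_𝒦}`, the difference of two states is not an interior point of `𝒦`. -/
theorem calR_le_coreForm (hP : P.Admissible) (hK : IsQuadraticPart K P.κ P.LK) {s s' : State d}
    (hne : s ≠ s') (h : DK P K ≤ Delta P K s s') : calR P ≤ coreForm P (s - s') := by
  by_contra! hlt
  have hrs := rs_pos hP hne
  have hΔ : 0 < Delta P K s s' := by
    have := rs_le_two_mul_Delta hP hK s s'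
    linarith
  obtain ⟨c, hc1, hc⟩ : ∃ c : ℝ, 1 < c ∧ c ^ 2 * coreForm P (s - s') ≤ calR P := by
    have h0 : 0 ≤ coreForm P (s - s') := by
      have := hP.κ_pos
      rw [coreForm]
      positivity
    have hcont : Filter.Tendsto (fun c : ℝ => c ^ 2 * coreForm P (s - s')) (nhdsWithin 1 (Ioi 1))
        (nhds (coreForm P (s - s'))) := by
      have : Continuous fun c : ℝ => c ^ 2 * coreForm P (s - s') := by fun_prop
      have h1 := this.tendsto 1
      rw [one_pow, one_mul] at h1
      exact h1.mono_left nhdsWithin_le_nhds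
    obtain ⟨c, h1, h2⟩ := ((hcont.eventually (eventually_le_nhds hlt)).and
      self_mem_nhdsWithin).exists
    exact ⟨c, h2, h1⟩
  -- `Δ` is homogeneous of degree one: enlarging the difference inside `𝒦` by `c > 1` would push `Δ
  -- > 0` beyond the supremum.
  have h1 : Delta P K (c • (s - s')) 0 ≤ DK P K :=
    Delta_le_DK hP (by rwa [sub_zero, mem_compactSet, coreForm_smul])
  rw [Delta_smul, ← Delta_eq_sub, abs_of_pos (by linarith)] at h1
  nlinarith

/-! ### Independence of `D_𝒦` and `R₁` from the dimension -/

section DimensionFree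

variable {d' : ℕ} {K' : Pos d' →L[ℝ] Pos d'}

/-- Replace `z`, `q` by nonnegative multiples of a bottom eigenvector of `K'` with the same norms.
Then `r_s` is unchanged, while `r_l` and the form defining `𝒦` do not increase, because aligned
vectors minimise `‖q - a z‖` for `a ≥ 0`; so `Δ` does not decrease. -/
theorem DK_le_DK (hP : P.Admissible) (hK : IsQuadraticPart K P.κ P.LK)
    (hK' : IsQuadraticPart K' P.κ P.LK) : DK P K ≤ DK P K' := by
  refine csSup_le ⟨_, 0, 0, by simpa using zero_mem_compactSet hP, rfl⟩ ?_
  rintro _ ⟨s, s', hs, rfl⟩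
  obtain ⟨e, he, hKe⟩ := hK'.exists_unit_eigenvector
  have hτ := tau_pos hP
  have hγ : 0 < P.γ⁻¹ := inv_pos.2 hP.γ_pos
  generalize hz : s.1 - s'.1 = z
  generalize hq : z + P.γ⁻¹ • (s.2 - s'.2) = q
  set p' := ofTwisted P (‖z‖ • e) (‖q‖ • e) with hp'
  have hz' : p'.1 - (0 : State d').1 = ‖z‖ • e := ofTwisted_fst _ _
  have hq' : ‖z‖ • e + P.γ⁻¹ • (p'.2 - (0 : State d').2) = ‖q‖ • e := ofTwisted_snd hP _ _
  have hnorm (c : ℝ) : ‖c • e‖ = |c| := by rw [norm_smul, he, mul_one, Real.norm_eq_abs]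
  have hle (a : ℝ) (ha : 0 ≤ a) : ‖‖q‖ • e - a • ‖z‖ • e‖ ≤ ‖q - a • z‖ := by
    rw [smul_smul, ← sub_smul, hnorm]
    have := abs_norm_sub_norm_le q (a • z)
    rwa [norm_smul, Real.norm_of_nonneg ha] at this
  have hle1 : ‖‖q‖ • e - ‖z‖ • e‖ ≤ ‖q - z‖ := by simpa using hle 1 zero_le_one
  have hrs : rs P p' 0 = rs P s s' := by
    rw [rs_eq hz' hq', rs_eq hz hq, hnorm, hnorm, abs_norm, abs_norm]
  have hrl : rl P K' p' 0 ≤ rl P K s s' := by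
    refine le_of_sq_le_sq ?_ (rl_nonneg _ _)
    rw [rl_sq hP hK' hz' hq', rl_sq hP hK hz hq]
    have h1 : ⟪‖z‖ • e, K' (‖z‖ • e)⟫ ≤ ⟪z, K z⟫ := by
      rw [map_smul, inner_smul_left, inner_smul_right, hKe, conj_trivial]
      have := hK.mul_norm_sq_le_inner z
      linarith
    have h2 := hle (2 * tau P) (by positivity)
    gcongr
  have hmem : p' - 0 ∈ compactSet d' P := by
    refine le_trans ?_ (mem_compactSet.1 hs)
    have e1 : P.γ⁻¹ • (p'.2 - (0 : State d').2) = ‖q‖ • e - ‖z‖ • e := by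
      rw [← hq']
      module
    have e2 : P.γ⁻¹ • (s.2 - s'.2) = q - z := by
      rw [← hq]
      module
    rw [coreForm, Prod.fst_sub, Prod.snd_sub, Prod.fst_sub, Prod.snd_sub, hz, hq, hz', hq', e1, e2, hnorm,
      hnorm, abs_norm, abs_norm]
    gcongr
  refine le_trans ?_ (Delta_le_DK hP hmem)
  rw [Delta, Delta, hrs]
  have := eps_pos hP
  gcongr

theorem DK_eq_DK (hP : P.Admissible) (hK : IsQuadraticPart K P.κ P.LK)
    (hK' : IsQuadraticPart K' P.κ P.LK) : DK P K' = DK P K :=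
  le_antisymm (DK_le_DK hP hK' hK) (DK_le_DK hP hK hK')

/-- The constraint is now `Δ ≤ D_𝒦`, so `r_l` should be as large as possible at fixed `r_s`: take
`z` and `q` antiparallel along a top eigenvector of `K'`. -/
theorem R1_le_R1 (hP : P.Admissible) (hK : IsQuadraticPart K P.κ P.LK)
    (hK' : IsQuadraticPart K' P.κ P.LK) : R1 P K ≤ R1 P K' := by
  refine csSup_le ⟨_, 0, 0, (Delta_self 0).trans_le (DK_nonneg hP), rfl⟩ ?_
  rintro _ ⟨s, s', hs, rfl⟩
  obtain ⟨e, he, hKe⟩ := hK'.exists_unit_top hP.κ_pos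
  have hτ := tau_pos hP
  have hγ : 0 < P.γ⁻¹ := inv_pos.2 hP.γ_pos
  generalize hz : s.1 - s'.1 = z
  generalize hq : z + P.γ⁻¹ • (s.2 - s'.2) = q
  set p' := ofTwisted P (‖z‖ • e) (-‖q‖ • e) with hp'
  have hz' : p'.1 - (0 : State d').1 = ‖z‖ • e := ofTwisted_fst _ _
  have hq' : ‖z‖ • e + P.γ⁻¹ • (p'.2 - (0 : State d').2) = -‖q‖ • e := ofTwisted_snd hP _ _
  have hnorm (c : ℝ) : ‖c • e‖ = |c| := by rw [norm_smul, he, mul_one, Real.norm_eq_abs]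
  have hle (a : ℝ) (ha : 0 ≤ a) : ‖q - a • z‖ ≤ ‖-‖q‖ • e - a • ‖z‖ • e‖ := by
    rw [smul_smul, ← sub_smul, hnorm, ← abs_neg, neg_sub, sub_neg_eq_add,
      abs_of_nonneg (by positivity)]
    refine (norm_sub_le _ _).trans_eq ?_
    rw [norm_smul, Real.norm_of_nonneg ha, add_comm]
  have hle1 : ‖q - z‖ ≤ ‖-‖q‖ • e - ‖z‖ • e‖ := by simpa using hle 1 zero_le_one
  have hrs : rs P p' 0 = rs P s s' := by
    rw [rs_eq hz' hq', rs_eq hz hq, hnorm, hnorm, abs_neg, abs_norm, abs_norm]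
  have hrl : rl P K s s' ≤ rl P K' p' 0 := by
    refine le_of_sq_le_sq ?_ (rl_nonneg _ _)
    rw [rl_sq hP hK' hz' hq', rl_sq hP hK hz hq]
    have h1 : ⟪z, K z⟫ ≤ ⟪‖z‖ • e, K' (‖z‖ • e)⟫ := by
      rw [map_smul, inner_smul_left, inner_smul_right, hKe, conj_trivial]
      have := hK.inner_le_mul_norm_sq z
      linarith
    have h2 := hle (2 * tau P) (by positivity)
    gcongr
  rw [← hrs]
  refine rs_le_R1 hP hK' ?_
  rw [DK_eq_DK hP hK hK']
  refine le_trans ?_ hs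
  rw [Delta, Delta, hrs]
  have := eps_pos hP
  gcongr

theorem R1_eq_R1 (hP : P.Admissible) (hK : IsQuadraticPart K P.κ P.LK)
    (hK' : IsQuadraticPart K' P.κ P.LK) : R1 P K' = R1 P K :=
  le_antisymm (R1_le_R1 hP hK' hK) (R1_le_R1 hP hK hK')

end DimensionFree

end Norms

/-! ### The concave function `f` -/

section Concave

variable {P : Params} {R₁ : ℝ}

theorem phi_eq (s : ℝ) : phi P R₁ s = Real.exp (-(64 * alpha P * P.γ ^ 2 * min s R₁ ^ 2)) := by
  rw [phi]
  ring_nf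

theorem phi_pos (s : ℝ) : 0 < phi P R₁ s := Real.exp_pos _

theorem continuous_phi : Continuous (phi P R₁) := by
  unfold phi
  fun_prop

theorem phi_antitoneOn (hP : P.Admissible) (hR : 0 ≤ R₁) : AntitoneOn (phi P R₁) (Ici 0) := by
  intro a ha b _ hab
  have := alpha_pos hP
  rw [phi_eq, phi_eq]
  have h0 : 0 ≤ min a R₁ := le_min ha hR
  gcongr

theorem phi_le_one (hP : P.Admissible) (s : ℝ) : phi P R₁ s ≤ 1 := by
  have := alpha_pos hP
  rw [phi_eq, Real.exp_le_one_iff, neg_nonpos]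
  positivity

theorem hasDerivAt_Phi (s : ℝ) : HasDerivAt (Phi P R₁) (phi P R₁ s) s :=
  intervalIntegral.integral_hasDerivAt_right (continuous_phi.intervalIntegrable _ _)
    (continuous_phi.stronglyMeasurableAtFilter _ _) continuous_phi.continuousAt

theorem strictMono_Phi : StrictMono (Phi P R₁) :=
  strictMono_of_deriv_pos fun s => by
    rw [(hasDerivAt_Phi s).deriv]
    exact phi_pos s

theorem continuous_Phi : Continuous (Phi P R₁) :=
  continuous_iff_continuousAt.2 fun s => (hasDerivAt_Phi s).continuousAt

theorem Phi_zero : Phi P R₁ 0 = 0 := intervalIntegral.integral_same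

theorem Phi_pos {s : ℝ} (hs : 0 < s) : 0 < Phi P R₁ s := by
  rw [← Phi_zero (P := P) (R₁ := R₁)]
  exact strictMono_Phi hs

theorem Phi_nonneg {s : ℝ} (hs : 0 ≤ s) : 0 ≤ Phi P R₁ s := by
  rw [← Phi_zero (P := P) (R₁ := R₁)]
  exact strictMono_Phi.monotone hs

/-- The primitive of `Φ φ⁻¹`. -/
noncomputable def ratioIntegral (P : Params) (R₁ s : ℝ) : ℝ :=
  ∫ x in (0 : ℝ)..s, Phi P R₁ x * (phi P R₁ x)⁻¹

theorem continuous_Phi_mul_inv : Continuous fun x => Phi P R₁ x * (phi P R₁ x)⁻¹ :=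
  continuous_Phi.mul (continuous_phi.inv₀ fun x => (phi_pos x).ne')

theorem monotoneOn_Phi_mul_inv (hP : P.Admissible) (hR : 0 ≤ R₁) :
    MonotoneOn (fun x => Phi P R₁ x * (phi P R₁ x)⁻¹) (Ici 0) := by
  intro a ha b hb hab
  have h1 := phi_antitoneOn hP hR ha hb hab
  have h2 := phi_pos (P := P) (R₁ := R₁) b
  have h3 := strictMono_Phi (P := P) (R₁ := R₁).monotone hab
  have h4 := Phi_nonneg (P := P) (R₁ := R₁) (mem_Ici.1 ha)
  have h5 := phi_pos (P := P) (R₁ := R₁) a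
  have h6 := h4.trans h3
  show Phi P R₁ a * (phi P R₁ a)⁻¹ ≤ Phi P R₁ b * (phi P R₁ b)⁻¹
  gcongr

/-- Bounds for the increments of the integral of a monotone function. -/
theorem mul_le_integral_of_monotoneOn {u : ℝ → ℝ} (hc : Continuous u) (hm : MonotoneOn u (Ici 0))
    {a b : ℝ} (ha : 0 ≤ a) (hab : a ≤ b) :
    (b - a) * u a ≤ (∫ x in (0 : ℝ)..b, u x) - ∫ x in (0 : ℝ)..a, u x := by
  rw [intervalIntegral.integral_interval_sub_left (hc.intervalIntegrable _ _)
    (hc.intervalIntegrable _ _)]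
  have h : ∫ _ in a..b, u a = (b - a) * u a := by simp
  rw [← h]
  exact intervalIntegral.integral_mono_on hab intervalIntegrable_const (hc.intervalIntegrable _ _)
    fun x hx => hm ha (ha.trans hx.1) hx.1

theorem integral_le_mul_of_monotoneOn {u : ℝ → ℝ} (hc : Continuous u) (hm : MonotoneOn u (Ici 0))
    {a b : ℝ} (ha : 0 ≤ a) (hab : a ≤ b) :
    (∫ x in (0 : ℝ)..b, u x) - (∫ x in (0 : ℝ)..a, u x) ≤ (b - a) * u b := by
  rw [intervalIntegral.integral_interval_sub_left (hc.intervalIntegrable _ _)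
    (hc.intervalIntegrable _ _)]
  have h : ∫ _ in a..b, u b = (b - a) * u b := by simp
  rw [← h]
  exact intervalIntegral.integral_mono_on hab (hc.intervalIntegrable _ _) intervalIntegrable_const
    fun x hx => hm (ha.trans hx.1) (ha.trans hab) hx.2

theorem ratioIntegral_zero : ratioIntegral P R₁ 0 = 0 := intervalIntegral.integral_same

theorem continuous_ratioIntegral : Continuous (ratioIntegral P R₁) :=
  intervalIntegral.continuous_primitive
    (fun _ _ => continuous_Phi_mul_inv.intervalIntegrable _ _) 0

theorem ratioIntegral_monotoneOn (hP : P.Admissible) (hR : 0 ≤ R₁) :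
    MonotoneOn (ratioIntegral P R₁) (Ici 0) := by
  intro a ha b _ hab
  have h := mul_le_integral_of_monotoneOn continuous_Phi_mul_inv (monotoneOn_Phi_mul_inv hP hR)
    (mem_Ici.1 ha) hab
  have h1 : 0 ≤ (b - a) * (Phi P R₁ a * (phi P R₁ a)⁻¹) :=
    mul_nonneg (sub_nonneg.2 hab)
      (mul_nonneg (Phi_nonneg (mem_Ici.1 ha)) (inv_nonneg.2 (phi_pos a).le))
  rw [ratioIntegral, ratioIntegral]
  linarith

theorem ratioIntegral_nonneg (hP : P.Admissible) (hR : 0 ≤ R₁) {s : ℝ} (hs : 0 ≤ s) :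
    0 ≤ ratioIntegral P R₁ s := by
  rw [← ratioIntegral_zero (P := P) (R₁ := R₁)]
  exact ratioIntegral_monotoneOn hP hR self_mem_Ici hs hs

theorem ratioIntegral_pos (hP : P.Admissible) (hR : 0 < R₁) : 0 < ratioIntegral P R₁ R₁ := by
  have h := mul_le_integral_of_monotoneOn continuous_Phi_mul_inv
    (monotoneOn_Phi_mul_inv hP hR.le) (half_pos hR).le (half_le_self hR.le)
  have h0 : 0 ≤ ratioIntegral P R₁ (R₁ / 2) := ratioIntegral_nonneg hP hR.le (half_pos hR).le
  have h1 : 0 < (R₁ - R₁ / 2) * (Phi P R₁ (R₁ / 2) * (phi P R₁ (R₁ / 2))⁻¹) :=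
    mul_pos (by linarith) (mul_pos (Phi_pos (half_pos hR)) (inv_pos.2 (phi_pos _)))
  rw [ratioIntegral] at h0 ⊢
  linarith

/-- The primitive of a nondecreasing function is convex, so it lies below its chord over `[0, R₁]`.
-/
theorem mul_ratioIntegral_le (hP : P.Admissible) {s : ℝ} (hs : 0 ≤ s) (hsR : s ≤ R₁) :
    R₁ * ratioIntegral P R₁ s ≤ s * ratioIntegral P R₁ R₁ := by
  have hm := monotoneOn_Phi_mul_inv hP (hs.trans hsR)
  have h1 := integral_le_mul_of_monotoneOn continuous_Phi_mul_inv hm le_rfl hs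
  have h2 := mul_le_integral_of_monotoneOn continuous_Phi_mul_inv hm hs hsR
  rw [intervalIntegral.integral_same, sub_zero, sub_zero] at h1
  rw [ratioIntegral, ratioIntegral]
  nlinarith

theorem chat_eq : chat P R₁ = 1 / (P.γ * ratioIntegral P R₁ R₁) := rfl

theorem chat_nonneg (hP : P.Admissible) (hR : 0 ≤ R₁) : 0 ≤ chat P R₁ := by
  have := ratioIntegral_nonneg hP hR hR
  have := hP.γ_pos
  rw [chat_eq]
  positivity

theorem chat_pos (hP : P.Admissible) (hR : 0 < R₁) : 0 < chat P R₁ := by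
  have := ratioIntegral_pos hP hR
  have := hP.γ_pos
  rw [chat_eq]
  positivity

theorem psi_eq (s : ℝ) : psi P R₁ s = 1 - chat P R₁ / 2 * P.γ * ratioIntegral P R₁ (min s R₁) :=
  rfl

theorem psi_eq_of_pos (hP : P.Admissible) (hR : 0 < R₁) (s : ℝ) :
    psi P R₁ s = 1 - ratioIntegral P R₁ (min s R₁) / (2 * ratioIntegral P R₁ R₁) := by
  have := (ratioIntegral_pos hP hR).ne'
  have := hP.γ_pos.ne'
  rw [psi_eq, chat_eq]
  field_simp

theorem psi_antitoneOn (hP : P.Admissible) (hR : 0 ≤ R₁) : AntitoneOn (psi P R₁) (Ici 0) := by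
  intro a ha b hb hab
  have h1 := chat_nonneg hP hR
  have h2 := hP.γ_pos
  have h3 := ratioIntegral_monotoneOn hP hR (mem_Ici.2 (le_min ha hR)) (mem_Ici.2 (le_min hb hR))
    (min_le_min_right R₁ hab)
  rw [psi_eq, psi_eq]
  gcongr

theorem psi_le_one (hP : P.Admissible) (hR : 0 ≤ R₁) {s : ℝ} (hs : 0 ≤ s) : psi P R₁ s ≤ 1 := by
  have h1 := chat_nonneg hP hR
  have h2 := hP.γ_pos
  have h3 := ratioIntegral_nonneg hP hR (le_min hs hR)
  have h4 : 0 ≤ chat P R₁ / 2 * P.γ * ratioIntegral P R₁ (min s R₁) := by positivity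
  rw [psi_eq]
  linarith

theorem psi_self (hP : P.Admissible) (hR : 0 < R₁) : psi P R₁ R₁ = 1 / 2 := by
  have := (ratioIntegral_pos hP hR).ne'
  rw [psi_eq_of_pos hP hR, min_self]
  field_simp
  norm_num

theorem psi_self_pos (hP : P.Admissible) (hR : 0 ≤ R₁) : 0 < psi P R₁ R₁ := by
  rcases hR.eq_or_lt with rfl | h
  · rw [psi_eq, min_self, ratioIntegral_zero]
    norm_num
  · rw [psi_self hP h]
    norm_num

theorem le_psi (hP : P.Admissible) (hR : 0 < R₁) {s : ℝ} (hs : 0 ≤ s) (hsR : s ≤ R₁) :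
    1 - s / (2 * R₁) ≤ psi P R₁ s := by
  have h1 := ratioIntegral_pos hP hR
  have h2 := mul_ratioIntegral_le hP hs hsR
  rw [psi_eq_of_pos hP hR, min_eq_left hsR]
  gcongr 1 - ?_
  rw [div_le_div_iff₀ (by positivity) (by positivity)]
  linarith

theorem continuous_psi : Continuous (psi P R₁) := by
  have h := continuous_ratioIntegral (P := P) (R₁ := R₁)
  have : Continuous fun s => 1 - chat P R₁ / 2 * P.γ * ratioIntegral P R₁ (min s R₁) := by
    fun_prop
  exact this

theorem phi_of_le {s : ℝ} (hs : R₁ ≤ s) : phi P R₁ s = phi P R₁ R₁ := by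
  rw [phi, phi, min_eq_right hs, min_self]

theorem psi_of_le {s : ℝ} (hs : R₁ ≤ s) : psi P R₁ s = psi P R₁ R₁ := by
  rw [psi_eq, psi_eq, min_eq_right hs, min_self]

/-- The derivative `φ ψ` of `f`. -/
noncomputable def slope (P : Params) (R₁ s : ℝ) : ℝ := phi P R₁ s * psi P R₁ s

theorem continuous_slope : Continuous (slope P R₁) := continuous_phi.mul continuous_psi

theorem slope_of_le {s : ℝ} (hs : R₁ ≤ s) : slope P R₁ s = slope P R₁ R₁ := by
  rw [slope, slope, phi_of_le hs, psi_of_le hs]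

theorem psi_pos (hP : P.Admissible) (hR : 0 ≤ R₁) {s : ℝ} (hs : 0 ≤ s) : 0 < psi P R₁ s := by
  rcases le_total s R₁ with h | h
  · exact (psi_self_pos hP hR).trans_le (psi_antitoneOn hP hR hs hR h)
  · rw [psi_of_le h]
    exact psi_self_pos hP hR

theorem slope_pos (hP : P.Admissible) (hR : 0 ≤ R₁) {s : ℝ} (hs : 0 ≤ s) : 0 < slope P R₁ s :=
  mul_pos (phi_pos s) (psi_pos hP hR hs)

theorem slope_antitoneOn (hP : P.Admissible) (hR : 0 ≤ R₁) : AntitoneOn (slope P R₁) (Ici 0) := by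
  intro a ha b hb hab
  have h1 := phi_antitoneOn hP hR ha hb hab
  have h2 := psi_antitoneOn hP hR ha hb hab
  have h3 := phi_pos (P := P) (R₁ := R₁) a
  have h4 := psi_pos hP hR (mem_Ici.1 hb)
  rw [slope, slope]
  gcongr

theorem slope_le_one (hP : P.Admissible) (hR : 0 ≤ R₁) {s : ℝ} (hs : 0 ≤ s) :
    slope P R₁ s ≤ 1 :=
  mul_le_one₀ (phi_le_one hP s) (psi_pos hP hR hs).le (psi_le_one hP hR hs)

theorem slope_self_le (hP : P.Admissible) (hR : 0 ≤ R₁) {s : ℝ} (hs : 0 ≤ s) :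
    slope P R₁ R₁ ≤ slope P R₁ s := by
  rcases le_total s R₁ with h | h
  · exact slope_antitoneOn hP hR hs hR h
  · rw [slope_of_le h]

/-- `φ` forces the slope to decrease at least at a Gaussian rate before `R₁`. -/
theorem slope_le_exp_mul_slope (hP : P.Admissible) {s t : ℝ} (hs : 0 ≤ s) (hst : s ≤ t)
    (ht : t ≤ R₁) :
    slope P R₁ t ≤ Real.exp (-(64 * alpha P * P.γ ^ 2 * (t ^ 2 - s ^ 2))) * slope P R₁ s := by
  have hR : 0 ≤ R₁ := hs.trans (hst.trans ht)
  have h1 : phi P R₁ t = Real.exp (-(64 * alpha P * P.γ ^ 2 * (t ^ 2 - s ^ 2))) * phi P R₁ s := by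
    rw [phi_eq, phi_eq, min_eq_left ht, min_eq_left (hst.trans ht), ← Real.exp_add]
    ring_nf
  have h2 := psi_antitoneOn hP hR hs (mem_Ici.2 (hs.trans hst)) hst
  have h3 := phi_pos (P := P) (R₁ := R₁) s
  rw [slope, slope, h1, mul_assoc]
  gcongr

/-- This is the Gaussian decay linearised by `1 + x ≤ eˣ`, the form in which curvature is compared
with the drift. -/
theorem one_add_mul_slope_le (hP : P.Admissible) {s t : ℝ} (hs : 0 ≤ s) (hst : s ≤ t)
    (ht : t ≤ R₁) :
    (1 + 64 * alpha P * P.γ ^ 2 * (t ^ 2 - s ^ 2)) * slope P R₁ t ≤ slope P R₁ s := by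
  have h1 := slope_le_exp_mul_slope hP hs hst ht
  have h2 := slope_pos hP (hs.trans (hst.trans ht)) (hs.trans hst)
  rw [Real.exp_neg, inv_mul_eq_div, le_div_iff₀ (Real.exp_pos _)] at h1
  have h3 := Real.add_one_le_exp (64 * alpha P * P.γ ^ 2 * (t ^ 2 - s ^ 2))
  nlinarith

/-- `ψ` forces the slope to decrease between `(1 - ν) R₁` and `R₁`. -/
theorem slope_self_le_mul (hP : P.Admissible) (hR : 0 < R₁) {a ν : ℝ} (ha : 0 ≤ a)
    (hν : 0 ≤ ν) (haν : a ≤ R₁ * (1 - ν)) :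
    slope P R₁ R₁ ≤ (1 - ν / 2) * slope P R₁ a := by
  have haR : a ≤ R₁ := haν.trans (by nlinarith)
  have hν1 : ν ≤ 1 := by
    by_contra! h
    nlinarith
  have h1 := phi_antitoneOn hP hR.le (mem_Ici.2 ha) (mem_Ici.2 hR.le) haR
  have h2 := le_psi hP hR ha haR
  have h3 : a / (2 * R₁) ≤ (1 - ν) / 2 := by
    rw [div_le_div_iff₀ (by positivity) (by norm_num)]
    linarith
  have h4 : 1 / 2 ≤ (1 - ν / 2) * psi P R₁ a := by nlinarith
  have h5 := phi_pos (P := P) (R₁ := R₁) a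
  rw [slope, slope, psi_self hP hR]
  calc phi P R₁ R₁ * (1 / 2) ≤ phi P R₁ a * ((1 - ν / 2) * psi P R₁ a) := by gcongr
    _ = _ := by ring

theorem f_eq (r : ℝ) : f P R₁ r = ∫ s in (0 : ℝ)..r, slope P R₁ s := rfl

theorem f_zero : f P R₁ 0 = 0 := intervalIntegral.integral_same

theorem deriv_f (r : ℝ) : deriv (f P R₁) r = slope P R₁ r :=
  (intervalIntegral.integral_hasDerivAt_right (continuous_slope.intervalIntegrable _ _)
    (continuous_slope.stronglyMeasurableAtFilter _ _) continuous_slope.continuousAt).deriv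

theorem continuous_f : Continuous (f P R₁) :=
  intervalIntegral.continuous_primitive (fun _ _ => continuous_slope.intervalIntegrable _ _) 0

theorem f_sub_le (hP : P.Admissible) (hR : 0 ≤ R₁) {a b : ℝ} (ha : 0 ≤ a) (hab : a ≤ b) :
    f P R₁ b - f P R₁ a ≤ (b - a) * slope P R₁ a := by
  have h := mul_le_integral_of_monotoneOn continuous_slope.neg (slope_antitoneOn hP hR).neg ha hab
  simp only [Pi.neg_apply, intervalIntegral.integral_neg] at h
  rw [f_eq, f_eq]
  linarith

theorem le_f_sub (hP : P.Admissible) (hR : 0 ≤ R₁) {a b : ℝ} (ha : 0 ≤ a) (hab : a ≤ b) :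
    (b - a) * slope P R₁ b ≤ f P R₁ b - f P R₁ a := by
  have h := integral_le_mul_of_monotoneOn continuous_slope.neg (slope_antitoneOn hP hR).neg ha hab
  simp only [Pi.neg_apply, intervalIntegral.integral_neg] at h
  rw [f_eq, f_eq]
  linarith

/-- The tangent line inequality. -/
theorem f_le_tangent (hP : P.Admissible) (hR : 0 ≤ R₁) {a b : ℝ} (ha : 0 ≤ a) (hb : 0 ≤ b) :
    f P R₁ b ≤ f P R₁ a + (b - a) * slope P R₁ a := by
  rcases le_total a b with h | h
  · have := f_sub_le hP hR ha h
    linarith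
  · have := le_f_sub hP hR hb h
    linarith

theorem f_monotoneOn (hP : P.Admissible) (hR : 0 ≤ R₁) : MonotoneOn (f P R₁) (Ici 0) := by
  intro a ha b hb hab
  have h := le_f_sub hP hR (mem_Ici.1 ha) hab
  have := mul_nonneg (sub_nonneg.2 hab) (slope_pos hP hR (mem_Ici.1 hb)).le
  linarith

theorem f_nonneg (hP : P.Admissible) (hR : 0 ≤ R₁) {r : ℝ} (hr : 0 ≤ r) : 0 ≤ f P R₁ r := by
  rw [← f_zero (P := P) (R₁ := R₁)]
  exact f_monotoneOn hP hR self_mem_Ici hr hr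

theorem f_le_self (hP : P.Admissible) (hR : 0 ≤ R₁) {r : ℝ} (hr : 0 ≤ r) : f P R₁ r ≤ r := by
  have h1 := f_sub_le hP hR le_rfl hr
  have h2 := slope_le_one hP hR (le_refl 0)
  rw [f_zero] at h1
  nlinarith

theorem f_pos (hP : P.Admissible) (hR : 0 ≤ R₁) {r : ℝ} (hr : 0 < r) : 0 < f P R₁ r := by
  have h1 := le_f_sub hP hR le_rfl hr.le
  have h2 := mul_pos hr (slope_pos hP hR hr.le)
  rw [f_zero] at h1
  linarith

/-- The slope decreases, so the increment beyond the larger argument is at most the increment of the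
same length from zero. -/
theorem f_add_le (hP : P.Admissible) (hR : 0 ≤ R₁) {a b : ℝ} (ha : 0 ≤ a) (hb : 0 ≤ b) :
    f P R₁ (a + b) ≤ f P R₁ a + f P R₁ b := by
  rcases le_total a b with h | h
  · have h1 := f_sub_le hP hR hb (le_add_of_nonneg_left ha : b ≤ a + b)
    have h2 := le_f_sub hP hR le_rfl ha
    have h3 := slope_antitoneOn hP hR ha hb h
    rw [f_zero] at h2
    nlinarith
  · have h1 := f_sub_le hP hR ha (le_add_of_nonneg_right hb : a ≤ a + b)
    have h2 := le_f_sub hP hR le_rfl hb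
    have h3 := slope_antitoneOn hP hR hb ha h
    rw [f_zero] at h2
    nlinarith

end Concave

/-! ### The distance `ρ` -/

section Distance

variable {d : ℕ} {P : Params} {K : Pos d →L[ℝ] Pos d}

/-- In this form `ρ` is monotone in the two norms `r_s` and `r_l`, so after a step it suffices to
bound either argument of the minimum. -/
theorem rho_eq (s s' : State d) :
    rho P K s s' = f P (R1 P K) (min (rs P s s') (DK P K + eps P * rl P K s s')) := by
  rw [rho, ← min_add_add_right, Delta, sub_add_cancel]

theorem isDistance_rho (hP : P.Admissible) (hK : IsQuadraticPart K P.κ P.LK) :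
    IsDistance (rho P K) := by
  have hR := R1_nonneg hP hK
  have hD := DK_nonneg (K := K) hP
  have hε := eps_pos hP
  have h0 (s t : State d) : 0 ≤ min (rs P s t) (DK P K + eps P * rl P K s t) :=
    le_min (rs_nonneg hP s t) (add_nonneg hD (mul_nonneg hε.le (rl_nonneg s t)))
  refine ⟨fun s t => ?_, fun s t => ⟨fun h => ?_, fun h => ?_⟩, fun s t => ?_, fun s t u => ?_⟩
  · rw [rho_eq]
    exact f_nonneg hP hR (h0 s t)
  · by_contra hne
    have h1 := rs_pos hP hne
    have h2 : 0 < rl P K s t := lt_of_lt_of_le (mul_pos (calE_pos hP) h1)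
      (calE_mul_rs_le_rl hP hK s t)
    have h3 := f_pos hP hR (lt_min h1 (add_pos_of_nonneg_of_pos hD (mul_pos hε h2)))
    rw [rho_eq] at h
    linarith
  · subst h
    have h1 : rs P s s = 0 := by simp [rs]
    rw [rho_eq, h1, min_eq_left, f_zero]
    exact add_nonneg hD (mul_nonneg hε.le (rl_nonneg s s))
  · rw [rho_eq, rho_eq, rs_symm, rl_symm]
  · rw [rho_eq, rho_eq, rho_eq]
    refine le_trans (f_monotoneOn hP hR (h0 s u) (add_nonneg (h0 s t) (h0 t u)) ?_)
      (f_add_le hP hR (h0 s t) (h0 t u))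
    have h1 := rs_triangle hP s t u
    have h2 := mul_le_mul_of_nonneg_left (rl_triangle hP hK s t u) hε.le
    have h3 := mul_nonneg hε.le (rl_nonneg (P := P) (K := K) s t)
    have h4 := mul_nonneg hε.le (rl_nonneg (P := P) (K := K) t u)
    have h5 := rs_nonneg hP s t
    have h6 := rs_nonneg hP t u
    have h7 := two_eps_mul_rl_le_rs hP hK s t
    have h8 := two_eps_mul_rl_le_rs hP hK t u
    rcases min_cases (rs P s t) (DK P K + eps P * rl P K s t) with ⟨e1, -⟩ | ⟨e1, -⟩ <;>
    rcases min_cases (rs P t u) (DK P K + eps P * rl P K t u) with ⟨e2, -⟩ | ⟨e2, -⟩ <;>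
    rw [e1, e2]
    · exact (min_le_left _ _).trans h1
    -- If one summand is `r_s` and the other `D_𝒦 + ε r_l`, then `2ε r_l ≤ r_s` converts the first;
    -- `D_𝒦 ≥ 0` settles the remaining case.
    all_goals
      refine (min_le_right _ _).trans ?_
      linarith

end Distance

/-! ### One step of the scheme for the difference of two copies -/

/-- The damping `1 - e^{-γ h}` of one `𝒰` step. -/
noncomputable def damping (P : Params) (h : ℝ) : ℝ := 1 - Real.exp (-P.γ * h)

/-- The relative defect `1 - (1 - e^{-γ h}) / (γ h)` of the damping. -/
noncomputable def defect (P : Params) (h : ℝ) : ℝ := 1 - damping P h / (P.γ * h)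

section Damping

variable {P : Params} {h : ℝ}

theorem damping_eq (hP : P.Admissible) (hh : 0 < h) :
    damping P h = P.γ * h * (1 - defect P h) := by
  have := hP.γ_pos
  rw [defect]
  field_simp
  ring

theorem exp_neg_le_quadratic {x : ℝ} (hx : 0 ≤ x) : Real.exp (-x) ≤ 1 - x + x ^ 2 / 2 := by
  have h1 := Real.quadratic_le_exp_of_nonneg hx
  rw [Real.exp_neg, inv_le_iff_one_le_mul₀ (Real.exp_pos x)]
  have h2 : 0 ≤ 1 - x + x ^ 2 / 2 := by nlinarith [sq_nonneg (x - 1)]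
  -- The product equals `1 + x⁴/4`.
  calc 1 ≤ (1 - x + x ^ 2 / 2) * (1 + x + x ^ 2 / 2) := by nlinarith [sq_nonneg (x ^ 2)]
    _ ≤ _ := by gcongr

theorem defect_nonneg (hP : P.Admissible) (hh : 0 < h) : 0 ≤ defect P h := by
  have hx : 0 < P.γ * h := mul_pos hP.γ_pos hh
  rw [defect, sub_nonneg, div_le_one hx, damping]
  have := Real.add_one_le_exp (-P.γ * h)
  linarith

theorem defect_le (hP : P.Admissible) (hh : 0 < h) : defect P h ≤ P.γ * h / 2 := by
  have hx : 0 < P.γ * h := mul_pos hP.γ_pos hh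
  have h1 := exp_neg_le_quadratic hx.le
  rw [defect, sub_le_comm, le_div_iff₀ hx, damping, neg_mul]
  linarith

end Damping

/-! ### Difference of two copies after one step, in the coordinates `z` and `q` -/

section Step

variable {d : ℕ} {U G : Pos d → ℝ} {K : Pos d →L[ℝ] Pos d} {P : Params} {h : ℝ}

/-- The product of the two radicands is `(1 - η)²/(γ²h)`, a perfect square over `h`. This is why
`ξ₁` enters the position only through the defect. -/
theorem noise_coefficient (hP : P.Admissible) (hh : 0 < h) :
    √((1 - Real.exp (-P.γ * h) ^ 2) / (2 * P.γ)) *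
      √((1 - Real.exp (-P.γ * h)) / (1 + Real.exp (-P.γ * h)) * (2 / (P.γ * h)))
      = (1 - defect P h) * √h := by
  have hγ := hP.γ_pos
  have hη := Real.exp_pos (-P.γ * h)
  have hη1 : Real.exp (-P.γ * h) ≤ 1 := Real.exp_le_one_iff.2 (by nlinarith)
  have hδ : 0 ≤ damping P h := sub_nonneg.2 hη1
  have h1 : 1 - defect P h = damping P h / (P.γ * h) := by rw [defect]; ring
  have h2 : 0 ≤ 1 - Real.exp (-P.γ * h) ^ 2 := by nlinarith
  rw [← Real.sqrt_mul (by positivity), h1,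
    Real.sqrt_eq_iff_mul_self_eq (by have := sub_nonneg.2 hη1; positivity) (by positivity),
    mul_mul_mul_comm, Real.mul_self_sqrt hh.le, damping]
  field_simp
  ring

theorem sqrt_two_div_mul_sqrt (hP : P.Admissible) :
    √(2 / P.γ) * √h = √(2 * P.γ⁻¹ * h) := by
  have hγ := hP.γ_pos
  rw [← Real.sqrt_mul (by positivity)]
  congr 1

theorem inv_mul_sqrt_two_mul (hP : P.Admissible) : P.γ⁻¹ * √(2 * P.γ) = √(2 / P.γ) := by
  have hγ := hP.γ_pos
  rw [eq_comm, Real.sqrt_eq_iff_mul_self_eq (by positivity) (by positivity), mul_mul_mul_comm,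
    Real.mul_self_sqrt (by positivity)]
  field_simp

theorem Z2_sub (hP : P.Admissible) (hh : 0 < h) (ξ ξ' ξ₂ : Pos d) :
    Z2 P.γ h ξ ξ₂ - Z2 P.γ h ξ' ξ₂ = ((1 - defect P h) * √h) • (ξ - ξ') := by
  rw [← noise_coefficient hP hh, Z2, Z2]
  module

/-- The position difference after one step; `ξ'` is the first noise of the second copy. -/
theorem stepBU_fst_sub (hP : P.Admissible) (hh : 0 < h) {s s' : State d} {z q θ : Pos d}
    (hz : s.1 - s'.1 = z) (hq : z + P.γ⁻¹ • (s.2 - s'.2) = q)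
    (hθ : (P.γ⁻¹ * h) • (gradient U s.1 - gradient U s'.1) = θ) (ξ ξ' ξ₂ : Pos d) :
    (stepBU U P.γ h s ξ ξ₂).1 - (stepBU U P.γ h s' ξ' ξ₂).1
      = (1 - damping P h) • z + damping P h • q - damping P h • θ
        + defect P h • √(2 * P.γ⁻¹ * h) • (ξ - ξ') := by
  have h1 : (stepBU U P.γ h s ξ ξ₂).1 - (stepBU U P.γ h s' ξ' ξ₂).1
      = (s.1 - s'.1) + damping P h • (P.γ⁻¹ • (s.2 - s'.2)
          - (P.γ⁻¹ * h) • (gradient U s.1 - gradient U s'.1))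
        + √(2 / P.γ) • (√h • (ξ - ξ') - (Z2 P.γ h ξ ξ₂ - Z2 P.γ h ξ' ξ₂)) := by
    simp only [stepBU, stepU, stepB, Z1, damping, div_eq_mul_inv]
    module
  rw [h1, Z2_sub hP hh, ← sqrt_two_div_mul_sqrt hP, hθ, hz, ← hq]
  module

/-- The damping and the noise defect cancel in `q`: it is moved only by the gradient and by the full
noise `σ(ξ - ξ')`. The contractive coupling is therefore designed for `q`. -/
theorem stepBU_twisted_sub (hP : P.Admissible) (hh : 0 < h) {s s' : State d} {z q θ : Pos d}
    (hz : s.1 - s'.1 = z) (hq : z + P.γ⁻¹ • (s.2 - s'.2) = q)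
    (hθ : (P.γ⁻¹ * h) • (gradient U s.1 - gradient U s'.1) = θ) (ξ ξ' ξ₂ : Pos d) :
    (stepBU U P.γ h s ξ ξ₂).1 - (stepBU U P.γ h s' ξ' ξ₂).1
      + P.γ⁻¹ • ((stepBU U P.γ h s ξ ξ₂).2 - (stepBU U P.γ h s' ξ' ξ₂).2)
      = q - θ + √(2 * P.γ⁻¹ * h) • (ξ - ξ') := by
  have h1 : P.γ⁻¹ • ((stepBU U P.γ h s ξ ξ₂).2 - (stepBU U P.γ h s' ξ' ξ₂).2)
      = (1 - damping P h) • (P.γ⁻¹ • (s.2 - s'.2)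
          - (P.γ⁻¹ * h) • (gradient U s.1 - gradient U s'.1))
        + (P.γ⁻¹ * √(2 * P.γ)) • (Z2 P.γ h ξ ξ₂ - Z2 P.γ h ξ' ξ₂) := by
    simp only [stepBU, stepU, stepB, damping]
    module
  rw [stepBU_fst_sub hP hh hz hq hθ, h1, Z2_sub hP hh, inv_mul_sqrt_two_mul hP,
    ← sqrt_two_div_mul_sqrt hP, hθ, ← hq]
  module

/-! ### The gradient of the potential -/

theorem differentiable_quadratic (K : Pos d →L[ℝ] Pos d) :
    Differentiable ℝ fun x => 1 / 2 * ⟪x, K x⟫ :=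
  (differentiable_id.inner ℝ K.differentiable).const_mul _

theorem gradient_eq (hU : Differentiable ℝ U) (hG : IsSplitting U K G P) (x : Pos d) :
    gradient U x = K x + gradient G x := by
  have hGeq : G = fun x => U x - 1 / 2 * ⟪x, K x⟫ := by
    funext x
    rw [hG.split]
    ring
  have hGd : Differentiable ℝ G := by
    rw [hGeq]
    exact hU.sub (differentiable_quadratic K)
  have h1 : HasFDerivAt (fun x => 1 / 2 * ⟪x, K x⟫) (innerSL ℝ (K x)) x := by
    have h := ((hasFDerivAt_id (𝕜 := ℝ) x).inner ℝ K.hasFDerivAt).const_mul (1 / 2)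
    refine h.congr_fderiv ?_
    ext v
    simp only [id, smul_apply, ContinuousLinearMap.comp_apply,
      ContinuousLinearMap.prod_apply, fderivInnerCLM_apply, ContinuousLinearMap.id_apply,
      smul_eq_mul, innerSL_apply_apply]
    rw [hG.quadratic.inner_map_comm x v, real_inner_comm v]
    ring
  have h2 : HasGradientAt (fun x => 1 / 2 * ⟪x, K x⟫) (K x) x := h1
  have h3 := hGd x |>.hasGradientAt
  have h4 : HasGradientAt U (K x + gradient G x) x := by
    have e : U = fun x => 1 / 2 * ⟪x, K x⟫ + G x := funext hG.split
    rw [hasGradientAt_iff_hasFDerivAt] at h2 h3 ⊢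
    rw [map_add, e]
    exact h2.add h3
  exact h4.gradient

/-- Within distance `R` only the Lipschitz bound is available. The resulting loss is what `calR`
compensates, as `τℛ = L_G R² γ⁻²`. -/
theorem neg_le_inner_gradient (hP : P.Admissible) (hG : IsSplitting U K G P) (x y : Pos d) :
    -(P.LG * P.R ^ 2) ≤ ⟪gradient G x - gradient G y, x - y⟫ := by
  have hLG := hP.LG_nonneg
  rcases le_or_gt ‖x - y‖ P.R with h | h
  · have h1 := neg_le_of_abs_le (abs_real_inner_le_norm (gradient G x - gradient G y) (x - y))
    have h2 : ‖gradient G x - gradient G y‖ * ‖x - y‖ ≤ P.LG * ‖x - y‖ * ‖x - y‖ :=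
      mul_le_mul_of_nonneg_right (hG.lipschitz x y) (norm_nonneg _)
    have h3 : P.LG * ‖x - y‖ * ‖x - y‖ ≤ P.LG * P.R * P.R := by
      have := hP.R_nonneg
      gcongr
    nlinarith
  · have := hG.monotone x y h
    have : 0 ≤ P.LG * P.R ^ 2 := by positivity
    linarith

end Step

/-! ### Contraction of `r_l` under synchronous coupling -/

theorem abs_le_of_sq_le_mul {m a b c C : ℝ} (ha : 0 ≤ a) (hb : 0 ≤ b) (hC : 0 ≤ C)
    (h : m ^ 2 ≤ c * (a * b)) (hc : c ≤ 4 * C ^ 2) : |m| ≤ C * (a + b) := by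
  refine abs_le_of_sq_le_sq ?_ (by positivity)
  have hab : 0 ≤ a * b := by positivity
  nlinarith [mul_le_mul_of_nonneg_right hc hab, mul_nonneg (sq_nonneg C) (sq_nonneg (a - b))]

set_option maxHeartbeats 1000000 in
/-- The scalar inequality behind the contraction of `r_l`: `S` stands for `⟪z, A z⟫`, `Z` and `Y`
for `‖z‖ ^ 2` and `‖y‖ ^ 2`, where `A = γ⁻² K`. -/
theorem quadratic_contraction {x ω τ S Z Y zy zAy yAy zg gy Θ θz θy V N : ℝ}
    (hx : 0 < x) (hx' : x ≤ 1 / 15) (hω : 0 ≤ ω) (hω' : ω ≤ x / 2) (hτ : 0 < τ) (hτ' : τ ≤ 1 / 8)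
    (hY : 0 ≤ Y) (hZ : 0 ≤ Z) (hS : 4 * τ * Z ≤ S)
    (hzy : zy ^ 2 ≤ Z * Y) (hzAy : x * zAy ^ 2 ≤ 1 / 55 * (S * Y)) (hyAy : x * yAy ≤ 1 / 55 * Y)
    (hyAy0 : 0 ≤ yAy) (hgy : gy ^ 2 ≤ 1 / 13 * (S * Y)) (hΘ0 : 0 ≤ Θ) (hΘ : Θ ≤ S / 300)
    (hθz : θz ^ 2 ≤ Θ * Z) (hθy : θy ^ 2 ≤ Θ * Y)
    (eθz : θz = x * (S + zg)) (eθy : θy = x * (zAy + gy))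
    (hV : V = S + 1 / 2 * (1 - 2 * τ) ^ 2 * Z + (1 - 2 * τ) * zy + Y + (1 - 2 * τ) * θz
      + 2 * θy + Θ)
    (hN : N ≤ S + 1 / 2 * Z + zy + Y + θz + 2 * θy + Θ) (hzg : -(τ * N) ≤ zg) :
    S + 2 * (x * (1 - ω)) * zAy + (x * (1 - ω)) ^ 2 * yAy
      + 1 / 2 * ((1 - 2 * τ) ^ 2 * Z + 2 * (1 - 2 * τ) * (1 - 2 * τ * (x * (1 - ω))) * zy
        + (1 - 2 * τ * (x * (1 - ω))) ^ 2 * Y) + 1 / 2 * (1 - x * (1 - ω)) ^ 2 * Y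
      ≤ (1 - 7 / 12 * (x * τ)) * V := by
  have hS0 : 0 ≤ S := le_trans (by positivity) hS
  have hSY : 0 ≤ S * Y := by positivity
  -- Every error term below is measured against `S` and `Y`; products `S * Y` are split by the
  -- arithmetic-geometric mean inequality.
  have b1 : |x * zAy| ≤ 1 / 50 * (S + Y) := by
    refine abs_le_of_sq_le_mul (c := 1 / 825) hS0 hY (by norm_num) ?_ (by norm_num)
    calc (x * zAy) ^ 2 = x * (x * zAy ^ 2) := by ring
      _ ≤ x * (1 / 55 * (S * Y)) := by gcongr
      _ ≤ 1 / 15 * (1 / 55 * (S * Y)) := by gcongr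
      _ = _ := by ring
  have b1' : |2 * ω * zAy| ≤ 1 / 50 * (S + Y) := by
    refine le_trans ?_ b1
    rw [abs_mul (2 * ω), abs_mul x, abs_of_nonneg (by positivity : 0 ≤ 2 * ω), abs_of_pos hx]
    gcongr
    linarith
  have b2 : -(1 / 2 * Y + 2 / 13 * S) ≤ 2 * gy := by
    have h1 : (2 * gy) ^ 2 ≤ (1 / 2 * Y + 2 / 13 * S) ^ 2 := by
      nlinarith [sq_nonneg (1 / 2 * Y - 2 / 13 * S)]
    exact neg_le_of_abs_le (abs_le_of_sq_le_sq h1 (by positivity))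
  have b5 : |τ * zy| ≤ 1 / 11 * (S + Y) := by
    refine abs_le_of_sq_le_mul (c := 1 / 32) hS0 hY (by norm_num) ?_ (by norm_num)
    calc (τ * zy) ^ 2 = τ * (τ * zy ^ 2) := by ring
      _ ≤ τ * (τ * (Z * Y)) := by gcongr
      _ = τ * (1 / 4 * (4 * τ * Z) * Y) := by ring
      _ ≤ 1 / 8 * (1 / 4 * S * Y) := by gcongr
      _ = _ := by ring
  have b6 : |τ * θz| ≤ S / 90 := by
    refine abs_le_of_sq_le_sq ?_ (by positivity)
    calc (τ * θz) ^ 2 = τ * (τ * θz ^ 2) := by ring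
      _ ≤ τ * (τ * (Θ * Z)) := by gcongr
      _ = τ * (1 / 4 * (4 * τ * Z) * Θ) := by ring
      _ ≤ 1 / 8 * (1 / 4 * S * (S / 300)) := by gcongr
      _ ≤ _ := by nlinarith [sq_nonneg S]
  have b7 : |τ * θy| ≤ 1 / 270 * (S + Y) := by
    refine abs_le_of_sq_le_mul (c := 1 / 19200) hS0 hY (by norm_num) ?_ (by norm_num)
    calc (τ * θy) ^ 2 = τ ^ 2 * θy ^ 2 := by ring
      _ ≤ (1 / 8) ^ 2 * ((S / 300) * Y) := by
        gcongr
        exact hθy.trans (by gcongr)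
      _ = _ := by ring
  have b8 : τ * Θ ≤ 1 / 8 * (S / 300) := by gcongr
  have b8' : 0 ≤ τ * Θ := by positivity
  have bS : τ * S ≤ 1 / 8 * S := by gcongr
  have bY : τ * Y ≤ 1 / 8 * Y := by gcongr
  have bY' : 0 ≤ τ * Y := by positivity
  have hτN : τ * N ≤ S / 4 + τ * zy + 1 / 8 * Y + 1 / 50 * (S + Y) := by
    have h1 := mul_le_mul_of_nonneg_left hN hτ.le
    have := abs_le.1 b6
    have := abs_le.1 b7
    linarith
  set u := 1 - 2 * τ with hu
  have hu1 : u ≤ 1 := by linarith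
  have hu2 : 3 / 4 ≤ u := by linarith
  have hu0 : 0 ≤ u := by linarith
  have huu : u ^ 2 ≤ 1 := pow_le_one₀ hu0 hu1
  have hτV : τ * V ≤ S / 4 + u * (τ * zy) + 1 / 8 * Y + 1 / 50 * (S + Y) := by
    have e : τ * V = τ * S + 1 / 8 * (u ^ 2 * (4 * τ * Z)) + u * (τ * zy) + τ * Y
        + u * (τ * θz) + 2 * (τ * θy) + τ * Θ := by
      rw [hV]
      ring
    have h1 : u ^ 2 * (4 * τ * Z) ≤ 1 * S := by gcongr
    have h2 : u * (τ * θz) ≤ 1 * (S / 90) := by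
      refine (mul_le_mul_of_nonneg_left (le_of_abs_le b6) hu0).trans ?_
      gcongr
    have := abs_le.1 b7
    linarith
  have hum : |u * (τ * zy)| ≤ 1 / 11 * (S + Y) := by
    rw [abs_mul, abs_of_nonneg hu0]
    exact (mul_le_of_le_one_left (abs_nonneg _) hu1).trans b5
  have hc : |(2 * (1 - ω) - 1 - 7 / 12) * (u * (τ * zy))| ≤ 5 / 12 * (1 / 11 * (S + Y)) := by
    rw [abs_mul]
    gcongr
    rw [abs_le]
    constructor <;> linarith
  have hωY : 93 / 100 * Y ≤ (2 * τ * (1 - ω) - 2 * τ ^ 2 * (1 - ω) * (x * (1 - ω))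
      + (1 - ω) * (1 - x * (1 - ω) / 2)) * Y := by
    refine mul_le_mul_of_nonneg_right ?_ hY
    have hd : x * (1 - ω) ≤ 1 / 15 :=
      (mul_le_of_le_one_right hx.le (by linarith)).trans hx'
    have hd0 : 0 ≤ x * (1 - ω) := mul_nonneg hx.le (by linarith)
    have h1 : 0 ≤ 2 * τ * (1 - ω) * (1 - τ * (x * (1 - ω))) := by
      refine mul_nonneg (mul_nonneg (by positivity) (by linarith)) (sub_nonneg.2 ?_)
      exact mul_le_one₀ (by linarith) hd0 (by linarith)
    have h2 : 29 / 30 * (29 / 30) ≤ (1 - ω) * (1 - x * (1 - ω) / 2) :=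
      mul_le_mul (by linarith) (by linarith) (by norm_num) (by linarith)
    linarith
  have hyA : x * ((1 - ω) ^ 2 * yAy) ≤ 1 / 55 * Y := by
    refine le_trans ?_ hyAy
    gcongr
    refine mul_le_of_le_one_left hyAy0 (pow_le_one₀ (by linarith) (by linarith))
  -- The right side minus the left side of the goal is `x` times this expression plus `Θ`. The main
  -- positive terms are `u * S ≥ (3/4) S` and at least `(93/100) Y`.
  have hE : 0 ≤ u * S + u * zg + 2 * gy + 2 * ω * zAy - x * ((1 - ω) ^ 2 * yAy)
      + 2 * (1 - ω) * (u * (τ * zy))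
      + (2 * τ * (1 - ω) - 2 * τ ^ 2 * (1 - ω) * (x * (1 - ω))
        + (1 - ω) * (1 - x * (1 - ω) / 2)) * Y - 7 / 12 * (τ * V) := by
    have h1 : -(u * (S / 4 + τ * zy + 1 / 8 * Y + 1 / 50 * (S + Y))) ≤ u * zg := by
      rw [← mul_neg]
      exact mul_le_mul_of_nonneg_left (by linarith) hu0
    have h2 := (abs_le.1 b1').1
    have h3 := (abs_le.1 hc).1
    have h4 : u * Y ≤ Y := mul_le_of_le_one_left hY hu1
    have h5 : 3 / 4 * S ≤ u * S := by gcongr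
    linarith
  have hfin := add_nonneg (mul_nonneg hx.le hE) hΘ0
  refine sub_nonneg.1 (hfin.trans_eq ?_)
  linear_combination -hV - u * eθz - 2 * eθy

section Synchronous

variable {d : ℕ} {U G : Pos d → ℝ} {K : Pos d →L[ℝ] Pos d} {P : Params} {h : ℝ}

/-- With `y = q - z - θ` the step reads `z ↦ z + δy`, `q ↦ z + y`, where `δ` is the damping. The
gradient then appears only in the old norm, through `q = z + y + θ`, and the comparison is between
two quadratic forms in `z`, `y` and `θ`. -/
theorem rl_sq_synchronous_le (hP : P.Admissible) (hU : Differentiable ℝ U)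
    (hG : IsSplitting U K G P) (hh : 0 < h) (hx : P.γ * h ≤ 1 / 15)
    (hLK : P.LK * P.γ⁻¹ * h ≤ 1 / 55) {s s' : State d}
    (hs : s ≠ s' → calR P ≤ coreForm P (s - s')) (ξ ξ₂ : Pos d) :
    rl P K (stepBU U P.γ h s ξ ξ₂) (stepBU U P.γ h s' ξ ξ₂) ^ 2
      ≤ (1 - 7 / 12 * (P.γ * h * tau P)) * rl P K s s' ^ 2 := by
  have hK := hG.quadratic
  have hκ := hP.κ_pos
  have hγ : 0 < P.γ⁻¹ := inv_pos.2 hP.γ_pos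
  have hγγ : P.γ⁻¹ * P.γ = 1 := inv_mul_cancel₀ hP.γ_pos.ne'
  have hx0 : 0 < P.γ * h := mul_pos hP.γ_pos hh
  have hτ := tau_pos hP
  generalize hz : s.1 - s'.1 = z
  generalize hq : z + P.γ⁻¹ • (s.2 - s'.2) = q
  generalize hθ : (P.γ⁻¹ * h) • (gradient U s.1 - gradient U s'.1) = θ
  have e1 := stepBU_fst_sub hP hh hz hq hθ ξ ξ ξ₂
  have e2 := stepBU_twisted_sub hP hh hz hq hθ ξ ξ ξ₂
  rw [sub_self, smul_zero, smul_zero, add_zero] at e1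
  rw [sub_self, smul_zero, add_zero, e1] at e2
  rw [rl_sq hP hK e1 e2, rl_sq hP hK hz hq]
  generalize hg : P.γ⁻¹ ^ 2 • (gradient G s.1 - gradient G s'.1) = g
  have hθ' : θ = (P.γ * h) • (P.γ⁻¹ ^ 2 • K z + g) := by
    rw [← hθ, gradient_eq hU hG, gradient_eq hU hG, ← hg, ← hz, map_sub]
    have : P.γ * h * P.γ⁻¹ ^ 2 = P.γ⁻¹ * h := by
      rw [pow_two]
      linear_combination (P.γ⁻¹ * h) * hγγ
    rw [← smul_add, smul_smul, this]
    module
  generalize hy : q - z - θ = y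
  have hqe : q = z + y + θ := by rw [← hy]; module
  have hδ := damping_eq hP hh
  have hω := defect_nonneg hP hh
  have hω' := defect_le hP hh
  generalize defect P h = ω at *
  have hSκ : P.γ⁻¹ ^ 2 * P.κ * ‖z‖ ^ 2 ≤ P.γ⁻¹ ^ 2 * ⟪z, K z⟫ := by
    rw [mul_assoc]
    gcongr
    exact hK.mul_norm_sq_le_inner z
  have hSτ : 4 * tau P * ‖z‖ ^ 2 ≤ P.γ⁻¹ ^ 2 * ⟪z, K z⟫ :=
    (mul_le_mul_of_nonneg_right four_tau_le (sq_nonneg _)).trans hSκ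
  have hS0 := hK.inner_nonneg hκ z
  have hyy := hK.inner_nonneg hκ y
  -- The friction condition `γ² ≥ 13 L_G²/κ` makes the non-quadratic force small relative to the `K`
  -- term.
  have hgn : ‖g‖ ^ 2 ≤ 1 / 13 * (P.γ⁻¹ ^ 2 * ⟪z, K z⟫) := by
    have h1 : ‖g‖ ≤ P.γ⁻¹ ^ 2 * (P.LG * ‖z‖) := by
      rw [← hg, norm_smul, Real.norm_of_nonneg (by positivity), ← hz]
      gcongr
      exact hG.lipschitz _ _
    have h2 : P.γ⁻¹ ^ 4 * P.LG ^ 2 ≤ 1 / 13 * (P.γ⁻¹ ^ 2 * P.κ) := by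
      have h3 := mul_le_mul_of_nonneg_left hP.LG_sq_le (by positivity : 0 ≤ P.γ⁻¹ ^ 4)
      have h4 : P.γ⁻¹ ^ 4 * (P.κ * P.γ ^ 2) = P.γ⁻¹ ^ 2 * P.κ * (P.γ⁻¹ * P.γ) ^ 2 := by ring
      rw [h4, hγγ] at h3
      linarith
    calc ‖g‖ ^ 2 ≤ (P.γ⁻¹ ^ 2 * (P.LG * ‖z‖)) ^ 2 := by gcongr
      _ = P.γ⁻¹ ^ 4 * P.LG ^ 2 * ‖z‖ ^ 2 := by ring
      _ ≤ 1 / 13 * (P.γ⁻¹ ^ 2 * P.κ) * ‖z‖ ^ 2 := by gcongr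
      _ = 1 / 13 * (P.γ⁻¹ ^ 2 * P.κ * ‖z‖ ^ 2) := by ring
      _ ≤ _ := by gcongr
  have hAz : ‖P.γ⁻¹ ^ 2 • K z‖ ^ 2 ≤ P.γ⁻¹ ^ 2 * P.LK * (P.γ⁻¹ ^ 2 * ⟪z, K z⟫) := by
    rw [norm_smul, Real.norm_of_nonneg (by positivity), mul_pow]
    calc (P.γ⁻¹ ^ 2) ^ 2 * ‖K z‖ ^ 2 ≤ (P.γ⁻¹ ^ 2) ^ 2 * (P.LK * ⟪z, K z⟫) := by
          gcongr
          exact hK.norm_map_sq_le hκ z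
      _ = _ := by ring
  have hxL : P.γ * h * (P.γ⁻¹ ^ 2 * P.LK) ≤ 1 / 55 := by
    refine le_of_eq_of_le ?_ hLK
    rw [pow_two]
    linear_combination (P.γ⁻¹ * h * P.LK) * hγγ
  have key := quadratic_contraction (x := P.γ * h) (ω := ω) (τ := tau P)
    (S := P.γ⁻¹ ^ 2 * ⟪z, K z⟫) (Z := ‖z‖ ^ 2) (Y := ‖y‖ ^ 2) (zy := ⟪z, y⟫)
    (zAy := P.γ⁻¹ ^ 2 * ⟪z, K y⟫) (yAy := P.γ⁻¹ ^ 2 * ⟪y, K y⟫) (zg := ⟪z, g⟫) (gy := ⟪g, y⟫)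
    (Θ := ‖θ‖ ^ 2) (θz := ⟪θ, z⟫) (θy := ⟪θ, y⟫)
    (V := P.γ⁻¹ ^ 2 * ⟪z, K z⟫ + 1 / 2 * ‖q - (2 * tau P) • z‖ ^ 2 + 1 / 2 * ‖q - z‖ ^ 2)
    (N := P.γ⁻¹ ^ 2 * P.κ * ‖z‖ ^ 2 + 1 / 2 * ‖q‖ ^ 2 + 1 / 2 * ‖q - z‖ ^ 2)
    hx0 hx hω hω' hτ tau_le_eighth (by positivity) (by positivity) hSτ ?_ ?_ ?_ (by positivity)
    ?_ (by positivity) ?_ ?_ ?_ ?_ ?_ ?_ ?_ ?_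
  · refine le_trans (le_of_eq ?_) key
    rw [hqe, hδ]
    generalize P.γ * h * (1 - ω) = δ
    have a1 : (1 - δ) • z + δ • (z + y + θ) - δ • θ = z + δ • y := by module
    have a2 : z + y + θ - θ - (2 * tau P) • (z + δ • y)
      = (1 - 2 * tau P) • z + (1 - 2 * tau P * δ) • y := by module
    have a3 : z + y + θ - θ - (z + δ • y) = (1 - δ) • y := by module
    rw [a1, a2, a3, norm_smul, mul_pow, Real.norm_eq_abs, sq_abs, map_add, map_smul,
      norm_add_sq_real]
    simp only [inner_add_left, inner_add_right, inner_smul_left, inner_smul_right, conj_trivial,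
      norm_smul, mul_pow, Real.norm_eq_abs, sq_abs, hK.inner_map_comm y z]
    ring
  · rw [← mul_pow]
    exact sq_le_sq' (neg_le_of_abs_le (abs_real_inner_le_norm z y)) (real_inner_le_norm z y)
  · have h1 := hK.inner_sq_le hκ z y
    have h2 := hK.inner_le_mul_norm_sq y
    calc P.γ * h * (P.γ⁻¹ ^ 2 * ⟪z, K y⟫) ^ 2
        = P.γ * h * (P.γ⁻¹ ^ 2) ^ 2 * ⟪z, K y⟫ ^ 2 := by ring
      _ ≤ P.γ * h * (P.γ⁻¹ ^ 2) ^ 2 * (⟪z, K z⟫ * (P.LK * ‖y‖ ^ 2)) := by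
        gcongr
        exact h1.trans (by gcongr)
      _ = P.γ * h * (P.γ⁻¹ ^ 2 * P.LK) * (P.γ⁻¹ ^ 2 * ⟪z, K z⟫ * ‖y‖ ^ 2) := by ring
      _ ≤ _ := by gcongr
  · calc P.γ * h * (P.γ⁻¹ ^ 2 * ⟪y, K y⟫) ≤ P.γ * h * (P.γ⁻¹ ^ 2 * (P.LK * ‖y‖ ^ 2)) := by
          gcongr
          exact hK.inner_le_mul_norm_sq y
      _ = P.γ * h * (P.γ⁻¹ ^ 2 * P.LK) * ‖y‖ ^ 2 := by ring
      _ ≤ _ := by gcongr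
  · have h1 : ⟪g, y⟫ ^ 2 ≤ ‖g‖ ^ 2 * ‖y‖ ^ 2 := by
      rw [← mul_pow]
      exact sq_le_sq' (neg_le_of_abs_le (abs_real_inner_le_norm g y)) (real_inner_le_norm g y)
    rw [← mul_assoc]
    exact h1.trans (by gcongr)
  · have h1 : ‖P.γ⁻¹ ^ 2 • K z + g‖ ^ 2 ≤ 2 * (‖P.γ⁻¹ ^ 2 • K z‖ ^ 2 + ‖g‖ ^ 2) := by
      have := norm_add_le (P.γ⁻¹ ^ 2 • K z) g
      have h2 : ‖P.γ⁻¹ ^ 2 • K z + g‖ ^ 2 ≤ (‖P.γ⁻¹ ^ 2 • K z‖ + ‖g‖) ^ 2 := by gcongr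
      nlinarith [sq_nonneg (‖P.γ⁻¹ ^ 2 • K z‖ - ‖g‖)]
    rw [hθ', norm_smul, Real.norm_of_nonneg hx0.le, mul_pow]
    generalize P.γ⁻¹ ^ 2 * ⟪z, K z⟫ = S at *
    have hS : 0 ≤ S := le_trans (by positivity) hSτ
    generalize P.γ * h = x at *
    have hLK0 := hP.LK_pos
    calc x ^ 2 * ‖P.γ⁻¹ ^ 2 • K z + g‖ ^ 2
        ≤ x ^ 2 * (2 * (P.γ⁻¹ ^ 2 * P.LK * S + 1 / 13 * S)) := by
          gcongr
          exact h1.trans (by gcongr)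
      _ = 2 * x * (x * (P.γ⁻¹ ^ 2 * P.LK)) * S + 2 / 13 * x ^ 2 * S := by ring
      _ ≤ 2 * (1 / 15) * (1 / 55) * S + 2 / 13 * (1 / 15) ^ 2 * S := by gcongr
      _ ≤ S / 300 := by linarith
  · rw [← mul_pow]
    exact sq_le_sq' (neg_le_of_abs_le (abs_real_inner_le_norm θ z)) (real_inner_le_norm θ z)
  · rw [← mul_pow]
    exact sq_le_sq' (neg_le_of_abs_le (abs_real_inner_le_norm θ y)) (real_inner_le_norm θ y)
  · rw [hθ', inner_smul_left, inner_add_left, inner_smul_left, conj_trivial, conj_trivial,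
      real_inner_comm z (K z), real_inner_comm z g]
  · rw [hθ', inner_smul_left, inner_add_left, inner_smul_left, conj_trivial, conj_trivial,
      hK.inner_map_comm z y, real_inner_comm (K z) y]
  · have a1 : q - (2 * tau P) • z = (1 - 2 * tau P) • z + y + θ := by rw [hqe]; module
    have a2 : q - z = y + θ := by rw [hqe]; module
    rw [a1, a2]
    simp only [← real_inner_self_eq_norm_sq, inner_add_left, inner_add_right, inner_smul_left,
      inner_smul_right, conj_trivial, real_inner_comm θ z, real_inner_comm θ y,
      real_inner_comm y z]
    ring
  · have a2 : q - z = y + θ := by rw [hqe]; module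
    have a3 : 1 / 2 * ‖q‖ ^ 2 + 1 / 2 * ‖q - z‖ ^ 2
        = 1 / 2 * ‖z‖ ^ 2 + ⟪z, y⟫ + ‖y‖ ^ 2 + ⟪θ, z⟫ + 2 * ⟪θ, y⟫ + ‖θ‖ ^ 2 := by
      rw [a2, hqe]
      simp only [← real_inner_self_eq_norm_sq, inner_add_left, inner_add_right,
        real_inner_comm θ z, real_inner_comm θ y, real_inner_comm y z]
      ring
    linarith
  · by_cases hss : s = s'
    · have hz0 : z = 0 := by rw [← hz, hss, sub_self]
      rw [hz0, inner_zero_left, neg_nonpos]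
      positivity
    · have h1 := hs hss
      have h2 := neg_le_inner_gradient hP hG s.1 s'.1
      have h3 : coreForm P (s - s') = P.γ⁻¹ ^ 2 * P.κ * ‖z‖ ^ 2 + 1 / 2 * ‖q‖ ^ 2
          + 1 / 2 * ‖q - z‖ ^ 2 := by
        have a4 : P.γ⁻¹ • (s.2 - s'.2) = q - z := by rw [← hq]; module
        rw [coreForm, Prod.fst_sub, Prod.snd_sub, hz, hq, a4]
        ring
      rw [← h3]
      -- Being outside the interior of `𝒦` makes `τ` times the form at least the worst possible loss
      -- from `G`.
      have h4 : tau P * calR P = P.LG * P.R ^ 2 * P.γ⁻¹ ^ 2 := by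
        rw [calR]
        field_simp
      have h5 := mul_le_mul_of_nonneg_left h1 hτ.le
      have h6 : ⟪z, g⟫ = P.γ⁻¹ ^ 2 * ⟪gradient G s.1 - gradient G s'.1, s.1 - s'.1⟫ := by
        rw [← hg, inner_smul_right, hz, real_inner_comm]
      have h7 := mul_le_mul_of_nonneg_left h2 (by positivity : 0 ≤ P.γ⁻¹ ^ 2)
      linarith

end Synchronous

/-! ### The maximal coupling of two shifted Gaussians on the line -/

section Line

theorem gaussianPDFReal_std (t : ℝ) :
    gaussianPDFReal 0 1 t = (√(2 * Real.pi))⁻¹ * Real.exp (-t ^ 2 / 2) := by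
  simp [gaussianPDFReal]

theorem gaussianPDFReal_std_neg (t : ℝ) : gaussianPDFReal 0 1 (-t) = gaussianPDFReal 0 1 t := by
  rw [gaussianPDFReal_std, gaussianPDFReal_std, neg_sq]

theorem gaussianPDFReal_std_le (t : ℝ) : gaussianPDFReal 0 1 t ≤ 2 / 5 := by
  have h1 : Real.exp (-t ^ 2 / 2) ≤ 1 := Real.exp_le_one_iff.2 (by nlinarith [sq_nonneg t])
  have h2 : 5 / 2 ≤ √(2 * Real.pi) := by
    refine Real.le_sqrt_of_sq_le ?_
    have := Real.pi_gt_d2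
    norm_num
    linarith
  rw [gaussianPDFReal_std]
  calc (√(2 * Real.pi))⁻¹ * Real.exp (-t ^ 2 / 2) ≤ (5 / 2)⁻¹ * 1 := by gcongr
    _ = 2 / 5 := by norm_num

theorem gaussianPDFReal_std_pos (t : ℝ) : 0 < gaussianPDFReal 0 1 t :=
  gaussianPDFReal_pos 0 1 t one_ne_zero

theorem gaussianPDFReal_std_shift_lt {b t : ℝ} (hb : 0 < b) (ht : -(b / 2) < t) :
    gaussianPDFReal 0 1 (t + b) < gaussianPDFReal 0 1 t := by
  rw [gaussianPDFReal_std, gaussianPDFReal_std]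
  have : -(t + b) ^ 2 / 2 < -t ^ 2 / 2 := by nlinarith
  gcongr

theorem le_gaussianPDFReal_std_shift {b t : ℝ} (hb : 0 < b) (ht : t ≤ -(b / 2)) :
    gaussianPDFReal 0 1 t ≤ gaussianPDFReal 0 1 (t + b) := by
  rw [gaussianPDFReal_std, gaussianPDFReal_std]
  have : -t ^ 2 / 2 ≤ -(t + b) ^ 2 / 2 := by nlinarith
  gcongr

/-- This positive part is the density of being at `t` and reflected. It lives on `t > -b/2`, where
the reflected signed distance `b + 2t` is positive. -/
theorem max_sub_gaussianPDFReal_std {b : ℝ} (hb : 0 < b) (t : ℝ) :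
    max (gaussianPDFReal 0 1 t - gaussianPDFReal 0 1 (t + b)) 0
      = (Ioi (-(b / 2))).indicator (fun t => gaussianPDFReal 0 1 t
          - gaussianPDFReal 0 1 (t + b)) t := by
  by_cases ht : -(b / 2) < t
  · rw [indicator_of_mem (mem_Ioi.2 ht), max_eq_left]
    exact sub_nonneg.2 (gaussianPDFReal_std_shift_lt hb ht).le
  · rw [indicator_of_notMem (by simpa using ht), max_eq_right]
    exact sub_nonpos.2 (le_gaussianPDFReal_std_shift hb (not_lt.1 ht))

/-- The law of a standard normal variable and an independent uniform variable on `[0, 1]`. -/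
noncomputable def lineLaw : Measure (ℝ × ℝ) :=
  (gaussianReal 0 1).prod (volume.restrict (Icc (0 : ℝ) 1))

instance isProbabilityMeasure_uniform :
    IsProbabilityMeasure (volume.restrict (Icc (0 : ℝ) 1)) :=
  ⟨by simp⟩

/-- The value `y t` if the coupled pair is reflected, and `0` if the copies coalesce. -/
noncomputable def reflected (b : ℝ) (y : ℝ → ℝ) (p : ℝ × ℝ) : ℝ :=
  open Classical in
  if p.2 ≤ gaussianPDFReal 0 1 (p.1 + b) / gaussianPDFReal 0 1 p.1 then 0 else y p.1

theorem measurableSet_coalescence (b : ℝ) : MeasurableSet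
    {p : ℝ × ℝ | p.2 ≤ gaussianPDFReal 0 1 (p.1 + b) / gaussianPDFReal 0 1 p.1} := by
  have h := measurable_gaussianPDFReal 0 1
  exact measurableSet_le measurable_snd
    ((h.comp (measurable_fst.add_const b)).div (h.comp measurable_fst))

theorem measurable_reflected (b : ℝ) {y : ℝ → ℝ} (hy : Measurable y) :
    Measurable (reflected b y) :=
  Measurable.ite (measurableSet_coalescence b) measurable_const (hy.comp measurable_fst)

theorem integrable_reflected (b : ℝ) {y : ℝ → ℝ} (hy : Measurable y)
    (hi : Integrable y (gaussianReal 0 1)) : Integrable (reflected b y) lineLaw := by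
  have h : Integrable (fun p : ℝ × ℝ => y p.1) lineLaw := hi.comp_fst _
  refine h.mono (measurable_reflected b hy).aestronglyMeasurable (ae_of_all _ fun p => ?_)
  unfold reflected
  split_ifs
  · simp
  · exact le_rfl

theorem integral_uniform_ite {c y : ℝ} (hc : 0 ≤ c) :
    open Classical in
    ∫ u in Icc (0 : ℝ) 1, (if u ≤ c then 0 else y) = y * max (1 - c) 0 := by
  classical
  have h1 : (fun u : ℝ => if u ≤ c then 0 else y) = (Ioi c).indicator fun _ => y := by
    funext u
    by_cases hu : u ≤ c
    · rw [if_pos hu, indicator_of_notMem (by simpa using hu)]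
    · rw [if_neg hu, indicator_of_mem (by simpa using hu)]
  have h2 : Icc (0 : ℝ) 1 ∩ Ioi c = Ioc c 1 := by
    ext u
    simp only [mem_inter_iff, mem_Icc, mem_Ioi, mem_Ioc]
    constructor
    · rintro ⟨⟨-, h⟩, h'⟩
      exact ⟨h', h⟩
    · rintro ⟨h', h⟩
      exact ⟨⟨hc.trans h'.le, h⟩, h'⟩
  rw [h1, setIntegral_indicator measurableSet_Ioi, h2, setIntegral_const, Real.volume_real_Ioc,
    smul_eq_mul, mul_comm]

/-- Integrating out the uniform variable multiplies the density at `t` by the rejection probability,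
which leaves the positive part of the difference of densities. -/
theorem integral_reflected {b : ℝ} (hb : 0 < b) {y : ℝ → ℝ} (hy : Measurable y)
    (hi : Integrable y (gaussianReal 0 1)) :
    ∫ p, reflected b y p ∂lineLaw
      = ∫ t, y t * (Ioi (-(b / 2))).indicator (fun t => gaussianPDFReal 0 1 t
          - gaussianPDFReal 0 1 (t + b)) t := by
  have h1 := integrable_reflected b hy hi
  unfold lineLaw at h1 ⊢
  rw [integral_prod _ h1, integral_gaussianReal_eq_integral_smul one_ne_zero]
  refine integral_congr_ae (ae_of_all _ fun t => ?_)
  have h2 := gaussianPDFReal_std_pos t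
  have h3 := gaussianPDFReal_std_pos (t + b)
  show gaussianPDFReal 0 1 t • ∫ u in Icc (0 : ℝ) 1, reflected b y (t, u) = _
  have h4 := integral_uniform_ite (y := y t)
    (div_nonneg h3.le h2.le : 0 ≤ gaussianPDFReal 0 1 (t + b) / gaussianPDFReal 0 1 t)
  unfold reflected
  simp only
  rw [h4, ← max_sub_gaussianPDFReal_std hb, smul_eq_mul,
    mul_left_comm, mul_max_of_nonneg _ _ h2.le, mul_zero]
  congr 2
  field_simp

theorem integrable_id_mul_gaussianPDFReal :
    Integrable fun t : ℝ => t * gaussianPDFReal 0 1 t := by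
  have h : Integrable (fun t : ℝ => t) (gaussianReal 0 1) :=
    (memLp_id_gaussianReal 1).integrable le_rfl
  rw [gaussianReal_of_var_ne_zero 0 one_ne_zero, integrable_withDensity_iff_integrable_smul'
    (measurable_gaussianPDF 0 1) (ae_of_all _ fun _ => gaussianPDF_lt_top)] at h
  refine h.congr (ae_of_all _ fun t => ?_)
  simp only [toReal_gaussianPDF, smul_eq_mul]
  ring

theorem integral_id_mul_gaussianPDFReal : ∫ t : ℝ, t * gaussianPDFReal 0 1 t = 0 := by
  have h := integral_id_gaussianReal (μ := 0) (v := 1)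
  rw [integral_gaussianReal_eq_integral_smul one_ne_zero] at h
  refine Eq.trans (integral_congr_ae (ae_of_all _ fun t => ?_)) h
  simp only [smul_eq_mul]
  ring

/-- The coupled distance is a martingale. -/
theorem integral_reflected_affine {b : ℝ} (hb : 0 < b) :
    ∫ p, reflected b (fun t => b + 2 * t) p ∂lineLaw = b := by
  have hid : Integrable (fun t : ℝ => t) (gaussianReal 0 1) :=
    (memLp_id_gaussianReal 1).integrable le_rfl
  have hφ := integrable_gaussianPDFReal 0 1
  have hA : Integrable fun t : ℝ => (b + 2 * t) * gaussianPDFReal 0 1 t := by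
    refine ((hφ.const_mul b).add (integrable_id_mul_gaussianPDFReal.const_mul 2)).congr
      (ae_of_all _ fun t => ?_)
    simp only [Pi.add_apply]
    ring
  set A : ℝ → ℝ := fun t => (b + 2 * t) * gaussianPDFReal 0 1 t with hAdef
  have hF := hA.indicator (measurableSet_Ioi (a := -(b / 2)))
  have hF' := hA.indicator (measurableSet_Iic (a := -(b / 2)))
  have hF2 : Integrable fun t => -(Iic (-(b / 2))).indicator A (-b - t) :=
    ((integrable_comp_sub_left _ (-b)).2 hF').neg
  -- The reflection `t ↦ -b - t` negates `b + 2t`, carries the shifted density to the unshifted one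
  -- and exchanges the half-lines. The two pieces thus recombine into the integral of `(b + 2t)φ(t)`
  -- over the whole line.
  have hpt (t : ℝ) : (b + 2 * t) * (Ioi (-(b / 2))).indicator (fun t => gaussianPDFReal 0 1 t
      - gaussianPDFReal 0 1 (t + b)) t
      = (Ioi (-(b / 2))).indicator A t - -(Iic (-(b / 2))).indicator A (-b - t) := by
    have e1 : gaussianPDFReal 0 1 (-b - t) = gaussianPDFReal 0 1 (t + b) := by
      rw [← gaussianPDFReal_std_neg]
      congr 1
      ring
    rcases lt_trichotomy t (-(b / 2)) with ht | ht | ht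
    · rw [indicator_of_notMem (by simpa using ht.le), indicator_of_notMem (by simpa using ht.le),
        indicator_of_notMem (by rw [mem_Iic]; linarith)]
      simp
    -- The fixed point of the reflection belongs to `Iic` but not to `Ioi`; there `b + 2t` vanishes,
    -- so the mismatch is harmless.
    · have e2 : b + 2 * t = 0 := by linarith
      have e3 : b + 2 * (-b - t) = 0 := by linarith
      have e4 (S : Set ℝ) (x : ℝ) (hx : b + 2 * x = 0) : S.indicator A x = 0 :=
        indicator_apply_eq_zero.2 fun _ => by rw [hAdef]; simp [hx]
      rw [e2, e4 _ _ e2, e4 _ _ e3]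
      simp
    · rw [indicator_of_mem (mem_Ioi.2 ht), indicator_of_mem (mem_Ioi.2 ht),
        indicator_of_mem (by rw [mem_Iic]; linarith)]
      simp only [hAdef, e1]
      ring
  have hi : Integrable (fun t : ℝ => b + 2 * t) (gaussianReal 0 1) :=
    (integrable_const b).add (hid.const_mul 2)
  rw [integral_reflected hb (by fun_prop) hi,
    integral_congr_ae (ae_of_all _ hpt), integral_sub hF hF2, integral_neg,
    integral_sub_left_eq_self ((Iic (-(b / 2))).indicator A) volume, sub_neg_eq_add,
    integral_indicator measurableSet_Ioi, integral_indicator measurableSet_Iic, add_comm,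
    ← compl_Iic, integral_add_compl measurableSet_Iic hA]
  have e : A = fun t => b * gaussianPDFReal 0 1 t + 2 * (t * gaussianPDFReal 0 1 t) := by
    funext t
    rw [hAdef]
    ring
  rw [e, integral_add (hφ.const_mul b) (integrable_id_mul_gaussianPDFReal.const_mul 2),
    integral_const_mul, integral_const_mul, integral_id_mul_gaussianPDFReal,
    integral_gaussianPDFReal_eq_one 0 one_ne_zero]
  ring

theorem integral_indicator_gaussianPDFReal_le {a b : ℝ} (hab : a ≤ b) :
    ∫ t in Ioc a b, gaussianPDFReal 0 1 t ≤ 2 / 5 * (b - a) := by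
  have h : ∫ _ in Ioc a b, (2 / 5 : ℝ) = 2 / 5 * (b - a) := by
    rw [setIntegral_const, Real.volume_real_Ioc_of_le hab, smul_eq_mul, mul_comm]
  rw [← h]
  exact setIntegral_mono (integrable_gaussianPDFReal 0 1).integrableOn
    (integrableOn_const (by simp)) gaussianPDFReal_std_le

/-- The copies fail to coalesce with small probability if they are close. -/
theorem integral_reflected_one_le {b : ℝ} (hb : 0 < b) :
    ∫ p, reflected b (fun _ => 1) p ∂lineLaw ≤ 2 / 5 * b := by
  have hφ := integrable_gaussianPDFReal 0 1
  have hF := hφ.indicator (measurableSet_Ioi (a := -(b / 2)))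
  have hF' := hφ.indicator (measurableSet_Ioi (a := b / 2))
  have hF2 : Integrable fun t => (Ioi (b / 2)).indicator (gaussianPDFReal 0 1) (t + b) :=
    hF'.comp_add_right b
  -- Shifting the second density by `b` leaves the Gaussian mass of `(-b/2, b/2]`.
  have hpt (t : ℝ) : 1 * (Ioi (-(b / 2))).indicator (fun t => gaussianPDFReal 0 1 t
      - gaussianPDFReal 0 1 (t + b)) t
      = (Ioi (-(b / 2))).indicator (gaussianPDFReal 0 1) t
        - (Ioi (b / 2)).indicator (gaussianPDFReal 0 1) (t + b) := by
    by_cases ht : -(b / 2) < t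
    · rw [indicator_of_mem (mem_Ioi.2 ht), indicator_of_mem (mem_Ioi.2 ht),
        indicator_of_mem (by rw [mem_Ioi]; linarith), one_mul]
    · rw [indicator_of_notMem (by simpa using ht), indicator_of_notMem (by simpa using ht),
        indicator_of_notMem (by rw [mem_Ioi]; linarith)]
      simp
  rw [integral_reflected hb measurable_const (integrable_const 1),
    integral_congr_ae (ae_of_all _ hpt), integral_sub hF hF2,
    integral_add_right_eq_self ((Ioi (b / 2)).indicator (gaussianPDFReal 0 1)),
    integral_indicator measurableSet_Ioi, integral_indicator measurableSet_Ioi]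
  have h1 : Ioi (-(b / 2)) = Ioc (-(b / 2)) (b / 2) ∪ Ioi (b / 2) :=
    (Ioc_union_Ioi_eq_Ioi (by linarith)).symm
  have h2 := integral_indicator_gaussianPDFReal_le (a := -(b / 2)) (b := b / 2) (by linarith)
  rw [h1, setIntegral_union (Ioc_disjoint_Ioi le_rfl) measurableSet_Ioi
    hφ.integrableOn hφ.integrableOn]
  linarith

/-- By symmetry the tail is half of what remains after removing `(-c, c]`, whose mass is at most
`2/5` times its length. -/
theorem gaussianReal_std_Iic_ge {c : ℝ} (hc : 0 ≤ c) :
    1 / 2 - 2 / 5 * c ≤ (gaussianReal 0 1).real (Iic (-c)) := by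
  have hφ := integrable_gaussianPDFReal 0 1
  have h (S : Set ℝ) : (gaussianReal 0 1).real S = ∫ t in S, gaussianPDFReal 0 1 t := by
    rw [measureReal_def, gaussianReal_apply_eq_integral 0 one_ne_zero, ENNReal.toReal_ofReal]
    exact integral_nonneg fun t => (gaussianPDFReal_std_pos t).le
  have h1 : ∫ t in Ioi c, gaussianPDFReal 0 1 t = ∫ t in Iic (-c), gaussianPDFReal 0 1 t := by
    have h2 := integral_comp_neg_Iic (-c) (gaussianPDFReal 0 1)
    simp only [gaussianPDFReal_std_neg, neg_neg] at h2
    exact h2.symm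
  have h2 : ∫ t, gaussianPDFReal 0 1 t = (∫ t in Iic (-c), gaussianPDFReal 0 1 t)
      + ((∫ t in Ioc (-c) c, gaussianPDFReal 0 1 t) + ∫ t in Ioi c, gaussianPDFReal 0 1 t) := by
    rw [← setIntegral_union (Ioc_disjoint_Ioi le_rfl) measurableSet_Ioi
      hφ.integrableOn hφ.integrableOn, Ioc_union_Ioi_eq_Ioi (by linarith), ← compl_Iic,
      integral_add_compl measurableSet_Iic hφ]
  have h3 := integral_indicator_gaussianPDFReal_le (a := -c) (b := c) (by linarith)
  rw [integral_gaussianPDFReal_eq_one 0 one_ne_zero] at h2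
  rw [h]
  linarith

end Line

/-! ### The contractive coupling in `ℝ^d` -/

section Coupling

variable {d : ℕ} {γ h : ℝ}

instance isProbabilityMeasure_noiseLaw : IsProbabilityMeasure (noiseLaw d) := by
  unfold noiseLaw
  infer_instance

theorem map_inner_stdGaussian {e : Pos d} (he : ‖e‖ = 1) :
    (stdGaussian (Pos d)).map (fun ξ => ⟪e, ξ⟫) = gaussianReal 0 1 := by
  have h1 := IsGaussian.map_eq_gaussianReal (μ := stdGaussian (Pos d)) (innerSL ℝ e)
  rw [integral_strongDual_stdGaussian, variance_dual_stdGaussian, innerSL_apply_norm, he] at h1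
  simpa using h1

/-- The coupling acts only along `e`, so all its moments reduce to a one-dimensional Gaussian and
the uniform variable. -/
theorem map_noiseLaw {e : Pos d} (he : ‖e‖ = 1) :
    (noiseLaw d).map (fun n => (⟪e, n.1⟫, n.2.2)) = lineLaw := by
  have h1 : Measurable fun ξ : Pos d => ⟪e, ξ⟫ := by fun_prop
  have h2 := Measure.map_prod_map (stdGaussian (Pos d))
    ((stdGaussian (Pos d)).prod (volume.restrict (Icc (0 : ℝ) 1))) h1 measurable_snd
  rw [Measure.map_snd_prod, measure_univ, one_smul, map_inner_stdGaussian he] at h2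
  exact h2.symm

/-- The distance of the coupled twisted coordinates before the drift is added. -/
noncomputable def coupledDist (γ h : ℝ) (q : Pos d) (n : Pos d × Pos d × ℝ) : ℝ :=
  ‖q + √(2 * γ⁻¹ * h) • (n.1 - contractiveNoise γ h q n.1 n.2.2)‖

theorem coupledDist_nonneg (q : Pos d) (n : Pos d × Pos d × ℝ) : 0 ≤ coupledDist γ h q n :=
  norm_nonneg _

theorem coupledDist_zero (n : Pos d × Pos d × ℝ) : coupledDist γ h 0 n = 0 := by
  simp [coupledDist, contractiveNoise]

theorem measurable_contractiveNoise (γ h : ℝ) :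
    Measurable fun p : Pos d × Pos d × ℝ => contractiveNoise γ h p.1 p.2.1 p.2.2 := by
  have hφ := measurable_gaussianPDFReal 0 1
  have he : Measurable fun p : Pos d × Pos d × ℝ => ⟪‖p.1‖⁻¹ • p.1, p.2.1⟫ := by fun_prop
  unfold contractiveNoise
  refine Measurable.ite (measurableSet_le (by fun_prop) ?_) (by fun_prop) (by fun_prop)
  exact (hφ.comp (by fun_prop)).div (hφ.comp he)

theorem measurable_coupledDist (q : Pos d) : Measurable (coupledDist γ h q) := by
  have h1 : Measurable fun n : Pos d × Pos d × ℝ => contractiveNoise γ h q n.1 n.2.2 :=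
    (measurable_contractiveNoise γ h).comp (f := fun n : Pos d × Pos d × ℝ => (q, n.1, n.2.2))
      (by fun_prop)
  unfold coupledDist
  fun_prop

theorem ae_le_one : ∀ᵐ n ∂noiseLaw d, n.2.2 ≤ 1 := by
  have h1 : ∀ᵐ u ∂(volume.restrict (Icc (0 : ℝ) 1)), u ≤ 1 :=
    (ae_restrict_mem measurableSet_Icc).mono fun u hu => hu.2
  have h2 := (Measure.quasiMeasurePreserving_snd (μ := stdGaussian (Pos d))
    (ν := volume.restrict (Icc (0 : ℝ) 1))).ae h1
  exact (Measure.quasiMeasurePreserving_snd (μ := stdGaussian (Pos d))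
    (ν := (stdGaussian (Pos d)).prod (volume.restrict (Icc (0 : ℝ) 1)))).ae h2

/-- When the shift is accepted it cancels `q`, because `σβ = 1`; when reflected, the vector stays on
the line through `e`. -/
theorem coupledDist_eq {σ : ℝ} (hσ : 0 < σ) (hσh : √(2 * γ⁻¹ * h) = σ) {q : Pos d} (hq : q ≠ 0)
    {n : Pos d × Pos d × ℝ} (hn : n.2.2 ≤ 1) :
    coupledDist γ h q n = σ * reflected (‖q‖ / σ) (fun t => ‖q‖ / σ + 2 * t)
      (⟪‖q‖⁻¹ • q, n.1⟫, n.2.2) := by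
  have hq0 : 0 < ‖q‖ := norm_pos_iff.2 hq
  have hb : 0 < ‖q‖ / σ := by positivity
  set e := ‖q‖⁻¹ • q with he
  have hqe : q = ‖q‖ • e := by rw [he, smul_smul, mul_inv_cancel₀ hq0.ne', one_smul]
  have he1 : ‖e‖ = 1 := by rw [he, norm_smul, norm_inv, norm_norm, inv_mul_cancel₀ hq0.ne']
  simp only [coupledDist, contractiveNoise, reflected, hσh]
  rw [← he, show 1 / σ * ‖q‖ = ‖q‖ / σ by ring]
  split_ifs with hu
  · have e1 : q + σ • (n.1 - (n.1 + (1 / σ) • q)) = 0 := by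
      have : σ * (1 / σ) = 1 := by field_simp
      have e2 : q + σ • (n.1 - (n.1 + (1 / σ) • q)) = (1 - σ * (1 / σ)) • q := by module
      rw [e2, this, sub_self, zero_smul]
    rw [e1, norm_zero, mul_zero]
  · have e1 : q + σ • (n.1 - (n.1 - (2 * ⟪e, n.1⟫) • e))
        = (‖q‖ + σ * (2 * ⟪e, n.1⟫)) • e := by
      nth_rewrite 1 [hqe]
      module
    -- For smaller values the density ratio is at least one, and `u ≤ 1` would force coalescence.
    -- Hence reflection never reverses `q`, and the norm is the signed length.
    have hpos : -(‖q‖ / σ / 2) < ⟪e, n.1⟫ := by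
      by_contra! hle
      refine hu (hn.trans ?_)
      rw [le_div_iff₀ (gaussianPDFReal_std_pos _), one_mul]
      exact le_gaussianPDFReal_std_shift hb hle
    have e3 : σ * (‖q‖ / σ + 2 * ⟪e, n.1⟫) = ‖q‖ + σ * (2 * ⟪e, n.1⟫) := by
      field_simp
    rw [e1, norm_smul, he1, mul_one, Real.norm_eq_abs, ← e3, abs_of_nonneg]
    exact mul_nonneg hσ.le (by linarith)

/-! ### Mean, coalescence and approach probabilities of the coupled distance -/

section Moments

variable {σ : ℝ}

theorem norm_unit {q : Pos d} (hq : q ≠ 0) : ‖‖q‖⁻¹ • q‖ = 1 := by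
  rw [norm_smul, norm_inv, norm_norm, inv_mul_cancel₀ (norm_ne_zero_iff.2 hq)]

theorem measurable_project (e : Pos d) :
    Measurable fun n : Pos d × Pos d × ℝ => (⟪e, n.1⟫, n.2.2) := by fun_prop

theorem integrable_affine_gaussianReal (a b : ℝ) :
    Integrable (fun t : ℝ => a + b * t) (gaussianReal 0 1) :=
  (integrable_const a).add (((memLp_id_gaussianReal 1).integrable le_rfl).const_mul b)

theorem integrable_reflected_comp {e : Pos d} (he : ‖e‖ = 1) (b : ℝ) {y : ℝ → ℝ}
    (hy : Measurable y) (hi : Integrable y (gaussianReal 0 1)) :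
    Integrable (fun n : Pos d × Pos d × ℝ => reflected b y (⟪e, n.1⟫, n.2.2)) (noiseLaw d) := by
  have h1 := integrable_reflected b hy hi
  rw [← map_noiseLaw he] at h1
  exact h1.comp_measurable (measurable_project e)

theorem integral_reflected_comp {e : Pos d} (he : ‖e‖ = 1) (b : ℝ) {y : ℝ → ℝ}
    (hy : Measurable y) :
    ∫ n, reflected b y (⟪e, n.1⟫, n.2.2) ∂noiseLaw d = ∫ p, reflected b y p ∂lineLaw := by
  rw [← map_noiseLaw he, integral_map (measurable_project e).aemeasurable
    (measurable_reflected b hy).aestronglyMeasurable]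

theorem coupledDist_ae_eq (hσ : 0 < σ) (hσh : √(2 * γ⁻¹ * h) = σ) {q : Pos d} (hq : q ≠ 0) :
    coupledDist γ h q =ᵐ[noiseLaw d] fun n => σ * reflected (‖q‖ / σ)
      (fun t => ‖q‖ / σ + 2 * t) (⟪‖q‖⁻¹ • q, n.1⟫, n.2.2) :=
  ae_le_one.mono fun _ hn => coupledDist_eq hσ hσh hq hn

theorem integrable_coupledDist (hσ : 0 < σ) (hσh : √(2 * γ⁻¹ * h) = σ) (q : Pos d) :
    Integrable (coupledDist γ h q) (noiseLaw d) := by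
  by_cases hq : q = 0
  · rw [hq, funext coupledDist_zero]
    exact integrable_zero _ _ _
  refine Integrable.congr ?_ (coupledDist_ae_eq hσ hσh hq).symm
  exact (integrable_reflected_comp (norm_unit hq) _ (by fun_prop)
    (integrable_affine_gaussianReal _ _)).const_mul σ

theorem integral_coupledDist (hσ : 0 < σ) (hσh : √(2 * γ⁻¹ * h) = σ) (q : Pos d) :
    ∫ n, coupledDist γ h q n ∂noiseLaw d = ‖q‖ := by
  by_cases hq : q = 0
  · simp [hq, coupledDist_zero]
  have hb : 0 < ‖q‖ / σ := div_pos (norm_pos_iff.2 hq) hσ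
  rw [integral_congr_ae (coupledDist_ae_eq hσ hσh hq), integral_const_mul,
    integral_reflected_comp (norm_unit hq) _ (by fun_prop), integral_reflected_affine hb]
  field_simp

/-- The coupled coordinates fail to coalesce with small probability if they are close. -/
theorem measureReal_coupledDist_ne_zero_le (hσ : 0 < σ) (hσh : √(2 * γ⁻¹ * h) = σ) (q : Pos d) :
    (noiseLaw d).real {n | coupledDist γ h q n ≠ 0} ≤ 2 / 5 * (‖q‖ / σ) := by
  by_cases hq : q = 0
  · simp [hq, coupledDist_zero]
  have hb : 0 < ‖q‖ / σ := div_pos (norm_pos_iff.2 hq) hσ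
  have hm : MeasurableSet {n : Pos d × Pos d × ℝ | coupledDist γ h q n ≠ 0} :=
    (measurable_coupledDist q (measurableSet_singleton 0)).compl
  have h1 := integrable_reflected_comp (norm_unit hq) (‖q‖ / σ) measurable_const
    (integrable_const (1 : ℝ))
  rw [← integral_indicator_one hm]
  refine le_trans ?_ (integral_reflected_one_le hb)
  rw [← integral_reflected_comp (norm_unit hq) _ measurable_const]
  refine integral_mono_ae ((integrable_const (1 : ℝ)).indicator hm) h1 ?_
  filter_upwards [coupledDist_ae_eq hσ hσh hq] with n hn
  by_cases h0 : coupledDist γ h q n = 0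
  · rw [indicator_of_notMem (by simpa using h0)]
    unfold reflected
    split_ifs <;> norm_num
  · rw [indicator_of_mem (by simpa using h0)]
    rw [hn] at h0
    unfold reflected at h0 ⊢
    split_ifs at h0 ⊢ with hu
    · simp at h0
    · exact le_rfl

/-- The coupled coordinates approach each other with probability bounded from below. -/
theorem le_measureReal_coupledDist_le (hσ : 0 < σ) (hσh : √(2 * γ⁻¹ * h) = σ) (q : Pos d) :
    33 / 100 ≤ (noiseLaw d).real {n | coupledDist γ h q n ≤ max 0 (‖q‖ - 17 / 20 * σ)} := by
  by_cases hq : q = 0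
  · have : {n : Pos d × Pos d × ℝ | coupledDist γ h q n ≤ max 0 (‖q‖ - 17 / 20 * σ)} = univ := by
      ext n
      simp [hq, coupledDist_zero]
    rw [this, probReal_univ]
    norm_num
  -- Reflection adds `2σt` to the length, so `t ≤ -17/40` gives a decrease of `(17/20)σ`; the
  -- probability is `1/2 - (2/5)(17/40) = 33/100`.
  have h1 := gaussianReal_std_Iic_ge (c := 17 / 40) (by norm_num)
  have h2 : (noiseLaw d).real ((fun n => ⟪‖q‖⁻¹ • q, n.1⟫) ⁻¹' Iic (-(17 / 40)))
      = (gaussianReal 0 1).real (Iic (-(17 / 40))) := by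
    have hfst : Measurable fun ξ : Pos d => ⟪‖q‖⁻¹ • q, ξ⟫ := by fun_prop
    have h3 : (noiseLaw d).map (fun n => ⟪‖q‖⁻¹ • q, n.1⟫) = gaussianReal 0 1 := by
      rw [← map_inner_stdGaussian (norm_unit hq)]
      have h4 : (noiseLaw d).map Prod.fst = stdGaussian (Pos d) := by
        unfold noiseLaw
        rw [Measure.map_fst_prod, measure_univ, one_smul]
      rw [← h4, Measure.map_map hfst measurable_fst]
      rfl
    rw [← h3, map_measureReal_apply (by fun_prop) measurableSet_Iic]
  refine le_trans (le_trans (by norm_num) h1) (h2.symm.trans_le ?_)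
  refine ENNReal.toReal_mono (measure_ne_top _ _) (measure_mono_ae ?_)
  filter_upwards [coupledDist_ae_eq hσ hσh hq] with n hn ht
  show coupledDist γ h q n ≤ max 0 (‖q‖ - 17 / 20 * σ)
  have ht' : ⟪‖q‖⁻¹ • q, n.1⟫ ≤ -(17 / 40) := ht
  rw [hn]
  unfold reflected
  split_ifs with hu
  · simp
  · refine le_max_of_le_right ?_
    have : σ * (‖q‖ / σ) = ‖q‖ := by field_simp
    show σ * (‖q‖ / σ + 2 * ⟪‖q‖⁻¹ • q, n.1⟫) ≤ _
    nlinarith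

end Moments

end Coupling

/-! ### The rate and the step size -/

/-- Consequences of the step size condition. -/
structure StepBounds (P : Params) (R₁ h : ℝ) : Prop where
  h_pos : 0 < h
  γh_le : P.γ * h ≤ 1 / 15
  LK_le : P.LK * P.γ⁻¹ * h ≤ 1 / 55
  alpha_le : alpha P * (P.γ * h) * (alpha P + 1) ≤ 1 / 9600
  R₁_le : alpha P * (P.γ * h) * R₁ ≤ √(2 * P.γ⁻¹ * h) / 2

section Rate

variable {P : Params} {R₁ h : ℝ}

theorem StepSizeCondition.stepBounds (hP : P.Admissible) (hR : 0 ≤ R₁) (hh : 0 < h)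
    (hs : StepSizeCondition P R₁ h) : StepBounds P R₁ h := by
  obtain ⟨h1, h2, h3, h4⟩ := hs
  have hL := hP.L_pos
  have hγ := hP.γ_pos
  have hLK := hP.LK_pos
  have hα := alpha_pos hP
  have hx : 0 < P.γ * h := mul_pos hγ hh
  have hαL : alpha P * (P.γ * h) = 2 * (P.L * P.γ⁻¹ * h) := by
    rw [alpha]
    field_simp
  refine ⟨hh, ?_, ?_, ?_, ?_⟩
  · have e : P.L * P.γ⁻¹ ^ 2 / 15 - P.L * P.γ⁻¹ * h
        = P.L * P.γ⁻¹ ^ 2 * (1 / 15 - P.γ * h) := by field_simp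
    have : 0 ≤ P.L * P.γ⁻¹ ^ 2 * (1 / 15 - P.γ * h) := by linarith
    have := nonneg_of_mul_nonneg_right this (by positivity)
    linarith
  · rw [le_div_iff₀ (by positivity)] at h4
    have : P.L * (P.LK * P.γ⁻¹ * h * 55) ≤ P.L * 1 := by linarith
    have := le_of_mul_le_mul_left this hL
    linarith
  · rw [← show alpha P = 2 * P.L * P.γ⁻¹ ^ 2 from rfl, le_div_iff₀ (by positivity)] at h2
    rw [hαL]
    linarith
  · rcases hR.eq_or_lt with rfl | hR0
    · rw [mul_zero]
      positivity
    · have h5 := h1 hR0.ne'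
      rw [le_div_iff₀ (by positivity)] at h5
      refine le_of_sq_le_sq ?_ (by positivity)
      rw [div_pow, Real.sq_sqrt (by positivity), hαL]
      have e : (2 * (P.L * P.γ⁻¹ * h) * R₁) ^ 2
          = P.L * P.γ⁻¹ * h * (8 * P.L * R₁ ^ 2) * (P.γ⁻¹ * h) / 2 := by ring
      have h6 : P.L * P.γ⁻¹ * h * (8 * P.L * R₁ ^ 2) * (P.γ⁻¹ * h) ≤ 1 * (P.γ⁻¹ * h) := by
        gcongr
      rw [e]
      linarith

theorem rate_le_rateBase : rate P R₁ h ≤ rateBase P R₁ h := by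
  rw [rate]
  split_ifs
  · exact le_rfl
  · exact min_le_left _ _

theorem rateBase_pos (hP : P.Admissible) (hR : 0 ≤ R₁) : 0 < rateBase P R₁ h := by
  have hs := slope_pos hP hR hR
  have hε := eps_pos hP
  have hE := calE_pos hP
  have hα := alpha_pos hP
  have hκ := hP.κ_pos
  have hγ := hP.γ_pos
  rw [rateBase, deriv_f]
  refine lt_min (lt_min ?_ ?_) (lt_min ?_ ?_) <;> positivity

theorem rate_pos (hP : P.Admissible) (hR : 0 ≤ R₁) : 0 < rate P R₁ h := by
  have h1 := rateBase_pos hP hR (h := h)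
  rw [rate]
  split_ifs with h0
  · exact h1
  · have hc := chat_pos hP (hR.lt_of_ne' h0)
    have hα := alpha_pos hP
    refine lt_min h1 (lt_min ?_ ?_) <;> positivity

/-- The first two entries of the rate correspond to the two possible values of `τ`: `7/96` is
exactly `(7/24)(1/4)`, and `7/256` is below `(7/24)(1/8)`. -/
theorem rate_mul_le_sync (hP : P.Admissible) (hR : 0 ≤ R₁) (hh : 0 < h) :
    rate P R₁ h * h ≤ slope P R₁ R₁ * eps P * calE P * (7 / 24 * (P.γ * h * tau P)) := by
  have hs := slope_pos hP hR hR
  have hε := eps_pos hP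
  have hE := calE_pos hP
  have hγ := hP.γ_pos
  have h1 : rateBase P R₁ h ≤ slope P R₁ R₁ * (7 * eps P * P.κ * P.γ⁻¹ / 96) * calE P := by
    rw [← deriv_f]
    exact (min_le_left _ _).trans (min_le_left _ _)
  have h2 : rateBase P R₁ h ≤ slope P R₁ R₁ * (7 * eps P * P.γ / 256) * calE P := by
    rw [← deriv_f]
    exact (min_le_left _ _).trans (min_le_right _ _)
  have h3 : rate P R₁ h ≤ slope P R₁ R₁ * eps P * calE P * (7 / 24 * P.γ * tau P) := by
    refine rate_le_rateBase.trans ?_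
    rw [tau]
    rcases min_cases (1 / 8) (P.γ⁻¹ ^ 2 * P.κ / 4) with ⟨e, -⟩ | ⟨e, -⟩ <;> rw [e]
    · refine h2.trans ?_
      have : 0 ≤ slope P R₁ R₁ * eps P * calE P * P.γ := by positivity
      linarith
    · refine h1.trans (le_of_eq ?_)
      field_simp
      ring
  calc rate P R₁ h * h ≤ slope P R₁ R₁ * eps P * calE P * (7 / 24 * P.γ * tau P) * h := by gcongr
    _ = _ := by ring

theorem rate_mul_le_sixteenth (hP : P.Admissible) (hR : 0 ≤ R₁) (hh : 0 < h) :
    rate P R₁ h * h ≤ slope P R₁ R₁ * (P.γ * h) / 16 := by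
  have hs := slope_pos hP hR hR
  have hγ := hP.γ_pos
  have h1 : rateBase P R₁ h ≤ slope P R₁ R₁ * Real.exp (-P.γ * h) * (P.γ / 16) := by
    rw [← deriv_f]
    exact (min_le_right _ _).trans (min_le_left _ _)
  have h2 : Real.exp (-P.γ * h) ≤ 1 := Real.exp_le_one_iff.2 (by nlinarith)
  calc rate P R₁ h * h ≤ slope P R₁ R₁ * 1 * (P.γ / 16) * h := by
        gcongr
        exact (rate_le_rateBase.trans h1).trans (by gcongr)
    _ = _ := by ring

theorem rate_mul_le_quarter (hP : P.Admissible) (hR : 0 ≤ R₁) (hh : 0 < h) :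
    rate P R₁ h * h ≤ slope P R₁ R₁ * (alpha P * (P.γ * h)) / 4 := by
  have hs := slope_pos hP hR hR
  have hγ := hP.γ_pos
  have hα := alpha_pos hP
  have h1 : rateBase P R₁ h ≤ slope P R₁ R₁ * Real.exp (-P.γ * h) * (P.γ * alpha P / 4) := by
    rw [← deriv_f]
    exact (min_le_right _ _).trans (min_le_right _ _)
  have h2 : Real.exp (-P.γ * h) ≤ 1 := Real.exp_le_one_iff.2 (by nlinarith)
  calc rate P R₁ h * h ≤ slope P R₁ R₁ * 1 * (P.γ * alpha P / 4) * h := by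
        gcongr
        exact (rate_le_rateBase.trans h1).trans (by gcongr)
    _ = _ := by ring

theorem rate_mul_lt_one (hP : P.Admissible) (hR : 0 ≤ R₁) (hh : 0 < h)
    (hx : P.γ * h ≤ 1 / 15) : rate P R₁ h * h < 1 := by
  have h1 := rate_mul_le_sixteenth hP hR hh
  have h2 := slope_le_one hP hR hR
  have h3 := slope_pos hP hR hR
  have h4 : 0 < P.γ * h := mul_pos hP.γ_pos hh
  nlinarith

/-- The rate is small compared to the drift: `c h (4 α + 1) ≤ f'(R₁) α γ h / 2`. -/
theorem rate_mul_four_alpha_add_one_le (hP : P.Admissible) (hR : 0 ≤ R₁) (hh : 0 < h) :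
    rate P R₁ h * h * (4 * alpha P + 1) ≤ slope P R₁ R₁ * (alpha P * (P.γ * h)) / 2 := by
  have h1 := rate_mul_le_sixteenth hP hR hh
  have h2 := rate_mul_le_quarter hP hR hh
  have hα := alpha_pos hP
  have hs : 0 < slope P R₁ R₁ * (P.γ * h) :=
    mul_pos (slope_pos hP hR hR) (mul_pos hP.γ_pos hh)
  have hs' := slope_pos hP hR hR
  have hγ := hP.γ_pos
  -- Below `1/4` one has `4α + 1 ≤ 2`, above it `4α + 1 ≤ 8α`; each case uses one of the two drift
  -- entries of the rate.
  rcases le_total (alpha P) (1 / 4) with h3 | h3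
  · calc rate P R₁ h * h * (4 * alpha P + 1)
        ≤ slope P R₁ R₁ * (alpha P * (P.γ * h)) / 4 * 2 := by
          have : 0 < rate P R₁ h := rate_pos hP hR
          gcongr
          linarith
      _ = _ := by ring
  · calc rate P R₁ h * h * (4 * alpha P + 1)
        ≤ slope P R₁ R₁ * (P.γ * h) / 16 * (8 * alpha P) := by
          have : 0 < rate P R₁ h := rate_pos hP hR
          gcongr
          linarith
      _ = _ := by ring

end Rate

/-! ### One step with synchronous coupling -/

section Synchronous

variable {d : ℕ} {U G : Pos d → ℝ} {K : Pos d →L[ℝ] Pos d} {P : Params} {h : ℝ}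

/-- After the step only the bound `D_𝒦 + ε r_l` is kept. Its decrease is weighted by at least
`f'(R₁)`, and `ℰ r_s ≤ r_l` with `ρ ≤ r_s` makes it proportional to `ρ`. -/
theorem rho_synchronous_le (hP : P.Admissible) (hU : Differentiable ℝ U)
    (hG : IsSplitting U K G P) (hb : StepBounds P (R1 P K) h) {s s' : State d}
    (hs : DK P K ≤ Delta P K s s') (ξ ξ₂ : Pos d) :
    rho P K (stepBU U P.γ h s ξ ξ₂) (stepBU U P.γ h s' ξ ξ₂)
      ≤ (1 - rate P (R1 P K) h * h) * rho P K s s' := by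
  have hK := hG.quadratic
  have hh := hb.h_pos
  have hR := R1_nonneg hP hK
  have hε := eps_pos hP
  have hD := DK_nonneg (K := K) hP
  have hsq := rl_sq_synchronous_le hP hU hG hh hb.γh_le hb.LK_le
    (fun hne => calR_le_coreForm hP hK hne hs) ξ ξ₂
  set t := stepBU U P.γ h s ξ ξ₂
  set t' := stepBU U P.γ h s' ξ ξ₂
  have hτ := tau_pos hP
  have hτ' := tau_le_eighth (P := P)
  have hx : 0 < P.γ * h := mul_pos hP.γ_pos hh
  set y := P.γ * h * tau P with hy
  have hy0 : 0 < y := mul_pos hx hτ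
  have hy1 : y ≤ 1 / 120 := by
    have := mul_le_mul hb.γh_le hτ' hτ.le (by norm_num)
    linarith
  have hl := rl_nonneg (P := P) (K := K) s s'
  have hl' := rl_nonneg (P := P) (K := K) t t'
  have h1 : rl P K t t' ≤ (1 - 7 / 24 * y) * rl P K s s' := by
    refine le_of_sq_le_sq ?_ (mul_nonneg (by linarith) hl)
    refine hsq.trans ?_
    rw [mul_pow]
    gcongr
    nlinarith
  have h2 : DK P K + eps P * rl P K s s' ≤ rs P s s' := by
    rw [Delta] at hs
    linarith
  have e1 : rho P K s s' = f P (R1 P K) (DK P K + eps P * rl P K s s') := by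
    rw [rho_eq, min_eq_right h2]
  have h3 : rho P K t t' ≤ f P (R1 P K) (DK P K + eps P * rl P K t t') := by
    rw [rho_eq]
    refine f_monotoneOn hP hR ?_ ?_ (min_le_right _ _)
    · exact le_min (rs_nonneg hP t t') (add_nonneg hD (mul_nonneg hε.le hl'))
    · exact add_nonneg hD (mul_nonneg hε.le hl')
  have h4 : rl P K t t' ≤ rl P K s s' := by nlinarith
  have h5 := le_f_sub hP hR (add_nonneg hD (mul_nonneg hε.le hl'))
    (by gcongr : DK P K + eps P * rl P K t t' ≤ DK P K + eps P * rl P K s s')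
  have h6 := slope_self_le hP hR (add_nonneg hD (mul_nonneg hε.le hl))
  have hs0 := slope_pos hP hR hR
  have h7 : eps P * (7 / 24 * y * rl P K s s') * slope P (R1 P K) (R1 P K)
      ≤ (DK P K + eps P * rl P K s s' - (DK P K + eps P * rl P K t t'))
        * slope P (R1 P K) (DK P K + eps P * rl P K s s') := by
    refine mul_le_mul ?_ h6 hs0.le ?_
    · have := mul_le_mul_of_nonneg_left h1 hε.le
      linarith
    · have := mul_le_mul_of_nonneg_left h4 hε.le
      linarith
  have h8 : rate P (R1 P K) h * h * rho P K s s'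
      ≤ eps P * (7 / 24 * y * rl P K s s') * slope P (R1 P K) (R1 P K) := by
    have hρ : rho P K s s' ≤ rs P s s' := by
      rw [e1]
      exact (f_le_self hP hR (add_nonneg hD (mul_nonneg hε.le hl))).trans h2
    have hρ0 := (isDistance_rho hP hK).nonneg s s'
    have h9 := calE_mul_rs_le_rl hP hK s s'
    have hE := calE_pos hP
    calc rate P (R1 P K) h * h * rho P K s s'
        ≤ slope P (R1 P K) (R1 P K) * eps P * calE P * (7 / 24 * y) * rs P s s' :=
          mul_le_mul (rate_mul_le_sync hP hR hh) hρ hρ0 (by positivity)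
      _ = slope P (R1 P K) (R1 P K) * eps P * (7 / 24 * y) * (calE P * rs P s s') := by ring
      _ ≤ slope P (R1 P K) (R1 P K) * eps P * (7 / 24 * y) * rl P K s s' := by gcongr
      _ = _ := by ring
  rw [← e1] at h5
  linarith

end Synchronous

/-! ### One step with contractive coupling -/

section Contractive

variable {d : ℕ} {U G : Pos d → ℝ} {K : Pos d →L[ℝ] Pos d} {P : Params} {h R₁ : ℝ}

theorem alpha_mul_le (hP : P.Admissible) (hb : StepBounds P R₁ h) :
    alpha P * (P.γ * h) ≤ 1 / 9600 := by
  have hα := alpha_pos hP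
  have hx : 0 < P.γ * h := mul_pos hP.γ_pos hb.h_pos
  have := hb.alpha_le
  nlinarith [mul_pos (mul_pos hα hx) hα]

theorem defect_le_damping (hP : P.Admissible) (hb : StepBounds P R₁ h) :
    defect P h ≤ damping P h := by
  have hx : 0 < P.γ * h := mul_pos hP.γ_pos hb.h_pos
  have h1 := defect_le hP hb.h_pos
  have h2 := hb.γh_le
  rw [damping_eq hP hb.h_pos]
  nlinarith

theorem damping_le (hP : P.Admissible) (hh : 0 < h) : damping P h ≤ P.γ * h := by
  have hx : 0 < P.γ * h := mul_pos hP.γ_pos hh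
  have h1 := defect_nonneg hP hh
  rw [damping_eq hP hh]
  exact mul_le_of_le_one_right hx.le (by linarith)

/-- An upper bound for `r_s` after one contractively coupled step, where `a = |z|`, `b = |q|` and
`T` is the coupled distance. -/
noncomputable def nextBound (P : Params) (h a b T : ℝ) : ℝ :=
  alpha P * a - 23 / 50 * (alpha P * (P.γ * h)) * a
    + alpha P * (damping P h - defect P h) * b + (1 + alpha P * defect P h) * T

theorem nextBound_nonneg (hP : P.Admissible) (hb : StepBounds P R₁ h) {a b T : ℝ} (ha : 0 ≤ a)
    (hb0 : 0 ≤ b) (hT : 0 ≤ T) : 0 ≤ nextBound P h a b T := by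
  have hα := alpha_pos hP
  have h1 := defect_nonneg hP hb.h_pos
  have h2 := sub_nonneg.2 (defect_le_damping hP hb)
  have h3 := hb.γh_le
  have h4 : 0 ≤ alpha P * a * (1 - 23 / 50 * (P.γ * h)) :=
    mul_nonneg (by positivity) (by linarith)
  have h5 : 0 ≤ alpha P * (damping P h - defect P h) * b := by positivity
  have h6 : 0 ≤ (1 + alpha P * defect P h) * T := by positivity
  rw [nextBound]
  linarith

theorem rs_contractive_le (hP : P.Admissible) (hU : PotentialAssumption U P.κ P.R P.L)
    (hb : StepBounds P R₁ h) {s s' : State d} {z q : Pos d} (hz : s.1 - s'.1 = z)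
    (hq : z + P.γ⁻¹ • (s.2 - s'.2) = q) (n : Pos d × Pos d × ℝ) :
    rs P (stepBU U P.γ h s n.1 n.2.1)
        (stepBU U P.γ h s' (contractiveNoise P.γ h q n.1 n.2.2) n.2.1)
      ≤ nextBound P h ‖z‖ ‖q‖ (coupledDist P.γ h q n) := by
  have hα := alpha_pos hP
  have hh := hb.h_pos
  have hγ := hP.γ_pos
  have hx : 0 < P.γ * h := mul_pos hγ hh
  have hω := defect_nonneg hP hh
  have hω' := defect_le hP hh
  have hωδ := sub_nonneg.2 (defect_le_damping hP hb)
  have hδx := damping_le hP hh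
  have hδ := damping_eq hP hh
  have hδ0 : 0 ≤ damping P h := hω.trans (sub_nonneg.1 hωδ)
  have hx15 := hb.γh_le
  generalize hθ : (P.γ⁻¹ * h) • (gradient U s.1 - gradient U s'.1) = θ
  have hθn : ‖θ‖ ≤ 1 / 2 * (alpha P * (P.γ * h)) * ‖z‖ := by
    have e : 1 / 2 * (alpha P * (P.γ * h)) = P.γ⁻¹ * h * P.L := by
      rw [alpha]
      field_simp
    rw [← hθ, norm_smul, Real.norm_of_nonneg (by positivity), e, mul_assoc _ P.L, ← hz]
    gcongr
    exact hU.lipschitz _ _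
  rw [rs_eq rfl rfl, stepBU_twisted_sub hP hh hz hq hθ, stepBU_fst_sub hP hh hz hq hθ]
  set ζ := √(2 * P.γ⁻¹ * h) • (n.1 - contractiveNoise P.γ h q n.1 n.2.2) with hζ
  have hT : coupledDist P.γ h q n = ‖q + ζ‖ := rfl
  -- The position noise is absorbed by borrowing `defect • q`, so that `ζ` occurs only in `q + ζ`,
  -- whose norm is the coupled distance.
  have e1 : (1 - damping P h) • z + damping P h • q - damping P h • θ + defect P h • ζ
      = ((1 - damping P h) • z + (damping P h - defect P h) • q + defect P h • (q + ζ))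
        - damping P h • θ := by module
  have e2 : q - θ + ζ = (q + ζ) - θ := by module
  have h1 : ‖(1 - damping P h) • z + damping P h • q - damping P h • θ + defect P h • ζ‖
      ≤ (1 - damping P h) * ‖z‖ + (damping P h - defect P h) * ‖q‖ + defect P h * ‖q + ζ‖
        + damping P h * ‖θ‖ := by
    rw [e1]
    refine (norm_sub_le _ _).trans ?_
    have := norm_add₃_le (a := (1 - damping P h) • z) (b := (damping P h - defect P h) • q)
      (c := defect P h • (q + ζ))
    rw [norm_smul, norm_smul, norm_smul, Real.norm_of_nonneg hωδ, Real.norm_of_nonneg hω,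
      Real.norm_of_nonneg (by linarith : 0 ≤ 1 - damping P h)] at this
    rw [norm_smul (damping P h) θ, Real.norm_of_nonneg hδ0]
    linarith
  have h2 : ‖q - θ + ζ‖ ≤ ‖q + ζ‖ + ‖θ‖ := by
    rw [e2]
    exact norm_sub_le _ _
  rw [hT, nextBound]
  have h3 := mul_le_mul_of_nonneg_left h1 hα.le
  have hαδ : alpha P * damping P h ≤ 1 / 9600 :=
    (mul_le_mul_of_nonneg_left hδx hα.le).trans (alpha_mul_le hP hb)
  have h4 : (1 + alpha P * damping P h) * ‖θ‖
      ≤ (1 + 1 / 9600) * (1 / 2 * (alpha P * (P.γ * h)) * ‖z‖) := by gcongr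
  -- The net coefficient in `nextBound` comes from `29/30 - (1/2)(1 + 1/9600) ≥ 23/50`.
  have h5 : 29 / 30 * (alpha P * (P.γ * h) * ‖z‖) ≤ alpha P * damping P h * ‖z‖ := by
    have e : alpha P * damping P h * ‖z‖ = (1 - defect P h) * (alpha P * (P.γ * h) * ‖z‖) := by
      rw [hδ]
      ring
    rw [e]
    gcongr
    linarith
  have h6 : 0 ≤ alpha P * (P.γ * h) * ‖z‖ := by positivity
  linarith

/-- The tangent at `m` is expressed through the tangent at `r`. The last term is the gain from
concavity, negative when `w` lies beyond `m` as seen from `r`. -/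
theorem f_le_two_tangents (hP : P.Admissible) (hR : 0 ≤ R₁) {r m w : ℝ} (hr : 0 ≤ r) (hm : 0 ≤ m)
    (hw : 0 ≤ w) :
    f P R₁ w ≤ f P R₁ r + (w - r) * slope P R₁ r + (w - m) * (slope P R₁ m - slope P R₁ r) := by
  have h1 := f_le_tangent hP hR hm hw
  have h2 := f_le_tangent hP hR hr hm
  linarith

section Integrals

variable {Ω : Type*} [MeasurableSpace Ω] {ν : Measure Ω} [IsProbabilityMeasure ν]

/-- All majorants below are affine in the coupled distance plus a multiple of one event, so their
means follow from the martingale property and one probability. -/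
theorem integrable_affine_indicator {T : Ω → ℝ} (hT : Integrable T ν) {S : Set Ω}
    (hS : MeasurableSet S) (c₀ c₁ c₂ : ℝ) :
    Integrable (fun n => c₀ + c₁ * T n + c₂ * S.indicator 1 n) ν :=
  ((integrable_const c₀).add (hT.const_mul c₁)).add
    (((integrable_const (1 : ℝ)).indicator hS).const_mul c₂)

theorem integral_affine_indicator {T : Ω → ℝ} (hT : Integrable T ν) {S : Set Ω}
    (hS : MeasurableSet S) (c₀ c₁ c₂ : ℝ) :
    ∫ n, (c₀ + c₁ * T n + c₂ * S.indicator 1 n) ∂ν = c₀ + c₁ * ∫ n, T n ∂ν + c₂ * ν.real S := by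
  have h1 : Integrable (fun n => c₀ + c₁ * T n) ν := (integrable_const c₀).add (hT.const_mul c₁)
  have h2 : Integrable (fun n => c₂ * S.indicator (1 : Ω → ℝ) n) ν :=
    ((integrable_const (1 : ℝ)).indicator hS).const_mul c₂
  rw [integral_add h1 h2, integral_add (integrable_const c₀) (hT.const_mul c₁), integral_const,
    integral_const_mul, integral_const_mul, integral_indicator_one hS, probReal_univ, one_smul]

end Integrals

/-- The drift of the position dominates if `4 |q| ≤ |z|`. -/
theorem exists_bound_of_le (hP : P.Admissible) (hR : 0 ≤ R₁) (hb : StepBounds P R₁ h) {a : ℝ}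
    (q : Pos d) (ha : 0 ≤ a) (hab : 4 * ‖q‖ ≤ a) :
    ∃ H : Pos d × Pos d × ℝ → ℝ, Integrable H (noiseLaw d) ∧
      (∀ n, f P R₁ (nextBound P h a ‖q‖ (coupledDist P.γ h q n)) ≤ H n) ∧
      ∫ n, H n ∂noiseLaw d ≤ (1 - rate P R₁ h * h) * f P R₁ (alpha P * a + ‖q‖) := by
  have hh := hb.h_pos
  have hα := alpha_pos hP
  have hγ := hP.γ_pos
  have hx : 0 < P.γ * h := mul_pos hγ hh
  have hσ : 0 < √(2 * P.γ⁻¹ * h) := by positivity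
  have hT := integrable_coupledDist hσ rfl q
  have hET := integral_coupledDist hσ rfl q
  have hq0 := norm_nonneg q
  generalize ‖q‖ = b at *
  set r := alpha P * a + b with hr
  have hr0 : 0 ≤ r := by positivity
  have hint := integrable_affine_indicator hT MeasurableSet.empty
    (f P R₁ r + (nextBound P h a b 0 - r) * slope P R₁ r)
    ((1 + alpha P * defect P h) * slope P R₁ r) 0
  have hval := integral_affine_indicator hT MeasurableSet.empty
    (f P R₁ r + (nextBound P h a b 0 - r) * slope P R₁ r)
    ((1 + alpha P * defect P h) * slope P R₁ r) 0
  refine ⟨_, hint, fun n => ?_, ?_⟩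
  · have h1 := f_le_tangent hP hR hr0
      (nextBound_nonneg hP hb ha hq0 (coupledDist_nonneg (γ := P.γ) (h := h) q n))
    refine h1.trans (le_of_eq ?_)
    simp only [nextBound]
    ring
  · rw [hval, hET]
    have hs := slope_pos hP hR hr0
    have hs1 := slope_self_le hP hR hr0
    have hsR := slope_pos hP hR hR
    -- The growth `αγh b` is at most `αγh a/4`, and `23/50 - 1/4 = 21/100`. No curvature is needed,
    -- hence the empty event in the majorant.
    have h1 : nextBound P h a b 0 - r + (1 + alpha P * defect P h) * b
        ≤ -(21 / 100 * (alpha P * (P.γ * h)) * a) := by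
      have h2 : alpha P * damping P h * b ≤ alpha P * (P.γ * h) * b := by
        gcongr
        exact damping_le hP hh
      have h3 : alpha P * (P.γ * h) * (4 * b) ≤ alpha P * (P.γ * h) * a := by gcongr
      rw [nextBound, hr]
      linarith
    have h4 : rate P R₁ h * h * f P R₁ r ≤ slope P R₁ R₁ * (alpha P * (P.γ * h)) / 8 * a := by
      have h5 := rate_mul_four_alpha_add_one_le hP hR hh
      have h6 := (rate_pos hP hR (h := h))
      calc rate P R₁ h * h * f P R₁ r ≤ rate P R₁ h * h * r := by
            gcongr
            exact f_le_self hP hR hr0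
        _ ≤ rate P R₁ h * h * ((4 * alpha P + 1) * (a / 4)) := by
            gcongr
            linarith
        _ = rate P R₁ h * h * (4 * alpha P + 1) * (a / 4) := by ring
        _ ≤ slope P R₁ R₁ * (alpha P * (P.γ * h)) / 2 * (a / 4) := by gcongr
        _ = _ := by ring
    have h7 : slope P R₁ R₁ * (alpha P * (P.γ * h)) / 8 * a
        ≤ slope P R₁ r * (alpha P * (P.γ * h)) / 8 * a := by gcongr
    have h8 := mul_le_mul_of_nonneg_right h1 hs.le
    have h9 : 0 ≤ slope P R₁ r * (alpha P * (P.γ * h)) * a := by positivity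
    linarith

/-- The rate term is dominated by half of the drift if `|z| ≤ 4 |q|`. -/
theorem rate_mul_f_le (hP : P.Admissible) (hR : 0 ≤ R₁) (hh : 0 < h) {a b : ℝ} (ha : 0 ≤ a)
    (hb : 0 ≤ b) (hab : a ≤ 4 * b) :
    rate P R₁ h * h * f P R₁ (alpha P * a + b)
      ≤ alpha P * (P.γ * h) * b / 2 * slope P R₁ (alpha P * a + b) := by
  have hα := alpha_pos hP
  have hγ := hP.γ_pos
  have hr0 : 0 ≤ alpha P * a + b := by positivity
  have hs1 := slope_self_le hP hR hr0
  have h5 := rate_mul_four_alpha_add_one_le hP hR hh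
  have h6 := (rate_pos hP hR (h := h))
  calc rate P R₁ h * h * f P R₁ (alpha P * a + b)
      ≤ rate P R₁ h * h * (alpha P * a + b) := by
        gcongr
        exact f_le_self hP hR hr0
    _ ≤ rate P R₁ h * h * (alpha P * (4 * b) + b) := by gcongr
    _ = rate P R₁ h * h * (4 * alpha P + 1) * b := by ring
    _ ≤ slope P R₁ R₁ * (alpha P * (P.γ * h)) / 2 * b := by gcongr
    _ ≤ slope P R₁ (alpha P * a + b) * (alpha P * (P.γ * h)) / 2 * b := by gcongr
    _ = _ := by ring

/-- The upper bound `nextBound` without the drift of the position. -/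
noncomputable def looseBound (P : Params) (h a b T : ℝ) : ℝ :=
  alpha P * a + alpha P * (damping P h - defect P h) * b + (1 + alpha P * defect P h) * T

theorem f_nextBound_le (hP : P.Admissible) (hR : 0 ≤ R₁) (hb : StepBounds P R₁ h) {a b T : ℝ}
    (ha : 0 ≤ a) (hb0 : 0 ≤ b) (hT : 0 ≤ T) :
    0 ≤ looseBound P h a b T ∧
      f P R₁ (nextBound P h a b T) ≤ f P R₁ (looseBound P h a b T) := by
  have hα := alpha_pos hP
  have hx : 0 < P.γ * h := mul_pos hP.γ_pos hb.h_pos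
  have h1 := nextBound_nonneg hP hb ha hb0 hT
  have h2 : nextBound P h a b T ≤ looseBound P h a b T := by
    have : 0 ≤ 23 / 50 * (alpha P * (P.γ * h)) * a := by positivity
    rw [nextBound, looseBound]
    linarith
  exact ⟨h1.trans h2, f_monotoneOn hP hR h1 (h1.trans h2) h2⟩

/-- It converts the curvature of `φ` on the noise scale into the drift unit `γh`. -/
theorem gamma_sq_mul_sigma_sq (hP : P.Admissible) (hh : 0 < h) :
    P.γ ^ 2 * √(2 * P.γ⁻¹ * h) ^ 2 = 2 * (P.γ * h) := by
  have hγ := hP.γ_pos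
  rw [Real.sq_sqrt (by positivity)]
  field_simp

/-- The concavity of `f` outweighs the drift if `|q|` is of the order of the noise. -/
theorem exists_bound_of_far (hP : P.Admissible) (hR : 0 ≤ R₁) (hb : StepBounds P R₁ h) {a : ℝ}
    (q : Pos d) (ha : 0 ≤ a) (hab : a ≤ 4 * ‖q‖) (hrR : alpha P * a + ‖q‖ ≤ R₁)
    (hfar : 7 / 10 * √(2 * P.γ⁻¹ * h) ≤ ‖q‖) :
    ∃ H : Pos d × Pos d × ℝ → ℝ, Integrable H (noiseLaw d) ∧
      (∀ n, f P R₁ (nextBound P h a ‖q‖ (coupledDist P.γ h q n)) ≤ H n) ∧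
      ∫ n, H n ∂noiseLaw d ≤ (1 - rate P R₁ h * h) * f P R₁ (alpha P * a + ‖q‖) := by
  have hh := hb.h_pos
  have hα := alpha_pos hP
  have hγ := hP.γ_pos
  have hx : 0 < P.γ * h := mul_pos hγ hh
  have hσ : 0 < √(2 * P.γ⁻¹ * h) := by positivity
  have hγσ := gamma_sq_mul_sigma_sq hP hh
  have hT := integrable_coupledDist hσ rfl q
  have hET := integral_coupledDist hσ rfl q
  have hprob := le_measureReal_coupledDist_le hσ rfl q
  have hq0 := norm_nonneg q
  have hR₁ := hb.R₁_le
  have hA := alpha_mul_le hP hb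
  have hrate := rate_mul_f_le hP hR hh ha hq0 hab
  generalize hσe : √(2 * P.γ⁻¹ * h) = σ at *
  generalize ‖q‖ = b at *
  have hS : MeasurableSet {n | coupledDist P.γ h q n ≤ max 0 (b - 17 / 20 * σ)} :=
    measurableSet_le (measurable_coupledDist q) measurable_const
  set r := alpha P * a + b with hr
  have hr0 : 0 ≤ r := by positivity
  have hbr : b ≤ r := by
    rw [hr]
    have : 0 ≤ alpha P * a := by positivity
    linarith
  have hs := slope_pos hP hR hr0
  -- The favourable event lowers `r` by at least `(17/20)σ - σ/2 = 2y`, the `σ/2` covering the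
  -- drift. Placing the tangent halfway, at `r - y`, leaves a gain of `y` times the slope
  -- difference.
  set y := 7 / 40 * σ with hy
  have hy0 : 0 < y := by positivity
  set D := 64 * alpha P * P.γ ^ 2 * (y * (2 * r - y)) * slope P R₁ r with hD
  have hω := defect_nonneg hP hh
  have hωδ := sub_nonneg.2 (defect_le_damping hP hb)
  have hδA : alpha P * damping P h ≤ alpha P * (P.γ * h) := by
    gcongr
    exact damping_le hP hh
  have hAb : alpha P * damping P h * b ≤ σ / 2 := by
    refine le_trans ?_ hR₁
    gcongr
    exact hbr.trans hrR
  have hint := integrable_affine_indicator hT hS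
    (f P R₁ r + (looseBound P h a b 0 - r) * slope P R₁ r)
    ((1 + alpha P * defect P h) * slope P R₁ r) (-(y * D))
  have hval := integral_affine_indicator hT hS
    (f P R₁ r + (looseBound P h a b 0 - r) * slope P R₁ r)
    ((1 + alpha P * defect P h) * slope P R₁ r) (-(y * D))
  refine ⟨_, hint, fun n => ?_, ?_⟩
  · have hT0 := coupledDist_nonneg (γ := P.γ) (h := h) q n
    obtain ⟨hw, hfw⟩ := f_nextBound_le hP hR hb ha hq0 hT0
    refine hfw.trans ?_
    have ew : looseBound P h a b 0 + (1 + alpha P * defect P h) * coupledDist P.γ h q n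
        = looseBound P h a b (coupledDist P.γ h q n) := by
      simp only [looseBound]
      ring
    by_cases hn : coupledDist P.γ h q n ≤ max 0 (b - 17 / 20 * σ)
    · rw [indicator_of_mem (show n ∈ {n | coupledDist P.γ h q n ≤ max 0 (b - 17 / 20 * σ)} from hn),
        Pi.one_apply]
      have hwle : looseBound P h a b (coupledDist P.γ h q n) ≤ r - 2 * y := by
        rw [looseBound, hr, hy]
        rcases le_max_iff.1 hn with h0 | h0
        · have hT00 : coupledDist P.γ h q n = 0 := le_antisymm h0 hT0
          have h1 : alpha P * (damping P h - defect P h) * b ≤ 1 / 9600 * b := by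
            gcongr
            nlinarith [mul_nonneg hα.le hω]
          rw [hT00]
          linarith
        · have h1 : alpha P * defect P h * coupledDist P.γ h q n ≤ alpha P * defect P h * b := by
            gcongr
            linarith
          linarith
      have h1 := f_le_two_tangents hP hR hr0 (by linarith : 0 ≤ r - y) hw
      have h2 : D ≤ slope P R₁ (r - y) - slope P R₁ r := by
        have h3 := one_add_mul_slope_le hP (by linarith : 0 ≤ r - y) (by linarith : r - y ≤ r) hrR
        have h4 : r ^ 2 - (r - y) ^ 2 = y * (2 * r - y) := by ring
        rw [h4] at h3
        rw [hD]
        linarith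
      have hD0 : 0 ≤ D := by
        have : 0 ≤ 2 * r - y := by linarith
        positivity
      have h5 : (looseBound P h a b (coupledDist P.γ h q n) - (r - y))
          * (slope P R₁ (r - y) - slope P R₁ r) ≤ -y * D := by
        have h6 := mul_le_mul (by linarith :
          y ≤ (r - y) - looseBound P h a b (coupledDist P.γ h q n)) h2 hD0 (by linarith)
        linarith
      rw [← ew] at h1 h5 ⊢
      linarith
    · rw [indicator_of_notMem (show n ∉ {n | coupledDist P.γ h q n ≤ max 0 (b - 17 / 20 * σ)}
        from hn)]
      have h1 := f_le_tangent hP hR hr0 hw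
      rw [← ew] at h1 ⊢
      linarith
  · rw [hval, hET]
    have h1 : (looseBound P h a b 0 - r + (1 + alpha P * defect P h) * b)
        = alpha P * damping P h * b := by
      rw [looseBound, hr]
      ring
    have h2 : alpha P * damping P h * b * slope P R₁ r
        ≤ alpha P * (P.γ * h) * b * slope P R₁ r := by gcongr
    -- Since `b ≥ 0.7σ` gives `y ≤ b/4`, the constant is `64 · (49/1600) · 2 · (7/4) ≥ 6`.
    -- Multiplied by the probability `0.33` it exceeds `3/2`: one unit for the drift and one half
    -- for the rate.
    have h3 : 6 * (alpha P * (P.γ * h) * b * slope P R₁ r) ≤ y * D := by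
      have e : y * D = 64 * (49 / 1600) * alpha P * (P.γ ^ 2 * σ ^ 2) * (2 * r - y)
          * slope P R₁ r := by
        rw [hD, hy]
        ring
      rw [e, hγσ]
      have h4 : 7 / 4 * b ≤ 2 * r - y := by linarith
      have h5 : 0 ≤ alpha P * (P.γ * h) * b * slope P R₁ r := by positivity
      calc 6 * (alpha P * (P.γ * h) * b * slope P R₁ r)
          ≤ 64 * (49 / 1600) * alpha P * (2 * (P.γ * h)) * (7 / 4 * b) * slope P R₁ r := by
            linarith
        _ ≤ _ := by gcongr
    have h6 : 0 ≤ alpha P * (P.γ * h) * b * slope P R₁ r := by positivity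
    have h7 : y * D * (33 / 100) ≤ y * D
        * (noiseLaw d).real {n | coupledDist P.γ h q n ≤ max 0 (b - 17 / 20 * σ)} := by
      have : 0 ≤ y * D := by linarith
      gcongr
    have h8 : f P R₁ r + (looseBound P h a b 0 - r) * slope P R₁ r
        + (1 + alpha P * defect P h) * slope P R₁ r * b
        = f P R₁ r + alpha P * damping P h * b * slope P R₁ r := by
      rw [← h1]
      ring
    rw [h8]
    linarith

/-- Up to `R₁` the drop comes from the Gaussian factor `φ` between `r` and `M`. Beyond `R₁` that
factor is frozen; then the slope at `M` is the one at `R₁`, and the drop comes from `ψ`. -/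
theorem slope_drop (hP : P.Admissible) (hR : 0 < R₁) (hb : StepBounds P R₁ h) {a b : ℝ}
    (ha : 0 ≤ a) (hb0 : 0 ≤ b) (hab : a ≤ 4 * b) (hrR : alpha P * a + b ≤ R₁)
    (hnear : b ≤ 7 / 10 * √(2 * P.γ⁻¹ * h)) :
    5 * (alpha P * (P.γ * h)) * slope P R₁ (alpha P * a + b)
      ≤ slope P R₁ (alpha P * a + b - b / 2)
        - slope P R₁ (alpha P * a + 3 / 2 * √(2 * P.γ⁻¹ * h)) := by
  have hh := hb.h_pos
  have hα := alpha_pos hP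
  have hγ := hP.γ_pos
  have hx : 0 < P.γ * h := mul_pos hγ hh
  have hσ : 0 < √(2 * P.γ⁻¹ * h) := by positivity
  have hγσ := gamma_sq_mul_sigma_sq hP hh
  have hA := alpha_mul_le hP hb
  generalize √(2 * P.γ⁻¹ * h) = σ at *
  have hαa : 0 ≤ alpha P * a := by positivity
  set r := alpha P * a + b with hr
  have hr0 : 0 ≤ r := by positivity
  have hs := slope_pos hP hR.le hr0
  have hm0 : 0 ≤ r - b / 2 := by linarith
  have hmr := slope_antitoneOn hP hR.le (mem_Ici.2 hm0) (mem_Ici.2 hr0)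
    (by linarith : r - b / 2 ≤ r)
  set M := alpha P * a + 3 / 2 * σ with hM
  rcases le_total M R₁ with hMR | hMR
  · have h1 := one_add_mul_slope_le hP hr0 (by linarith : r ≤ M) hMR
    have hsM := slope_pos hP hR.le (by linarith : 0 ≤ M)
    have h2 : 153 * (alpha P * (P.γ * h)) ≤ 64 * alpha P * P.γ ^ 2 * (M ^ 2 - r ^ 2) := by
      -- `b ≤ 0.7σ` gives `M - r ≥ (4/5)σ`, while `M + r ≥ (3/2)σ`.
      have h3 : 6 / 5 * σ ^ 2 ≤ M ^ 2 - r ^ 2 := by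
        have h4 : 4 / 5 * σ ≤ M - r := by linarith
        have h5 : 3 / 2 * σ ≤ M + r := by linarith
        have h6 := mul_le_mul h4 h5 (by positivity) (by linarith)
        linarith
      have h7 : 64 * alpha P * P.γ ^ 2 * (6 / 5 * σ ^ 2)
          ≤ 64 * alpha P * P.γ ^ 2 * (M ^ 2 - r ^ 2) := by gcongr
      have e : 64 * alpha P * P.γ ^ 2 * (6 / 5 * σ ^ 2)
          = 384 / 5 * alpha P * (P.γ ^ 2 * σ ^ 2) := by ring
      rw [e, hγσ] at h7
      have : 0 ≤ alpha P * (P.γ * h) := by positivity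
      linarith
    have hA0 : 0 < alpha P * (P.γ * h) := mul_pos hα hx
    generalize alpha P * (P.γ * h) = A at *
    have h8 : (1 + 153 * A) * slope P R₁ M ≤ slope P R₁ r :=
      le_trans (by gcongr) h1
    by_contra! hcon
    have h9 : (1 + 153 * A) * ((1 - 5 * A) * slope P R₁ r) < slope P R₁ r := by
      refine lt_of_lt_of_le ?_ h8
      have : (1 - 5 * A) * slope P R₁ r < slope P R₁ M := by linarith
      gcongr
    have h10 : 0 < (148 * A - 765 * A ^ 2) * slope P R₁ r := by
      refine mul_pos ?_ hs
      nlinarith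
    linarith
  -- From `a ≤ 4b` one gets `r ≤ (4α + 1)b`, so removing `b/2` shortens `r` by at least the fraction
  -- `ν`.
  · set ν := 1 / (8 * alpha P + 2) with hν
    have hν0 : 0 < ν := by positivity
    have h1 : r - b / 2 ≤ R₁ * (1 - ν) := by
      have h2 : r * ν ≤ b / 2 := by
        rw [hν, mul_one_div, div_le_iff₀ (by positivity), hr]
        have := mul_le_mul_of_nonneg_left hab hα.le
        linarith
      have hν1 : ν ≤ 1 := by
        rw [hν, div_le_one (by positivity)]
        linarith
      have h3 : r * (1 - ν) ≤ R₁ * (1 - ν) := mul_le_mul_of_nonneg_right hrR (by linarith)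
      linarith
    have h2 := slope_self_le_mul hP hR hm0 hν0.le h1
    rw [slope_of_le hMR]
    have h3 : 5 * (alpha P * (P.γ * h)) ≤ ν / 2 := by
      rw [hν, div_div, le_div_iff₀ (by positivity)]
      have h4 := hb.alpha_le
      have h5 : 0 ≤ alpha P * (P.γ * h) := by positivity
      have h6 : 0 ≤ alpha P * (P.γ * h) * alpha P := by positivity
      nlinarith
    have h4 : 5 * (alpha P * (P.γ * h)) * slope P R₁ r ≤ ν / 2 * slope P R₁ (r - b / 2) := by
      gcongr
    linarith

/-- The concavity of `f` outweighs the drift if `|q|` is small compared to the noise. -/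
theorem exists_bound_of_near (hP : P.Admissible) (hR : 0 < R₁) (hb : StepBounds P R₁ h) {a : ℝ}
    (q : Pos d) (ha : 0 ≤ a) (hab : a ≤ 4 * ‖q‖) (hrR : alpha P * a + ‖q‖ ≤ R₁)
    (hnear : ‖q‖ ≤ 7 / 10 * √(2 * P.γ⁻¹ * h)) :
    ∃ H : Pos d × Pos d × ℝ → ℝ, Integrable H (noiseLaw d) ∧
      (∀ n, f P R₁ (nextBound P h a ‖q‖ (coupledDist P.γ h q n)) ≤ H n) ∧
      ∫ n, H n ∂noiseLaw d ≤ (1 - rate P R₁ h * h) * f P R₁ (alpha P * a + ‖q‖) := by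
  have hh := hb.h_pos
  have hα := alpha_pos hP
  have hγ := hP.γ_pos
  have hx : 0 < P.γ * h := mul_pos hγ hh
  have hσ : 0 < √(2 * P.γ⁻¹ * h) := by positivity
  have hT := integrable_coupledDist hσ rfl q
  have hET := integral_coupledDist hσ rfl q
  have hprob := measureReal_coupledDist_ne_zero_le hσ rfl q
  have hq0 := norm_nonneg q
  have hA := alpha_mul_le hP hb
  have hrate := rate_mul_f_le hP hR.le hh ha hq0 hab
  have hdrop := slope_drop hP hR hb ha hq0 hab hrR hnear
  generalize hσe : √(2 * P.γ⁻¹ * h) = σ at *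
  generalize ‖q‖ = b at *
  have hS : MeasurableSet {n : Pos d × Pos d × ℝ | coupledDist P.γ h q n ≠ 0} :=
    (measurable_coupledDist q (measurableSet_singleton 0)).compl
  have hαa : 0 ≤ alpha P * a := by positivity
  set r := alpha P * a + b with hr
  have hr0 : 0 ≤ r := by positivity
  have hs := slope_pos hP hR.le hr0
  have hm0 : 0 ≤ r - b / 2 := by linarith
  set M := alpha P * a + 3 / 2 * σ with hM
  have hM0 : 0 ≤ M := by positivity
  set D₁ := slope P R₁ (r - b / 2) - slope P R₁ r with hD₁
  set D₂ := slope P R₁ r - slope P R₁ M with hD₂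
  have hD₁0 : 0 ≤ D₁ := sub_nonneg.2 (slope_antitoneOn hP hR.le (mem_Ici.2 hm0) (mem_Ici.2 hr0)
    (by linarith))
  have hD₂0 : 0 ≤ D₂ := sub_nonneg.2 (slope_antitoneOn hP hR.le (mem_Ici.2 hr0) (mem_Ici.2 hM0)
    (by linarith))
  have hω := defect_nonneg hP hh
  have hωδ := sub_nonneg.2 (defect_le_damping hP hb)
  have hδA : alpha P * damping P h ≤ alpha P * (P.γ * h) := by
    gcongr
    exact damping_le hP hh
  have hχ : alpha P * (damping P h - defect P h) * b ≤ 1 / 100 * b := by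
    gcongr
    nlinarith [mul_nonneg hα.le hω]
  have hint := integrable_affine_indicator hT hS
    (f P R₁ r + (looseBound P h a b 0 - r) * slope P R₁ r - 49 / 100 * b * D₁)
    ((1 + alpha P * defect P h) * slope P R₁ r - D₂) (49 / 100 * b * D₁ + 3 / 2 * σ * D₂)
  have hval := integral_affine_indicator hT hS
    (f P R₁ r + (looseBound P h a b 0 - r) * slope P R₁ r - 49 / 100 * b * D₁)
    ((1 + alpha P * defect P h) * slope P R₁ r - D₂) (49 / 100 * b * D₁ + 3 / 2 * σ * D₂)
  refine ⟨_, hint, fun n => ?_, ?_⟩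
  · have hT0 := coupledDist_nonneg (γ := P.γ) (h := h) q n
    obtain ⟨hw, hfw⟩ := f_nextBound_le hP hR.le hb ha hq0 hT0
    refine hfw.trans ?_
    have ew : looseBound P h a b 0 + (1 + alpha P * defect P h) * coupledDist P.γ h q n
        = looseBound P h a b (coupledDist P.γ h q n) := by
      simp only [looseBound]
      ring
    -- On coalescence the tangent at `r - b/2` is used, and the new value lies at least `(49/100) b`
    -- below that point. Otherwise the tangent at `M` is used, which is beneficial on average
    -- although single terms may be positive.
    by_cases hn : coupledDist P.γ h q n = 0
    · rw [indicator_of_notMem (by simpa using hn)]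
      have h1 := f_le_two_tangents hP hR.le hr0 hm0 hw
      have h2 : looseBound P h a b (coupledDist P.γ h q n) - (r - b / 2) ≤ -(49 / 100 * b) := by
        rw [hn, looseBound, hr]
        linarith
      have h3 := mul_le_mul_of_nonneg_right h2 hD₁0
      rw [← ew] at h1 h3 ⊢
      rw [hn] at h1 h3 ⊢
      linarith
    · rw [indicator_of_mem (show n ∈ {n | coupledDist P.γ h q n ≠ 0} from hn), Pi.one_apply]
      have h1 := f_le_two_tangents hP hR.le hr0 hM0 hw
      have h2 : coupledDist P.γ h q n - 3 / 2 * σ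
          ≤ looseBound P h a b (coupledDist P.γ h q n) - M := by
        have h4 : 0 ≤ alpha P * (damping P h - defect P h) * b := by positivity
        have h5 : 0 ≤ alpha P * defect P h * coupledDist P.γ h q n := by positivity
        rw [looseBound, hM]
        linarith
      have h3 := mul_le_mul_of_nonneg_right h2 hD₂0
      rw [← ew] at h1 h3 ⊢
      linarith
  · rw [hval, hET]
    have h8 : f P R₁ r + (looseBound P h a b 0 - r) * slope P R₁ r - 49 / 100 * b * D₁
        + ((1 + alpha P * defect P h) * slope P R₁ r - D₂) * b
        = f P R₁ r + alpha P * damping P h * b * slope P R₁ r - 49 / 100 * b * D₁ - D₂ * b := by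
      rw [looseBound, hr]
      ring
    have h2 : alpha P * damping P h * b * slope P R₁ r
        ≤ alpha P * (P.γ * h) * b * slope P R₁ r := by gcongr
    set p := (noiseLaw d).real {n : Pos d × Pos d × ℝ | coupledDist P.γ h q n ≠ 0}
    have hbσ : b / σ ≤ 7 / 10 := by
      rw [div_le_iff₀ hσ]
      exact hnear
    -- The net gains are `0.49(1 - 0.28) b D₁` and `(1 - 3/5) b D₂`, both at least `(7/20) b` times
    -- the drop. Since `(7/20) · 5 ≥ 3/2`, drift and rate are covered.
    have h3 : 49 / 100 * b * D₁ * p ≤ 49 / 100 * b * D₁ * (2 / 5 * (7 / 10)) := by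
      gcongr
      linarith
    have h4 : 3 / 2 * σ * D₂ * p ≤ 3 / 5 * b * D₂ := by
      calc 3 / 2 * σ * D₂ * p ≤ 3 / 2 * σ * D₂ * (2 / 5 * (b / σ)) := by gcongr
        _ = _ := by
          field_simp
    have h5 : 7 / 20 * b * (5 * (alpha P * (P.γ * h)) * slope P R₁ r)
        ≤ 7 / 20 * b * (D₁ + D₂) := by
      gcongr
      rw [hD₁, hD₂]
      linarith
    have h6 : 0 ≤ b * D₁ := by positivity
    have h7 : 0 ≤ b * D₂ := by positivity
    have h9 : 0 ≤ alpha P * (P.γ * h) * b * slope P R₁ r := by positivity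
    rw [h8]
    linarith

/-- The average contraction of `f(r_s)` when `Δ < D_𝒦`. -/
theorem exists_bound_contractive (hP : P.Admissible) (hR : 0 < R₁) (hb : StepBounds P R₁ h)
    {a : ℝ} (q : Pos d) (ha : 0 ≤ a) (hrR : alpha P * a + ‖q‖ ≤ R₁) :
    ∃ H : Pos d × Pos d × ℝ → ℝ, Integrable H (noiseLaw d) ∧
      (∀ n, f P R₁ (nextBound P h a ‖q‖ (coupledDist P.γ h q n)) ≤ H n) ∧
      ∫ n, H n ∂noiseLaw d ≤ (1 - rate P R₁ h * h) * f P R₁ (alpha P * a + ‖q‖) := by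
  rcases le_total (4 * ‖q‖) a with h1 | h1
  · exact exists_bound_of_le hP hR.le hb q ha h1
  · rcases le_total (7 / 10 * √(2 * P.γ⁻¹ * h)) ‖q‖ with h2 | h2
    · exact exists_bound_of_far hP hR.le hb q ha h1 hrR h2
    · exact exists_bound_of_near hP hR hb q ha h1 hrR h2

end Contractive

/-! ### One step of the coupled chain -/

section OneStep

variable {d : ℕ} {U G : Pos d → ℝ} {K : Pos d →L[ℝ] Pos d} {P : Params} {h : ℝ}

/-- With lower integrals only the majorant has to be integrable; integrability of `ρ` along the
chain is then a conclusion of the induction. -/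
theorem lintegral_ofReal_le_of_bound {Ω : Type*} [MeasurableSpace Ω] {ν : Measure Ω} {V H : Ω → ℝ}
    {c : ℝ} (hV : ∀ n, 0 ≤ V n) (hVH : ∀ n, V n ≤ H n) (hH : Integrable H ν)
    (hc : ∫ n, H n ∂ν ≤ c) : ∫⁻ n, ENNReal.ofReal (V n) ∂ν ≤ ENNReal.ofReal c :=
  calc ∫⁻ n, ENNReal.ofReal (V n) ∂ν ≤ ∫⁻ n, ENNReal.ofReal (H n) ∂ν :=
        lintegral_mono fun n => ENNReal.ofReal_le_ofReal (hVH n)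
    _ = ENNReal.ofReal (∫ n, H n ∂ν) := (ofReal_integral_eq_lintegral_ofReal hH
        (ae_of_all _ fun n => (hV n).trans (hVH n))).symm
    _ ≤ ENNReal.ofReal c := ENNReal.ofReal_le_ofReal hc

theorem lintegral_rho_coupledStep_le (hP : P.Admissible) (hU : PotentialAssumption U P.κ P.R P.L)
    (hG : IsSplitting U K G P) (hb : StepBounds P (R1 P K) h) (p : State d × State d) :
    ∫⁻ n, ENNReal.ofReal (rho P K (coupledStep U K P h p n).1 (coupledStep U K P h p n).2)
        ∂noiseLaw d
      ≤ ENNReal.ofReal ((1 - rate P (R1 P K) h * h) * rho P K p.1 p.2) := by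
  have hK := hG.quadratic
  have hdist := isDistance_rho hP hK
  have hR := R1_nonneg hP hK
  by_cases hsync : DK P K + eps P * rl P K p.1 p.2 ≤ rs P p.1 p.2
  · refine lintegral_ofReal_le_of_bound (fun n => hdist.nonneg _ _) (fun n => ?_)
      (integrable_const _) (by rw [integral_const, probReal_univ, one_smul])
    rw [coupledStep, coupledNoise, if_pos hsync]
    refine rho_synchronous_le hP hU.differentiable hG hb ?_ _ _
    rw [Delta]
    linarith
  · push Not at hsync
    have hΔ : Delta P K p.1 p.2 < DK P K := by
      rw [Delta]
      linarith
    -- If `R₁ = 0` then `D_𝒦 = 0`, while `Δ ≥ r_s/2 ≥ 0`, contradicting `Δ < D_𝒦`.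
    have hR0 : 0 < R1 P K := by
      refine hR.lt_of_ne' fun h0 => ?_
      have h1 := DK_eq_zero_of_R1_eq_zero hP hK h0
      have h2 := rs_le_two_mul_Delta hP hK p.1 p.2
      have h3 := rs_nonneg hP p.1 p.2
      linarith
    generalize hz : p.1.1 - p.2.1 = z
    generalize hq : z + P.γ⁻¹ • (p.1.2 - p.2.2) = q
    have hrs := rs_eq hz hq
    have hrR := rs_le_R1 hP hK hΔ.le
    rw [hrs] at hrR
    obtain ⟨H, hH, hle, hint⟩ := exists_bound_contractive hP hR0 hb q (norm_nonneg z) hrR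
    refine lintegral_ofReal_le_of_bound (fun n => hdist.nonneg _ _) (fun n => ?_) hH ?_
    · refine le_trans ?_ (hle n)
      rw [coupledStep, coupledNoise, if_neg (not_le.2 hsync), hz, hq, rho_eq]
      refine f_monotoneOn hP hR ?_ ?_ ((min_le_left _ _).trans (rs_contractive_le hP hU hb hz hq n))
      · exact le_min (rs_nonneg hP _ _)
          (add_nonneg (DK_nonneg hP) (mul_nonneg (eps_pos hP).le (rl_nonneg _ _)))
      · exact nextBound_nonneg hP hb (norm_nonneg z) (norm_nonneg q) (coupledDist_nonneg q n)
    · rwa [rho_eq, min_eq_left hsync.le, hrs]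

theorem continuous_gradient (hU : PotentialAssumption U P.κ P.R P.L) :
    Continuous (gradient U) := by
  refine (LipschitzWith.of_dist_le' (K := P.L) fun x y => ?_).continuous
  rw [dist_eq_norm, dist_eq_norm]
  exact hU.lipschitz x y

theorem continuous_rs : Continuous fun p : State d × State d => rs P p.1 p.2 := by
  unfold rs
  fun_prop

theorem continuous_rl : Continuous fun p : State d × State d => rl P K p.1 p.2 := by
  unfold rl
  have h1 : Continuous fun p : State d × State d => ⟪p.1.1 - p.2.1, K (p.1.1 - p.2.1)⟫ :=
    Continuous.inner (by fun_prop) (by fun_prop)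
  fun_prop

theorem continuous_rho : Continuous fun p : State d × State d => rho P K p.1 p.2 := by
  have h1 := continuous_rs (d := d) (P := P)
  have h2 := continuous_rl (d := d) (P := P) (K := K)
  have h3 : Continuous fun p : State d × State d =>
      min (rs P p.1 p.2) (DK P K + eps P * rl P K p.1 p.2) := by fun_prop
  simp only [rho_eq]
  exact continuous_f.comp h3

theorem continuous_stepBU (hU : PotentialAssumption U P.κ P.R P.L) :
    Continuous fun p : State d × Pos d × Pos d => stepBU U P.γ h p.1 p.2.1 p.2.2 := by
  have h1 := continuous_gradient hU
  have h2 : Continuous fun p : State d × Pos d × Pos d => gradient U p.1.1 := by fun_prop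
  unfold stepBU stepU stepB Z1 Z2
  fun_prop

theorem measurable_coupledStep (hU : PotentialAssumption U P.κ P.R P.L) :
    Measurable fun x : (State d × State d) × Pos d × Pos d × ℝ =>
      coupledStep U K P h x.1 x.2 := by
  have h1 := (continuous_stepBU (h := h) hU).measurable
  have h2 := (continuous_rs (d := d) (P := P)).measurable
  have h3 := (continuous_rl (d := d) (P := P) (K := K)).measurable
  have hnoise : Measurable fun x : (State d × State d) × Pos d × Pos d × ℝ =>
      coupledNoise P K h x.1.1 x.1.2 x.2.1 x.2.2.2 := by
    unfold coupledNoise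
    refine Measurable.ite (measurableSet_le ?_ ?_) (by fun_prop) ?_
    · exact measurable_const.add (measurable_const.mul (h3.comp measurable_fst))
    · exact h2.comp measurable_fst
    · exact (measurable_contractiveNoise P.γ h).comp
        (f := fun x : (State d × State d) × Pos d × Pos d × ℝ =>
          ((x.1.1.1 - x.1.2.1) + P.γ⁻¹ • (x.1.1.2 - x.1.2.2), x.2.1, x.2.2.2)) (by fun_prop)
  unfold coupledStep
  refine Measurable.prodMk ?_ ?_
  · exact h1.comp (f := fun x : (State d × State d) × Pos d × Pos d × ℝ =>
      (x.1.1, x.2.1, x.2.2.1)) (by fun_prop)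
  · exact h1.comp (f := fun x : (State d × State d) × Pos d × Pos d × ℝ =>
      (x.1.2, coupledNoise P K h x.1.1 x.1.2 x.2.1 x.2.2.2, x.2.2.1))
      (measurable_fst.snd.prodMk (hnoise.prodMk (by fun_prop)))

end OneStep

/-! ### The coupled chain -/

section Chain

variable {d : ℕ} {U G : Pos d → ℝ} {K : Pos d →L[ℝ] Pos d} {P : Params} {h : ℝ} {Ω : Type*}

/-- The coupled chain at time `k` is a measurable function of the first `k` noises. -/
theorem exists_coupledChain_eq (hU : PotentialAssumption U P.κ P.R P.L)
    (N : ℕ → Ω → Pos d × Pos d × ℝ) (p : State d × State d) (k : ℕ) :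
    ∃ F : (Finset.range k → Pos d × Pos d × ℝ) → State d × State d, Measurable F ∧
      ∀ ω, coupledChain U K P h p N k ω = F fun i => N i ω := by
  induction k with
  | zero => exact ⟨fun _ => p, measurable_const, fun _ => rfl⟩
  | succ k ih =>
    obtain ⟨F, hF, hFe⟩ := ih
    refine ⟨fun g => coupledStep U K P h
      (F fun i => g ⟨i, Finset.mem_range.2 ((Finset.mem_range.1 i.2).trans k.lt_succ_self)⟩)
      (g ⟨k, Finset.self_mem_range_succ k⟩), ?_, fun ω => ?_⟩
    · have h1 : Measurable fun g : Finset.range (k + 1) → Pos d × Pos d × ℝ =>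
          F fun i => g ⟨i, Finset.mem_range.2 ((Finset.mem_range.1 i.2).trans k.lt_succ_self)⟩ :=
        hF.comp (measurable_pi_lambda _ fun i => measurable_pi_apply _)
      exact (measurable_coupledStep hU).comp (h1.prodMk (measurable_pi_apply _))
    · rw [coupledChain, hFe]

variable [MeasurableSpace Ω] {μ : Measure Ω} {N : ℕ → Ω → Pos d × Pos d × ℝ}

theorem aemeasurable_coupledChain (hU : PotentialAssumption U P.κ P.R P.L)
    (hN : ∀ k, AEMeasurable (N k) μ) (p : State d × State d) (k : ℕ) :
    AEMeasurable (coupledChain U K P h p N k) μ := by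
  obtain ⟨F, hF, hFe⟩ := exists_coupledChain_eq (K := K) (h := h) hU N p k
  rw [show coupledChain U K P h p N k = F ∘ fun ω (i : Finset.range k) => N i ω from funext hFe]
  exact hF.comp_aemeasurable (aemeasurable_pi_lambda _ fun i => hN i)

theorem indepFun_coupledChain (hU : PotentialAssumption U P.κ P.R P.L) (hind : iIndepFun N μ)
    (hN : ∀ k, AEMeasurable (N k) μ) (p : State d × State d) (k : ℕ) :
    IndepFun (coupledChain U K P h p N k) (N k) μ := by
  obtain ⟨F, hF, hFe⟩ := exists_coupledChain_eq (K := K) (h := h) hU N p k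
  have h1 := hind.indepFun_finset₀ (Finset.range k) {k} (by simp) hN
  have h2 := h1.comp hF (measurable_pi_apply (⟨k, Finset.mem_singleton_self k⟩ : ({k} : Finset ℕ)))
  rw [show coupledChain U K P h p N k = F ∘ fun ω (i : Finset.range k) => N i ω from funext hFe]
  exact h2

/-- The state at time `k` depends on the noises before `k` only, so its joint law with the next
noise is a product. Tonelli's theorem then applies the one-step bound at each fixed pair of states.
-/
theorem lintegral_rho_coupledChain_le [IsProbabilityMeasure μ] (hP : P.Admissible)
    (hU : PotentialAssumption U P.κ P.R P.L) (hG : IsSplitting U K G P)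
    (hb : StepBounds P (R1 P K) h) (hind : iIndepFun N μ)
    (hN : ∀ k, HasLaw (N k) (noiseLaw d) μ) (p : State d × State d) (k : ℕ) :
    ∫⁻ ω, ENNReal.ofReal (rho P K (coupledChain U K P h p N k ω).1
        (coupledChain U K P h p N k ω).2) ∂μ
      ≤ ENNReal.ofReal ((1 - rate P (R1 P K) h * h) ^ k * rho P K p.1 p.2) := by
  have hNm (k : ℕ) : AEMeasurable (N k) μ := (hN k).aemeasurable
  have hc : 0 ≤ 1 - rate P (R1 P K) h * h :=
    sub_nonneg.2 (rate_mul_lt_one hP (R1_nonneg hP hG.quadratic) hb.h_pos hb.γh_le).le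
  have hV : Measurable fun p : State d × State d => ENNReal.ofReal (rho P K p.1 p.2) :=
    ENNReal.measurable_ofReal.comp continuous_rho.measurable
  induction k with
  | zero => simp [coupledChain]
  | succ k ih =>
    have hX := aemeasurable_coupledChain (K := K) (h := h) hU hNm p k
    have hmap := (indepFun_iff_map_prod_eq_prod_map_map hX (hNm k)).1
      (indepFun_coupledChain hU hind hNm p k)
    rw [(hN k).map_eq] at hmap
    have hstep : Measurable fun x : (State d × State d) × Pos d × Pos d × ℝ =>
        ENNReal.ofReal (rho P K (coupledStep U K P h x.1 x.2).1
          (coupledStep U K P h x.1 x.2).2) :=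
      hV.comp (measurable_coupledStep (K := K) (h := h) hU)
    calc ∫⁻ ω, ENNReal.ofReal (rho P K (coupledChain U K P h p N (k + 1) ω).1
          (coupledChain U K P h p N (k + 1) ω).2) ∂μ
        = ∫⁻ x, ENNReal.ofReal (rho P K (coupledStep U K P h x.1 x.2).1
            (coupledStep U K P h x.1 x.2).2)
            ∂(μ.map (coupledChain U K P h p N k)).prod (noiseLaw d) := by
          rw [← hmap]
          exact (lintegral_map' hstep.aemeasurable (hX.prodMk (hNm k))).symm
      _ = ∫⁻ r, ∫⁻ n, ENNReal.ofReal (rho P K (coupledStep U K P h r n).1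
            (coupledStep U K P h r n).2) ∂noiseLaw d ∂μ.map (coupledChain U K P h p N k) :=
          lintegral_prod _ hstep.aemeasurable
      _ ≤ ∫⁻ r, ENNReal.ofReal ((1 - rate P (R1 P K) h * h) * rho P K r.1 r.2)
            ∂μ.map (coupledChain U K P h p N k) :=
          lintegral_mono fun r => lintegral_rho_coupledStep_le hP hU hG hb r
      _ = ENNReal.ofReal (1 - rate P (R1 P K) h * h) *
            ∫⁻ ω, ENNReal.ofReal (rho P K (coupledChain U K P h p N k ω).1
              (coupledChain U K P h p N k ω).2) ∂μ := by
          simp only [ENNReal.ofReal_mul hc]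
          rw [lintegral_const_mul _ hV, lintegral_map' hV.aemeasurable hX]
      _ ≤ ENNReal.ofReal (1 - rate P (R1 P K) h * h) *
            ENNReal.ofReal ((1 - rate P (R1 P K) h * h) ^ k * rho P K p.1 p.2) := by gcongr
      _ = _ := by
          rw [← ENNReal.ofReal_mul hc]
          congr 1
          ring

theorem integrable_rho_coupledChain [IsProbabilityMeasure μ] (hP : P.Admissible)
    (hU : PotentialAssumption U P.κ P.R P.L) (hG : IsSplitting U K G P)
    (hb : StepBounds P (R1 P K) h) (hind : iIndepFun N μ)
    (hN : ∀ k, HasLaw (N k) (noiseLaw d) μ) (p : State d × State d) (k : ℕ) :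
    Integrable (fun ω => rho P K (coupledChain U K P h p N k ω).1
        (coupledChain U K P h p N k ω).2) μ ∧
      ∫ ω, rho P K (coupledChain U K P h p N k ω).1 (coupledChain U K P h p N k ω).2 ∂μ
        ≤ (1 - rate P (R1 P K) h * h) ^ k * rho P K p.1 p.2 := by
  have hdist := isDistance_rho hP hG.quadratic
  have hle := lintegral_rho_coupledChain_le hP hU hG hb hind hN p k
  have hX := aemeasurable_coupledChain (K := K) (h := h) hU (fun k => (hN k).aemeasurable) p k
  have hm : AEStronglyMeasurable (fun ω => rho P K (coupledChain U K P h p N k ω).1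
      (coupledChain U K P h p N k ω).2) μ :=
    (continuous_rho.measurable.comp_aemeasurable hX).aestronglyMeasurable
  have h0 : 0 ≤ᵐ[μ] fun ω => rho P K (coupledChain U K P h p N k ω).1
      (coupledChain U K P h p N k ω).2 := ae_of_all _ fun ω => hdist.nonneg _ _
  have hc : 0 ≤ 1 - rate P (R1 P K) h * h :=
    sub_nonneg.2 (rate_mul_lt_one hP (R1_nonneg hP hG.quadratic) hb.h_pos hb.γh_le).le
  refine ⟨⟨hm, (hasFiniteIntegral_iff_ofReal h0).2 (hle.trans_lt ENNReal.ofReal_lt_top)⟩, ?_⟩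
  rw [integral_eq_lintegral_of_nonneg_ae h0 hm]
  exact ENNReal.toReal_le_of_le_ofReal (mul_nonneg (pow_nonneg hc k) (hdist.nonneg _ _)) hle

end Chain

end KineticBU

theorem mainTheorem2 {d : ℕ} (U G : KineticBU.Pos d → ℝ)
    (K : KineticBU.Pos d →L[ℝ] KineticBU.Pos d) (P : KineticBU.Params) (h : ℝ)
    (hU : KineticBU.PotentialAssumption U P.κ P.R P.L)
    (hG : KineticBU.IsSplitting U K G P)
    (hγ_pos : 0 < P.γ) (hh_pos : 0 < h)
    (hγ : √(13 * P.LG ^ 2 / P.κ) ≤ P.γ)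
    (hh : KineticBU.StepSizeCondition P (KineticBU.R1 P K) h) :
    -- `ρ` is a distance
    KineticBU.IsDistance (KineticBU.rho P K) ∧
    -- the rate is positive and `1 - c h` is a genuine contraction factor
    0 < KineticBU.rate P (KineticBU.R1 P K) h ∧
    KineticBU.rate P (KineticBU.R1 P K) h * h < 1 ∧
    -- contraction of the coupled chain from every pair of initial points
    (∀ {Ω : Type*} [MeasurableSpace Ω] (μ : MeasureTheory.Measure Ω)
      [MeasureTheory.IsProbabilityMeasure μ]
      (N : ℕ → Ω → KineticBU.Pos d × KineticBU.Pos d × ℝ),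
      ProbabilityTheory.iIndepFun N μ →
      (∀ k, ProbabilityTheory.HasLaw (N k) (KineticBU.noiseLaw d) μ) →
      ∀ (s s' : KineticBU.State d) (k : ℕ),
        MeasureTheory.Integrable (fun ω => KineticBU.rho P K
          (KineticBU.coupledChain U K P h (s, s') N k ω).1
          (KineticBU.coupledChain U K P h (s, s') N k ω).2) μ ∧
        ∫ ω, KineticBU.rho P K
          (KineticBU.coupledChain U K P h (s, s') N k ω).1
          (KineticBU.coupledChain U K P h (s, s') N k ω).2 ∂μ
          ≤ (1 - KineticBU.rate P (KineticBU.R1 P K) h * h) ^ k * KineticBU.rho P K s s') ∧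
    -- the constants entering `ρ` and the rate do not depend on the dimension
    (∀ (d' : ℕ) (K' : KineticBU.Pos d' →L[ℝ] KineticBU.Pos d'),
      KineticBU.IsQuadraticPart K' P.κ P.LK →
        KineticBU.DK P K' = KineticBU.DK P K ∧ KineticBU.R1 P K' = KineticBU.R1 P K) := by
  have hP := KineticBU.Params.admissible hU hG hγ_pos hγ
  have hK := hG.quadratic
  have hR := KineticBU.R1_nonneg hP hK
  have hb := hh.stepBounds hP hR hh_pos
  refine ⟨KineticBU.isDistance_rho hP hK, KineticBU.rate_pos hP hR,
    KineticBU.rate_mul_lt_one hP hR hh_pos hb.γh_le, ?_, ?_⟩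
  · intro Ω _ μ _ N hind hN s s' k
    exact KineticBU.integrable_rho_coupledChain hP hU hG hb hind hN (s, s') k
  · intro d' K' hK'
    exact ⟨KineticBU.DK_eq_DK hP hK hK', KineticBU.R1_eq_R1 hP hK hK'⟩
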